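/- **Setting.** Let $u,v,x^3,x^4,\dots,x^N$ ($N\ge 3$) be coordinates on a coordinate box $\Omega$ (a product of nonempty open intervals); $e,f$ and $i,j,k$ run over $3,\dots,N$, while $r,n,m,p$ run over $4,\dots,N$. All functions are $C^\infty$; a comma denotes a partial derivative, and $F(u,x^r)$ etc. indicates the only coordinates on which $F$ depends. Consider a metric (with covariantly constant null vector $\ell=\partial_v$) $$ds^2=2\,du\,[dv+H\,du+\hat W_e\,dx^e]+g_{ef}\,dx^e dx^f ,\qquad g_{ef}=\sum_i m_{ie}m_{if},$$ with $H,\hat W_e,m_{ie}$ independent of $v$, $\hat W_3=0$, and $(m_{ie})$ upper triangular and invertible. Let $(m_i{}^e)$ satisfy $\sum_e m_i{}^e m_{je}=\delta_{ij}$, and put $W_i=m_i{}^e\hat W_e$ (so $W_3=0$), $$\ell=D_1=\partial_v,\qquad n=D_2=\partial_u-H\partial_v,\qquad m_i=D_i=m_i{}^e(\partial_e-\hat W_e\partial_v),$$ $B_{ij}=m_{ie,u}m_j{}^e$, $B_{(ij)}=\frac12(B_{ij}+B_{ji})$, $J_i=D_iH-D_2W_i-\sum_jB_{ji}W_j$,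 $D_{ijk}=m_{ie,f}(m_j{}^em_k{}^f-m_k{}^em_j{}^f)$, $A_{ij}=D_jW_i-D_iW_j+\sum_kD_{kij}W_k$, and $\Gamma_{abc}=g(e_a,\nabla_{e_c}e_b)$ for the frame $e_1=\ell$, $e_2=n$, $e_i=m_i$. Consider vector fields of the form $$X=X_1 n+X_2\ell+X_3 m_3 ,$$ and set $X_i=0$ for $i\ge4$. An integral $\int f\,dc$ in a coordinate $c$ is the antiderivative vanishing where $c$ takes its value at a fixed, arbitrary point of $\Omega$. A *change of coordinates* is an injective smooth map between boxes that carries one metric of the above kind (with all the stated conventions) and its field $X$ to another such metric and field and preserves $\ell=\partial_v$. **Killing equations.** $X$ is Killing on $\Omega$ if and only if $$X_{1,v}=0,\quad X_{1,u}+X_{2,v}=0,\quad m_3{}^eX_{1,e}+X_{3,v}=0,\quad m_n{}^eX_{1,e}=0,$$ $$D_2X_2+\sum_iJ_iX_i=0,\qquad D_iX_2+D_2X_i-J_iX_1-\sum_j(A_{ji}+B_{ij})X_j=0,$$ $$D_jX_i+D_iX_j+2B_{(ij)}X_1-\sum_k(\Gamma_{kij}+\Gamma_{kji})X_k=0 .$$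 If $X$ is Killing, then $X_1=F_1(u,x^e)$, $X_2=-D_2(X_1)v+F_2(u,x^e)$, $X_3=-D_3(X_1)v+F_3(u,x^e)$, and either (Case 1) $D_3X_1=0$ on $\Omega$, or (Case 2) $\Gamma_{3ia}=0$ on $\Omega$ for all $i$ and all frame indices $a$. **Case 1: $D_3X_1=0$.** If $X$ is Killing, then $X_1=c_1u+c_2$ with constants $c_1,c_2$. If $c_1\neq0$, then the translation of $u$ by $c_2/c_1$ is a change of coordinates after which the Killing vector $c_1^{-1}X$ has $X_1=u$; if $c_1=0\ne c_2$, then $c_2^{-1}X$ has $X_1=1$. For $F_2,F_3$ functions of $(u,x^e)$ the following holds. *1.1 ($F_3=0$).* (i) Let $u\ne0$ on $\Omega$. $X=un+(F_2-v)\ell$ is Killing if and only if $g_{ef}$ is independent of $u$ and there are $f_2(x^e)$, $g_2(u,x^r)$, $B_n(x^e)$ with $$F_2=\frac{f_2}{u}+\frac{g_2}{u},\qquad H=\frac{f_2}{u^2}-\frac{g_{2,u}}{u}+\frac{g_2}{u^2},\qquad W_n=\frac{B_n-D_ng_2}{u}.$$ Moreover, if $X$ is Killing, then near every point a change of coordinates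 $v\to v+h(u,x^r)$ brings these data to the form in which $g_2=g_2(u)$ depends on $u$ only and $W_n=B_n(x^e)/u$, so that $F_2=\frac{f_2(x^e)}{u}+\frac{g_2(u)}{u}$ and $H=\frac{f_2(x^e)}{u^2}-\frac{g_2'(u)}{u}+\frac{g_2(u)}{u^2}$. (ii) $X=n+F_2\ell$ is Killing if and only if $g_{ef}$ is independent of $u$, $F_{2,u}=0$, and there are $A_0(u,x^r)$, $C_n(x^e)$ with $H=F_2+A_0$ and $W_n=\int D_nA_0\,du+C_n$. *1.2 (general $F_3$).* (i) Let $u\ne0$ on $\Omega$. $X=un+(F_2-v)\ell+F_3m_3$ is Killing if and only if, with $X_1=u$, $$m_{33}=-\int\frac{F_{3,3}}{X_1}du+A_1(x^e),\quad m_{nr,u}=-m_{nr,3}\frac{F_3}{m_{33}X_1},\quad m_{3r,u}=-\frac{F_{3,r}}{X_1}-(m_{3r,3}-m_{33,r})\frac{m_3{}^3F_3}{X_1}\tag{T}$$ for some $A_1$, and $$H=-D_2F_2-\frac{D_2(F_3^2)}{2u}-\frac{F_3D_3F_2}{u}-\frac{F_3D_3(F_3^2)}{2u^2},\qquad uD_3H=D_3F_2+D_2F_3+\frac{D_3(F_3^2)}{2u},$$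 $$D_2(uW_n)+F_3D_3W_n+D_n(F_2-uH)=0 .$$ (ii) $X=n+F_2\ell+F_3m_3$ is Killing if and only if (T) holds with $X_1=1$ and $$D_2F_2+F_3D_3F_2+\tfrac12D_2(F_3^2)+\tfrac12F_3D_3(F_3^2)=0,$$ $$H=\int m_{33}D_2F_3\,dx^3+F_2+\tfrac12F_3^2+A_2(u,x^r)\ \text{ for some }A_2,\qquad F_3D_3W_n+D_2W_n=D_n(H-F_2).$$ (iii) Let $F_3\ne0$ at every point. $X=F_2\ell+F_3m_3$ is Killing if and only if $$F_{3,3}=0,\quad m_{nr,3}=0,\quad F_{3,r}+(m_{3r,3}-m_{33,r})m_3{}^3F_3=0,\quad D_2\log|m_{33}|=\frac{D_3F_2}{F_3}+D_2\log|F_3|,$$ $$W_n=-\int\frac{m_{33}D_nF_2}{F_3}dx^3+E_n(u,x^r),\qquad H=-\int\frac{m_{33}D_2F_2}{F_3}dx^3+A_3(u,x^r)$$ for some $E_n$, $A_3$. **Case 2: $\Gamma_{3ia}=0$.** Near every point there is a change of coordinates, leaving $u$ and the $x^r$ fixed, after which $$m_{33}=M_{,3}(u,x^3),\qquad m_{3r}=0,\qquad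 m_{nr}=m_{nr}(u,x^r),\qquad D_3W_n=0 ;\tag{S}$$ and when $m_{3r}=0$ already, $\Gamma_{3ia}=0$ on $\Omega$ is equivalent to (S). Assume (S). If $X$ is Killing, then $X_1=F_1(u,x^3)$, $B_{(mn)}X_1=0$ everywhere, and either $X_1=0$ on $\Omega$ or $B_{(mn)}=0$ on $\Omega$ for all $m,n$. *2.1 ($X_1=0$).* Let $F_3\neq0$ at every point. $X=F_2\ell+F_3m_3$ is Killing if and only if $F_{2,r}=0$, $F_{3,e}=0$, and the equations of 1.2 (iii) for $\log|m_{33}|$, $W_n$ and $H$ hold. *2.2 ($B_{(mn)}=0$).* If $B_{(mn)}=0$, then $m_{nr,u}=0$, $m_r{}^3=0$, and $B_{33}$ is the only component of $B$ that can be nonzero. If $F_1=F_1(u,x^3)$ with $F_{1,3}\neq0$ everywhere, then $X=F_1n+(F_2-D_2(F_1)v)\ell+(F_3-D_3(F_1)v)m_3$ is Killing if and only if $B_{(mn)}=0$ and $$\frac{m_{33,3}}{m_{33}}=\frac{F_{1,33}}{F_{1,3}},\qquad\frac{m_{33,u}}{m_{33}}=\frac{F_{1,3u}}{F_{1,3}},$$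 $$H=\frac{D_3D_2F_1}{(D_3F_1)^2}F_3-\frac{D_2^2F_1}{(D_3F_1)^2}F_1-\frac{D_2F_3+D_3F_2}{D_3F_1},\qquad W_n=-\frac{D_nF_3}{D_3F_1},$$ $$F_3=-\int\frac{m_{33}F_1D_3D_2F_1}{D_3F_1}dx^3+A_6(u,x^r)\ \text{ for some }A_6,$$ together with the differential equations for $F_2$ $$D_2F_2+HD_2F_1+F_3D_3H=0,\quad D_2^2F_1+D_3F_1D_3H=0,\quad D_2(F_1W_n)+D_nF_2-F_1D_nH=0 .$$ -/

import Mathlib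

open scoped ContDiff

noncomputable section

namespace Kundt

/-- Coordinate labels `u, v, x^e`.  The transverse label `e` runs over `Fin (k + 1)`; the value `0`
is the distinguished transverse direction (written `x^3`), the values `r.succ` are the remaining
directions (written `x^r`, `r ≥ 4`). -/
inductive Coord (k : ℕ) where
  | u : Coord k
  | v : Coord k
  | x (e : Fin (k + 1)) : Coord k
  deriving DecidableEq, Fintype

/-- Labels of the frame `ℓ = D_1`, `n = D_2`, `m_i = D_i`; `tr 0` is `m_3`, `tr r.succ` the others. -/
inductive FrameIdx (k : ℕ) where
  | one : FrameIdx k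
  | two : FrameIdx k
  | tr (i : Fin (k + 1)) : FrameIdx k

/-- Points of the coordinate space. -/
abbrev Pt (k : ℕ) := Coord k → ℝ

/-- Scalar functions of the coordinates. -/
abbrev SF (k : ℕ) := Pt k → ℝ

/-- Vector fields, by their coordinate components. -/
abbrev VF (k : ℕ) := Pt k → Coord k → ℝ

variable {k : ℕ}

/-- The partial derivative `f_{,c}`. -/
def pd (c : Coord k) (f : SF k) : SF k := fun p => fderiv ℝ f p (Pi.single c 1)

/-- The derivative of a function along a vector field. -/
def along (Y : VF k) (f : SF k) : SF k := fun p => fderiv ℝ f p (Y p)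

/-- A coordinate box: a product of nonempty open intervals (bounded or unbounded). -/
def IsBox (Ω : Set (Pt k)) : Prop :=
  ∃ I : Coord k → Set ℝ, (∀ c, IsOpen (I c) ∧ (I c).Nonempty ∧ (I c).OrdConnected) ∧
    Ω = Set.univ.pi I

/-- Smoothness of a function on `Ω`. -/
def Smooth (Ω : Set (Pt k)) (f : SF k) : Prop := ContDiffOn ℝ ∞ f Ω

/-- On `Ω` the function `f` depends only on the coordinates in `s`. -/
def FunOf (Ω : Set (Pt k)) (s : Set (Coord k)) (f : SF k) : Prop :=
  ∀ p ∈ Ω, ∀ q ∈ Ω, (∀ c ∈ s, p c = q c) → f p = f q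

/-- The antiderivative `∫ f dc` in the coordinate `c` that vanishes where `p c = o c`. -/
def antider (o : Pt k) (c : Coord k) (f : SF k) : SF k :=
  fun p => ∫ t in (o c)..(p c), f (Function.update p c t)

/-- The functions in the metric
`ds² = 2 du [dv + H du + Ŵ_e dx^e] + g_ef dx^e dx^f`, `g_ef = ∑ i, m_ie m_if`. -/
structure Data (k : ℕ) where
  H : SF k
  What : Fin (k + 1) → SF k
  m : Fin (k + 1) → Fin (k + 1) → SF k

/-- The standing conventions: smooth functions, independent of `v`, `Ŵ_3 = 0`, and an
upper-triangular nondegenerate transverse coframe. -/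
structure Data.IsAdapted (S : Data k) (Ω : Set (Pt k)) : Prop where
  smooth_H : Smooth Ω S.H
  smooth_What : ∀ e, Smooth Ω (S.What e)
  smooth_m : ∀ i e, Smooth Ω (S.m i e)
  funOf_H : FunOf Ω {Coord.v}ᶜ S.H
  funOf_What : ∀ e, FunOf Ω {Coord.v}ᶜ (S.What e)
  funOf_m : ∀ i e, FunOf Ω {Coord.v}ᶜ (S.m i e)
  What_three : ∀ p ∈ Ω, S.What 0 p = 0
  upper : ∀ i e, e < i → ∀ p ∈ Ω, S.m i e p = 0
  diag : ∀ i, ∀ p ∈ Ω, S.m i i p ≠ 0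

namespace Data

variable (S : Data k)

/-- The transverse metric `g_ef`. -/
def gT (e f : Fin (k + 1)) : SF k := fun p => ∑ i, S.m i e p * S.m i f p

/-- The spacetime metric in the coordinates. -/
def metric (p : Pt k) : Coord k → Coord k → ℝ
  | .u, .u => 2 * S.H p
  | .u, .v => 1
  | .v, .u => 1
  | .u, .x e => S.What e p
  | .x e, .u => S.What e p
  | .x e, .x f => S.gT e f p
  | .v, .v => 0
  | .v, .x _ => 0
  | .x _, .v => 0

/-- The inverse coframe `m_i^e`, with `∑ e, m_i^e m_je = δ_ij`. -/
def mUp (i e : Fin (k + 1)) : SF k :=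
  fun p => (Matrix.of fun a b => S.m a b p)⁻¹ e i

/-- The frame components `W_i = m_i^e Ŵ_e`. -/
def W (i : Fin (k + 1)) : SF k := fun p => ∑ e, S.mUp i e p * S.What e p

/-- The frame vectors `ℓ = ∂_v`, `n = ∂_u - H ∂_v`, `m_i = m_i^e (∂_e - Ŵ_e ∂_v)`. -/
def frame : FrameIdx k → VF k
  | .one => fun _ => Pi.single Coord.v 1
  | .two => fun p c => match c with
    | .u => 1
    | .v => - S.H p
    | .x _ => 0
  | .tr i => fun p c => match c with
    | .u => 0
    | .v => - S.W i p
    | .x e => S.mUp i e p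

/-- The frame derivative `D_2`. -/
def D2 (f : SF k) : SF k := along (S.frame .two) f

/-- The frame derivative `D_i`; `S.D 0` is `D_3`. -/
def D (i : Fin (k + 1)) (f : SF k) : SF k := along (S.frame (.tr i)) f

/-- The first-kind Christoffel symbol `g(∂_d, ∇_{∂_a} ∂_b)` of the Levi-Civita connection. -/
def christoffel (p : Pt k) (d a b : Coord k) : ℝ :=
  (pd a (fun q => S.metric q d b) p + pd b (fun q => S.metric q d a) p
    - pd d (fun q => S.metric q a b) p) / 2

/-- The connection coefficient `Γ_{abc} = g(e_a, ∇_{e_c} e_b)` of the frame. -/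
def Γ (a b c : FrameIdx k) : SF k := fun p =>
  (∑ d, ∑ e, S.frame a p d * S.metric p d e * along (S.frame c) (fun q => S.frame b q e) p)
  + ∑ d, ∑ e, ∑ f, S.christoffel p d e f * S.frame a p d * S.frame c p e * S.frame b p f

/-- `B_ij = m_{ie,u} m_j^e`. -/
def B (i j : Fin (k + 1)) : SF k := fun p => ∑ e, pd .u (S.m i e) p * S.mUp j e p

/-- `B_(ij)`. -/
def Bsym (i j : Fin (k + 1)) : SF k := fun p => (S.B i j p + S.B j i p) / 2

/-- `J_i = D_i H - D_2 W_i - B_ji W^j`. -/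
def J (i : Fin (k + 1)) : SF k :=
  fun p => S.D i S.H p - S.D2 (S.W i) p - ∑ j, S.B j i p * S.W j p

/-- `D_ijk = m_{ie,f} (m_j^e m_k^f - m_k^e m_j^f)`. -/
def Dten (i j l : Fin (k + 1)) : SF k := fun p =>
  ∑ e, ∑ f, pd (.x f) (S.m i e) p *
    (S.mUp j e p * S.mUp l f p - S.mUp l e p * S.mUp j f p)

/-- `A_ij = D_j W_i - D_i W_j + D_kij W^k`. -/
def A (i j : Fin (k + 1)) : SF k :=
  fun p => S.D j (S.W i) p - S.D i (S.W j) p + ∑ l, S.Dten l i j p * S.W l p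

/-- The Lie derivative of the metric along the vector field `X`. -/
def lieMetric (X : VF k) (p : Pt k) (a b : Coord k) : ℝ :=
  ∑ c, (X p c * pd c (fun q => S.metric q a b) p
    + S.metric p c b * pd a (fun q => X q c) p
    + S.metric p a c * pd b (fun q => X q c) p)

/-- `X` is a Killing vector field on `Ω`. -/
def IsKilling (Ω : Set (Pt k)) (X : VF k) : Prop :=
  ∀ p ∈ Ω, ∀ a b, S.lieMetric X p a b = 0

/-- The vector field `X = X_1 n + X_2 ℓ + X_3 m_3`. -/
def field (X₁ X₂ X₃ : SF k) : VF k := fun p c =>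
  X₁ p * S.frame .two p c + X₂ p * S.frame .one p c + X₃ p * S.frame (.tr 0) p c

/-- `Γ_{3ia} = 0` on `Ω` for all transverse `i` and all frame labels `a`. -/
def ThreeParallel (Ω : Set (Pt k)) : Prop :=
  ∀ p ∈ Ω, ∀ (i : Fin (k + 1)) (a : FrameIdx k), S.Γ (.tr 0) (.tr i) a p = 0

/-- `m_33 = M_{,3}(u, x^3)`, `m_3r = 0`, `m_nr = m_nr(u, x^r)` and `D_3 W_n = 0` on `Ω`. -/
def Split (Ω : Set (Pt k)) : Prop :=
  (∃ M : SF k, Smooth Ω M ∧ FunOf Ω {.u, .x 0} M ∧ ∀ p ∈ Ω, S.m 0 0 p = pd (.x 0) M p) ∧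
  (∀ r : Fin k, ∀ p ∈ Ω, S.m 0 r.succ p = 0) ∧
  (∀ n r : Fin k, FunOf Ω {.v, .x 0}ᶜ (S.m n.succ r.succ)) ∧
  (∀ n : Fin k, ∀ p ∈ Ω, S.D 0 (S.W n.succ) p = 0)

end Data

/-- `Φ` is a change of coordinates from `Ω'` into `Ω`, fixing `ℓ = ∂_v`, under which the metric of
`S` becomes that of `S'` and the vector field `X` becomes `X'`. -/
structure IsCoordChange (S : Data k) (Ω : Set (Pt k)) (X : VF k)
    (S' : Data k) (Ω' : Set (Pt k)) (X' : VF k) (Φ : Pt k → Pt k) : Prop where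
  smooth : ∀ c, Smooth Ω' (fun q => Φ q c)
  mapsTo : Set.MapsTo Φ Ω' Ω
  injOn : Set.InjOn Φ Ω'
  fix_l : ∀ q ∈ Ω', ∀ c, pd .v (fun q => Φ q c) q = if c = .v then 1 else 0
  metric_eq : ∀ q ∈ Ω', ∀ a b, S'.metric q a b =
    ∑ c, ∑ d, S.metric (Φ q) c d * pd a (fun q => Φ q c) q * pd b (fun q => Φ q d) q
  field_eq : ∀ q ∈ Ω', ∀ c, X (Φ q) c = ∑ a, X' q a * pd a (fun q => Φ q c) q

end Kundt

end

open Kundt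

/-! ### Calculus of partial derivatives and antiderivatives on a coordinate box -/

namespace Kundt

variable {k : ℕ} {Ω : Set (Pt k)} {f g : SF k} {p : Pt k} {Y : VF k} {c d : Coord k}

/-! The Killing equation is tested on the null frame `ℓ, n, m_i`. The frame has constant inner
products, so the frame components of the Lie derivative of the metric contain only frame derivatives
of `X₁, X₂, X₃` and commutators of the frame (`Data.lieMetric_frame`). The commutator components are
`B`, `J`, `Dten` and `A`, and `ℓ = ∂_v` commutes with the whole frame because nothing depends on
`v`.

The triangular coframe leaves no rotational freedom: an upper triangular matrix that is
antisymmetric vanishes (`Data.eq_zero_of_antisymm_of_triangular`). Hence the symmetrised transverse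
equations hold entry by entry, and the full system collapses to the short list `Data.KillingAt`
(`Data.isKilling_iff_killingAt`).

The dichotomy comes from the commutator of `X` with `ℓ`. It is again Killing, with components `0,
X_{2,v}, X_{3,v}` (`Data.killingAt_pd_v`). Its equations, combined with equality of mixed partials
of `X₁`, show that the transverse differential of `X₁` is `c` times the covector `m_3`, with `c`
constant (`Data.exists_const_of_killingAt`). If `c = 0`, then `D_3 X₁ = 0` and `X₁` is affine in
`u`. If `c ≠ 0`, the covector `m_3` is proportional to a transverse gradient and up to a multiple of
`ℓ` the commutator is `m_3` itself, and its Killing equations force `Γ_{3ia} = 0`.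

In Case 1 the equations are solved by algebra and by integration in one coordinate at a time. Each
formula with an integral and a free function is equivalent to prescribing one partial derivative
(`exists_antider_iff`); the free function is the integrated function with that coordinate frozen.

In Case 2 the covector `m_3` is closed at fixed `u`, so it has a potential `M`. Taking `M` as the
new `x^3` and shifting `v` by an antiderivative of `M_{,u}` gives the split form
(`Data.exists_split`). For split metrics the Killing equations are affine in `v`. Their
`v`-coefficients are the equations of the commutator with `ℓ`, and separating the two orders gives
the explicit solution (`Data.Split.isKilling_iff`). -/

theorem sum_coord (f : Coord k → ℝ) : ∑ c, f c = f .u + f .v + ∑ e, f (.x e) := by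
  have h : (Finset.univ : Finset (Coord k)) =
      insert .u (insert .v (Finset.univ.image Coord.x)) := by
    ext c; cases c <;> simp
  rw [h, Finset.sum_insert (by simp), Finset.sum_insert (by simp)]
  rw [Finset.sum_image (fun a _ b _ h => by injection h), add_assoc]

theorem along_eq_sum (Y : VF k) (f : SF k) (p : Pt k) :
    along Y f p = ∑ c, Y p c * pd c f p := by
  unfold along pd
  conv_lhs => rw [show Y p = ∑ c, Y p c • (Pi.single c 1 : Pt k) by
    ext d; simp [Finset.sum_apply, Pi.single_apply]]
  simp

theorem IsBox.isOpen (h : IsBox Ω) : IsOpen Ω := by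
  obtain ⟨I, hI, rfl⟩ := h
  exact isOpen_set_pi Set.finite_univ fun c _ => (hI c).1

theorem IsBox.convex (h : IsBox Ω) : Convex ℝ Ω := by
  obtain ⟨I, hI, rfl⟩ := h
  exact convex_pi fun c _ => (hI c).2.2.convex

theorem IsBox.nonempty (h : IsBox Ω) : Ω.Nonempty := by
  obtain ⟨I, hI, rfl⟩ := h
  exact Set.univ_pi_nonempty_iff.2 fun c => (hI c).2.1

theorem IsBox.update_mem (h : IsBox Ω) {p q : Pt k} (hp : p ∈ Ω) (hq : q ∈ Ω) (c : Coord k) :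
    Function.update p c (q c) ∈ Ω := by
  obtain ⟨I, hI, rfl⟩ := h
  intro d _
  by_cases hd : d = c
  · subst hd; simpa using hq d trivial
  · simpa [hd] using hp d trivial

theorem IsBox.update_mem_of_uIcc (h : IsBox Ω) {p q : Pt k} (hp : p ∈ Ω) (hq : q ∈ Ω)
    {c : Coord k} {t : ℝ} (ht : t ∈ Set.uIcc (q c) (p c)) : Function.update p c t ∈ Ω := by
  obtain ⟨I, hI, rfl⟩ := h
  intro d _
  by_cases hd : d = c
  · subst hd; simpa using (hI d).2.2.uIcc_subset (hq d trivial) (hp d trivial) ht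
  · simpa [hd] using hp d trivial

theorem Smooth.contDiffAt (hf : Smooth Ω f) (ho : IsOpen Ω) (hp : p ∈ Ω) : ContDiffAt ℝ ∞ f p :=
  ContDiffOn.contDiffAt hf (ho.mem_nhds hp)

theorem Smooth.differentiableAt (hf : Smooth Ω f) (ho : IsOpen Ω) (hp : p ∈ Ω) :
    DifferentiableAt ℝ f p :=
  (hf.contDiffAt ho hp).differentiableAt (by simp)

theorem Smooth.continuousOn (hf : Smooth Ω f) : ContinuousOn f Ω := ContDiffOn.continuousOn hf

theorem Smooth.congr (hf : Smooth Ω f) (h : ∀ p ∈ Ω, g p = f p) : Smooth Ω g :=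
  ContDiffOn.congr hf h

theorem Smooth.mono {Ω' : Set (Pt k)} (hf : Smooth Ω f) (h : Ω' ⊆ Ω) : Smooth Ω' f :=
  ContDiffOn.mono hf h

theorem Smooth.const (a : ℝ) : Smooth Ω (fun _ => a) := contDiffOn_const

theorem Smooth.zero : Smooth Ω (0 : SF k) := contDiffOn_const

theorem Smooth.coord (c : Coord k) : Smooth Ω (fun p => p c) := (contDiff_apply ℝ ℝ c).contDiffOn

theorem Smooth.add (hf : Smooth Ω f) (hg : Smooth Ω g) : Smooth Ω (fun p => f p + g p) :=
  ContDiffOn.add hf hg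

theorem Smooth.sub (hf : Smooth Ω f) (hg : Smooth Ω g) : Smooth Ω (fun p => f p - g p) :=
  ContDiffOn.sub hf hg

theorem Smooth.neg (hf : Smooth Ω f) : Smooth Ω (fun p => - f p) := ContDiffOn.neg hf

theorem Smooth.mul (hf : Smooth Ω f) (hg : Smooth Ω g) : Smooth Ω (fun p => f p * g p) :=
  ContDiffOn.mul hf hg

theorem Smooth.div (hf : Smooth Ω f) (hg : Smooth Ω g) (h : ∀ p ∈ Ω, g p ≠ 0) :
    Smooth Ω (fun p => f p / g p) :=
  ContDiffOn.div hf hg h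

theorem Smooth.pow (hf : Smooth Ω f) (n : ℕ) : Smooth Ω (fun p => f p ^ n) := ContDiffOn.pow hf n

theorem Smooth.sum {ι : Type*} {s : Finset ι} {F : ι → SF k} (h : ∀ i ∈ s, Smooth Ω (F i)) :
    Smooth Ω (fun p => ∑ i ∈ s, F i p) :=
  ContDiffOn.sum h

theorem Smooth.comp {Ω' : Set (Pt k)} {Φ : Pt k → Pt k} (hf : Smooth Ω f)
    (hΦ : ∀ c, Smooth Ω' (fun q => Φ q c)) (h : Set.MapsTo Φ Ω' Ω) :
    Smooth Ω' (fun q => f (Φ q)) :=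
  ContDiffOn.comp (f := Φ) hf (contDiffOn_pi.2 hΦ) h

theorem Smooth.pd (hf : Smooth Ω f) (ho : IsOpen Ω) (c : Coord k) : Smooth Ω (pd c f) :=
  (ContDiffOn.fderiv_of_isOpen (m := ∞) hf ho (by simp)).clm_apply contDiffOn_const

theorem Smooth.along (hf : Smooth Ω f) (ho : IsOpen Ω) (hY : ∀ c, Smooth Ω (fun p => Y p c)) :
    Smooth Ω (along Y f) :=
  (ContDiffOn.fderiv_of_isOpen (m := ∞) hf ho (by simp)).clm_apply (contDiffOn_pi.2 hY)

theorem along_congr (ho : IsOpen Ω) (h : ∀ p ∈ Ω, f p = g p) (hp : p ∈ Ω) :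
    along Y f p = along Y g p := by
  unfold along
  rw [Filter.EventuallyEq.fderiv_eq (Filter.eventuallyEq_of_mem (ho.mem_nhds hp) h)]

theorem pd_congr (ho : IsOpen Ω) (h : ∀ p ∈ Ω, f p = g p) (hp : p ∈ Ω) : pd c f p = pd c g p :=
  along_congr (Y := fun _ => Pi.single c 1) ho h hp

theorem along_const (a : ℝ) : along Y (fun _ => a) p = 0 := by simp [along]

theorem along_zero : along Y 0 p = 0 :=
  along_const (0 : ℝ)

theorem along_add (hf : DifferentiableAt ℝ f p) (hg : DifferentiableAt ℝ g p) :
    along Y (fun q => f q + g q) p = along Y f p + along Y g p := by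
  unfold along; rw [fderiv_fun_add hf hg]; simp

theorem along_sub (hf : DifferentiableAt ℝ f p) (hg : DifferentiableAt ℝ g p) :
    along Y (fun q => f q - g q) p = along Y f p - along Y g p := by
  unfold along; rw [fderiv_fun_sub hf hg]; simp

theorem along_neg : along Y (fun q => - f q) p = - along Y f p := by
  unfold along; rw [fderiv_fun_neg]; simp

theorem along_mul (hf : DifferentiableAt ℝ f p) (hg : DifferentiableAt ℝ g p) :
    along Y (fun q => f q * g q) p = along Y f p * g p + f p * along Y g p := by
  unfold along; rw [fderiv_fun_mul hf hg]; simp; ring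

theorem along_sq (hf : DifferentiableAt ℝ f p) :
    along Y (f ^ 2) p = 2 * f p * along Y f p := by
  rw [show f ^ 2 = fun q => f q * f q by ext; simp [sq], along_mul hf hf]; ring

theorem along_div (hf : DifferentiableAt ℝ f p) (hg : DifferentiableAt ℝ g p) (h : g p ≠ 0) :
    along Y (fun q => f q / g q) p = (along Y f p * g p - f p * along Y g p) / g p ^ 2 := by
  have := along_mul (Y := Y) (hf.fun_mul (hg.fun_inv h)) hg
  have e : along Y (fun q => f q * (g q)⁻¹ * g q) p = along Y f p := by
    unfold along
    have hev : (fun q => f q * (g q)⁻¹ * g q) =ᶠ[nhds p] f := by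
      filter_upwards [hg.continuousAt.eventually_ne h] with q hq
      field_simp
    rw [hev.fderiv_eq]
  rw [e] at this
  simp only [← div_eq_mul_inv] at this
  field_simp
  rw [this]
  field_simp
  ring

theorem along_log (hf : DifferentiableAt ℝ f p) (h : f p ≠ 0) :
    along Y (fun q => Real.log (f q)) p = along Y f p / f p := by
  unfold along; rw [fderiv.log hf h]; simp; ring

theorem along_sum {ι : Type*} {s : Finset ι} {F : ι → SF k}
    (h : ∀ i ∈ s, DifferentiableAt ℝ (F i) p) :
    along Y (fun q => ∑ i ∈ s, F i q) p = ∑ i ∈ s, along Y (F i) p := by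
  unfold along; rw [fderiv_fun_sum h]; simp

theorem pd_const (a : ℝ) : pd c (fun _ => a) p = 0 :=
  along_const (Y := fun _ => Pi.single c 1) a

theorem pd_zero : pd c 0 p = 0 := along_zero (Y := fun _ => Pi.single c 1)

theorem pd_coord (d : Coord k) : pd c (fun q => q d) p = if d = c then 1 else 0 := by
  unfold pd
  rw [show (fun q : Pt k => q d) = (ContinuousLinearMap.proj d : Pt k →L[ℝ] ℝ) from rfl,
    ContinuousLinearMap.fderiv]
  simp [Pi.single_apply]

theorem pd_add (hf : DifferentiableAt ℝ f p) (hg : DifferentiableAt ℝ g p) :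
    pd c (fun q => f q + g q) p = pd c f p + pd c g p :=
  along_add (Y := fun _ => Pi.single c 1) hf hg

theorem pd_sub (hf : DifferentiableAt ℝ f p) (hg : DifferentiableAt ℝ g p) :
    pd c (fun q => f q - g q) p = pd c f p - pd c g p :=
  along_sub (Y := fun _ => Pi.single c 1) hf hg

theorem pd_neg : pd c (fun q => - f q) p = - pd c f p := along_neg (Y := fun _ => Pi.single c 1)

theorem pd_mul (hf : DifferentiableAt ℝ f p) (hg : DifferentiableAt ℝ g p) :
    pd c (fun q => f q * g q) p = pd c f p * g p + f p * pd c g p :=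
  along_mul (Y := fun _ => Pi.single c 1) hf hg

theorem pd_sum {ι : Type*} {s : Finset ι} {F : ι → SF k}
    (h : ∀ i ∈ s, DifferentiableAt ℝ (F i) p) :
    pd c (fun q => ∑ i ∈ s, F i q) p = ∑ i ∈ s, pd c (F i) p :=
  along_sum (Y := fun _ => Pi.single c 1) h

theorem pd_comm (hf : Smooth Ω f) (ho : IsOpen Ω) (hp : p ∈ Ω) (c d : Coord k) :
    pd c (pd d f) p = pd d (pd c f) p := by
  have h := (hf.contDiffAt ho hp)
  have hs : IsSymmSndFDerivAt ℝ f p := h.isSymmSndFDerivAt (by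
    simpa using WithTop.coe_le_coe.2 (le_top : (2 : ℕ∞) ≤ ⊤))
  have hd : DifferentiableAt ℝ (fderiv ℝ f) p :=
    (h.fderiv_right (m := ∞) (by simp)).differentiableAt (by simp)
  have key : ∀ a b : Coord k, pd a (pd b f) p
      = fderiv ℝ (fderiv ℝ f) p (Pi.single a 1) (Pi.single b 1) := by
    intro a b
    unfold pd
    rw [fderiv_clm_apply hd (by fun_prop)]
    simp
  rw [key, key]; exact hs _ _

/-! ### Dependence on coordinates -/

/-- Near `p` the function is constant along the `c`-line. No smoothness is needed, because at a
point of non-differentiability `fderiv` takes the default value zero. -/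
theorem FunOf.pd_eq_zero {s : Set (Coord k)} (hf : FunOf Ω s f) (ho : IsOpen Ω) (hp : p ∈ Ω)
    (hc : c ∉ s) : pd c f p = 0 := by
  unfold pd
  by_cases hd : DifferentiableAt ℝ f p
  · have h1 := hd.hasFDerivAt.hasLineDerivAt (Pi.single c 1)
    have h2 : HasLineDerivAt ℝ f 0 p (Pi.single c 1) := by
      unfold HasLineDerivAt
      refine (hasDerivAt_const (0 : ℝ) (f p)).congr_of_eventuallyEq ?_
      have : ∀ᶠ t : ℝ in nhds 0, p + t • (Pi.single c 1 : Pt k) ∈ Ω := by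
        apply ContinuousAt.eventually_mem (by fun_prop)
        simpa using ho.mem_nhds hp
      filter_upwards [this] with t ht
      refine hf _ ht _ hp fun d hd => ?_
      have : d ≠ c := fun h => hc (h ▸ hd)
      simp [this]
    exact h1.unique h2
  · simp [fderiv_zero_of_not_differentiableAt hd]

/-- A box is convex, so two points can be joined by a segment. In the derivative along it every term
vanishes: either the two points agree in that coordinate, or the partial derivative is zero. -/
theorem funOf_of_pd (hΩ : IsBox Ω) {s : Set (Coord k)} (hf : Smooth Ω f)
    (h : ∀ p ∈ Ω, ∀ c, c ∉ s → pd c f p = 0) : FunOf Ω s f := by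
  intro p hp q hq hpq
  have hmem : ∀ t ∈ Set.Icc (0 : ℝ) 1, p + t • (q - p) ∈ Ω := fun t ht =>
    hΩ.convex.add_smul_sub_mem hp hq ht
  have hder : ∀ t ∈ Set.Icc (0 : ℝ) 1, HasDerivAt (fun t : ℝ => f (p + t • (q - p))) 0 t := by
    intro t ht
    have h1 : HasDerivAt (fun t : ℝ => p + t • (q - p)) (q - p) t := by
      simpa using ((hasDerivAt_id t).smul_const (q - p)).const_add p
    have h2 := (hf.differentiableAt hΩ.isOpen (hmem t ht)).hasFDerivAt.comp_hasDerivAt t h1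
    have e : fderiv ℝ f (p + t • (q - p)) (q - p) = 0 := ?_
    · rwa [e] at h2
    have := along_eq_sum (fun _ => q - p) f (p + t • (q - p))
    refine this.trans (Finset.sum_eq_zero ?_)
    intro c _
    by_cases hc : c ∈ s
    · simp [hpq c hc]
    · simp [h _ (hmem t ht) c hc]
  have := constant_of_has_deriv_right_zero
    (fun t ht => (hder t ht).continuousAt.continuousWithinAt)
    (fun t ht => (hder t ⟨ht.1, ht.2.le⟩).hasDerivWithinAt) 1 (by simp)
  simpa using this.symm

theorem funOf_iff (hΩ : IsBox Ω) {s : Set (Coord k)} (hf : Smooth Ω f) :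
    FunOf Ω s f ↔ ∀ p ∈ Ω, ∀ c, c ∉ s → pd c f p = 0 :=
  ⟨fun h _ hp _ hc => h.pd_eq_zero hΩ.isOpen hp hc, funOf_of_pd hΩ hf⟩

theorem FunOf.pd (hΩ : IsBox Ω) {s : Set (Coord k)} (hf : Smooth Ω f) (h : FunOf Ω s f)
    (c : Coord k) : FunOf Ω s (pd c f) := by
  refine funOf_of_pd hΩ (hf.pd hΩ.isOpen c) fun p hp d hd => ?_
  rw [pd_comm hf hΩ.isOpen hp,
    pd_congr (g := fun _ => 0) hΩ.isOpen (fun q hq => h.pd_eq_zero hΩ.isOpen hq hd) hp, pd_const]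

theorem FunOf.mono_left {Ω' : Set (Pt k)} {s : Set (Coord k)} (hf : FunOf Ω s f) (h : Ω' ⊆ Ω) :
    FunOf Ω' s f := fun p hp q hq => hf p (h hp) q (h hq)

/-- Freezing a coordinate is how the free functions of integration are produced. -/
theorem FunOf.update (hΩ : IsBox Ω) {s : Set (Coord k)} (hf : FunOf Ω s f) {o : Pt k} (ho : o ∈ Ω)
    (c : Coord k) : FunOf Ω (s \ {c}) (fun p => f (Function.update p c (o c))) := by
  intro p hp q hq h
  refine hf _ (hΩ.update_mem hp ho c) _ (hΩ.update_mem hq ho c) fun d hd => ?_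
  by_cases hdc : d = c
  · subst hdc; simp
  · simpa [hdc] using h d ⟨hd, hdc⟩

theorem Smooth.update (hΩ : IsBox Ω) (hf : Smooth Ω f) {o : Pt k} (ho : o ∈ Ω)
    (c : Coord k) : Smooth Ω (fun p => f (Function.update p c (o c))) := by
  refine hf.comp (Φ := fun p => Function.update p c (o c)) (fun d => ?_)
    fun p hp => hΩ.update_mem hp ho c
  by_cases hdc : d = c
  · subst hdc; simpa using Smooth.const _
  · simpa [hdc] using Smooth.coord d

/-! ### Antiderivatives in a coordinate -/

theorem hasDerivAt_update (hf : DifferentiableAt ℝ f p) {t : ℝ} (q : Pt k)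
    (h : p = Function.update q c t) :
    HasDerivAt (fun s => f (Function.update q c s)) (pd c f p) t := by
  subst h
  have := hf.hasFDerivAt.comp_hasDerivAt t (hasDerivAt_update q c t)
  exact this

/-- The fundamental theorem of calculus on the `c`-segment through `p`, which stays in `Ω` because
`Ω` is a box. -/
theorem sub_update_eq_antider (hΩ : IsBox Ω) (hg : Smooth Ω g) {o : Pt k} (ho : o ∈ Ω)
    (h : ∀ p ∈ Ω, pd c g p = f p) (hp : p ∈ Ω) :
    g p = antider o c f p + g (Function.update p c (o c)) := by
  have hmem : ∀ t ∈ Set.uIcc (o c) (p c), Function.update p c t ∈ Ω := fun t ht =>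
    hΩ.update_mem_of_uIcc hp ho ht
  have hint : IntervalIntegrable (fun t => pd c g (Function.update p c t)) MeasureTheory.volume
      (o c) (p c) := by
    apply ContinuousOn.intervalIntegrable
    have hupd : Continuous fun t : ℝ => Function.update p c t :=
      continuous_const.update c continuous_id
    exact (hg.pd hΩ.isOpen c).continuousOn.comp hupd.continuousOn hmem
  have := intervalIntegral.integral_eq_sub_of_hasDerivAt
    (f := fun t => g (Function.update p c t)) (fun t ht =>
    Kundt.hasDerivAt_update (hg.differentiableAt hΩ.isOpen (hmem t ht)) p rfl) hint
  unfold antider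
  rw [intervalIntegral.integral_congr (g := fun t => pd c g (Function.update p c t))
    (fun t ht => (h _ (hmem t ht)).symm), this]
  simp

theorem antider_update (o p : Pt k) (c : Coord k) (f : SF k) (s : ℝ) :
    antider o c f (Function.update p c s) = ∫ t in (o c)..s, f (Function.update p c t) := by
  simp [antider]

/-- Only the upper limit of the integral is differentiated, so continuity of `f` suffices.
Smoothness of `g` identifies the one-variable derivative with `pd c g`, so no smoothness of the
integral in the other coordinates is required. -/
theorem pd_eq_of_eq_antider (hΩ : IsBox Ω) (hg : Smooth Ω g) (hf : ContinuousOn f Ω) {o : Pt k}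
    (ho : o ∈ Ω) (h : ∀ p ∈ Ω, g p = antider o c f p) (hp : p ∈ Ω) : pd c g p = f p := by
  have h1 := Kundt.hasDerivAt_update (hg.differentiableAt hΩ.isOpen hp) (t := p c) (c := c) p
    (by simp)
  have hnhds : ∀ᶠ t : ℝ in nhds (p c), Function.update p c t ∈ Ω := by
    apply ContinuousAt.eventually_mem (by fun_prop)
    simpa using hΩ.isOpen.mem_nhds hp
  have hmem : ∀ t ∈ Set.uIcc (o c) (p c), Function.update p c t ∈ Ω := fun t ht =>
    hΩ.update_mem_of_uIcc hp ho ht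
  have hupd : Continuous fun t : ℝ => Function.update p c t :=
    continuous_const.update c continuous_id
  have hcont : ContinuousOn (fun t => f (Function.update p c t))
      ((fun t : ℝ => Function.update p c t) ⁻¹' Ω) :=
    hf.comp hupd.continuousOn fun t ht => ht
  have hopen : IsOpen ((fun t : ℝ => Function.update p c t) ⁻¹' Ω) := hΩ.isOpen.preimage hupd
  have hpm : p c ∈ (fun t : ℝ => Function.update p c t) ⁻¹' Ω := by simpa using hp
  have h2 : HasDerivAt (fun s => ∫ t in (o c)..s, f (Function.update p c t)) (f p) (p c) := by
    have := intervalIntegral.integral_hasDerivAt_right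
      (f := fun t => f (Function.update p c t)) (a := o c) (b := p c)
      ((hcont.mono hmem).intervalIntegrable)
      (hcont.stronglyMeasurableAtFilter hopen _ hpm)
      (hcont.continuousAt (hopen.mem_nhds hpm))
    simpa using this
  refine h1.unique (h2.congr_of_eventuallyEq ?_)
  filter_upwards [hnhds] with t ht
  rw [h _ ht, antider_update]

/-- `g = ∫ f dc + A` with `A` smooth and independent of `c` (and of the coordinates outside `s`,
like `g`) if and only if `g_{,c} = f`. -/
theorem exists_antider_iff (hΩ : IsBox Ω) (hg : Smooth Ω g) {s s' : Set (Coord k)}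
    (hgs : FunOf Ω s g) (hs : s' = s \ {c}) (hf : Smooth Ω f) {o : Pt k} (ho : o ∈ Ω) :
    (∃ A : SF k, Smooth Ω A ∧ FunOf Ω s' A ∧ ∀ p ∈ Ω, g p = antider o c f p + A p) ↔
      ∀ p ∈ Ω, pd c g p = f p := by
  subst hs
  constructor
  · rintro ⟨A, hA, hAs, h⟩ p hp
    have := pd_eq_of_eq_antider (g := fun q => g q - A q) hΩ (hg.sub hA) hf.continuousOn ho
      (fun q hq => by rw [h q hq]; ring) hp
    rw [pd_sub (hg.differentiableAt hΩ.isOpen hp) (hA.differentiableAt hΩ.isOpen hp),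
      hAs.pd_eq_zero hΩ.isOpen hp (by simp)] at this
    simpa using this
  · intro h
    exact ⟨_, hg.update hΩ ho c, hgs.update hΩ ho c, fun p hp => sub_update_eq_antider hΩ hg ho h hp⟩

end Kundt

/-! ### The null frame, its commutators, and the Lie derivative of the metric -/

namespace Kundt

namespace Data

variable {k : ℕ} {Ω : Set (Pt k)} {S : Data k} {f g : SF k} {p : Pt k}

theorem D2_eq (S : Data k) (f : SF k) (p : Pt k) :
    S.D2 f p = pd .u f p - S.H p * pd .v f p := by
  simp [D2, along_eq_sum, sum_coord, frame]; ring

theorem D_eq (S : Data k) (i : Fin (k + 1)) (f : SF k) (p : Pt k) :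
    S.D i f p = - S.W i p * pd .v f p + ∑ e, S.mUp i e p * pd (.x e) f p := by
  simp [D, along_eq_sum, sum_coord, frame]

theorem along_one (S : Data k) (f : SF k) : along (S.frame .one) f = pd .v f := rfl

/-! ### The inverse coframe -/

theorem det_ne_zero (hS : S.IsAdapted Ω) (hp : p ∈ Ω) :
    (Matrix.of fun a b => S.m a b p).det ≠ 0 := by
  rw [Matrix.det_of_isUpperTriangular]
  · exact Finset.prod_ne_zero_iff.2 fun i _ => hS.diag i p hp
  · intro i j h
    exact hS.upper i j h p hp

theorem sum_m_mUp (hS : S.IsAdapted Ω) (hp : p ∈ Ω) (j i : Fin (k + 1)) :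
    ∑ e, S.m j e p * S.mUp i e p = if j = i then 1 else 0 := by
  have h := Matrix.mul_nonsing_inv (Matrix.of fun a b => S.m a b p)
    (isUnit_iff_ne_zero.2 (det_ne_zero hS hp))
  have := congr_fun (congr_fun h j) i
  simpa [Matrix.mul_apply, Matrix.one_apply, mUp] using this

theorem sum_mUp_m (hS : S.IsAdapted Ω) (hp : p ∈ Ω) (e f : Fin (k + 1)) :
    ∑ i, S.mUp i e p * S.m i f p = if e = f then 1 else 0 := by
  have h := Matrix.nonsing_inv_mul (Matrix.of fun a b => S.m a b p)
    (isUnit_iff_ne_zero.2 (det_ne_zero hS hp))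
  have := congr_fun (congr_fun h e) f
  simpa [Matrix.mul_apply, Matrix.one_apply, mUp] using this

/-- The inverse of an upper triangular matrix is upper triangular, and `mUp i e` is its entry in row
`e`, column `i`. For `i = 0` this says that the only transverse coordinate direction in `m_3` is
`x^3`. -/
theorem mUp_eq_zero (hS : S.IsAdapted Ω) (hp : p ∈ Ω) {i e : Fin (k + 1)} (h : i < e) :
    S.mUp i e p = 0 := by
  have : Invertible (Matrix.of fun a b => S.m a b p) :=
    Matrix.invertibleOfIsUnitDet _ (isUnit_iff_ne_zero.2 (det_ne_zero hS hp))
  have hb : Matrix.BlockTriangular (Matrix.of fun a b => S.m a b p) id :=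
    fun a b hab => hS.upper a b hab p hp
  exact Matrix.blockTriangular_inv_of_blockTriangular hb h

theorem mUp_zero_succ (hS : S.IsAdapted Ω) (hp : p ∈ Ω) (r : Fin k) : S.mUp 0 r.succ p = 0 :=
  mUp_eq_zero hS hp (Fin.succ_pos r)

theorem m_succ_zero (hS : S.IsAdapted Ω) (hp : p ∈ Ω) (r : Fin k) : S.m r.succ 0 p = 0 :=
  hS.upper _ _ (Fin.succ_pos r) p hp

theorem m_mul_mUp_diag (hS : S.IsAdapted Ω) (hp : p ∈ Ω) : S.m 0 0 p * S.mUp 0 0 p = 1 := by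
  have := sum_m_mUp hS hp 0 0
  simpa [Fin.sum_univ_succ, mUp_zero_succ hS hp] using this

theorem mUp_zero_zero (hS : S.IsAdapted Ω) (hp : p ∈ Ω) : S.mUp 0 0 p = 1 / S.m 0 0 p := by
  have := m_mul_mUp_diag hS hp
  have h0 := hS.diag 0 p hp
  field_simp
  linarith

/-- Reconstruction of a covector from its transverse frame components. -/
theorem sum_m_sum_mUp (hS : S.IsAdapted Ω) (hp : p ∈ Ω) (t : Fin (k + 1) → ℝ) (f : Fin (k + 1)) :
    ∑ i, S.m i f p * ∑ e, S.mUp i e p * t e = t f := by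
  simp_rw [Finset.mul_sum]
  rw [Finset.sum_comm]
  have : ∀ e, ∑ i, S.m i f p * (S.mUp i e p * t e) = (∑ i, S.mUp i e p * S.m i f p) * t e := by
    intro e; rw [Finset.sum_mul]; exact Finset.sum_congr rfl fun i _ => by ring
  simp [this, sum_mUp_m hS hp]

/-- Cramer's rule: the inverse is the adjugate over the determinant, and an adjugate entry is the
determinant of the matrix with one row replaced by a unit vector. Determinants are polynomials in
the entries. -/
theorem smooth_mUp (hS : S.IsAdapted Ω) (i e : Fin (k + 1)) : Smooth Ω (S.mUp i e) := by
  have hdet : ∀ F : Fin (k + 1) → Fin (k + 1) → SF k, (∀ a b, Smooth Ω (F a b)) →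
      Smooth Ω (fun p => (Matrix.of fun a b => F a b p).det) := by
    intro F hF
    simp only [Matrix.det_apply']
    exact Smooth.sum fun σ _ => (Smooth.const _).mul
      (contDiffOn_prod fun j _ => hF (σ j) j)
  have hadj : Smooth Ω (fun p => (Matrix.of fun a b => S.m a b p).adjugate e i) := by
    refine (hdet (fun a b => if a = i then fun _ => if b = e then 1 else 0 else S.m a b)
      fun a b => ?_).congr fun p _ => ?_
    · by_cases h : a = i
      · simpa [h] using Smooth.const _
      · simpa [h] using hS.smooth_m a b
    · rw [Matrix.adjugate_apply]
      congr 1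
      ext a b
      by_cases h : a = i
      · subst h; simp [Pi.single_apply]
      · simp [h, Matrix.updateRow_ne]
  refine (((Smooth.const 1).div (hdet _ hS.smooth_m) fun p hp => det_ne_zero hS hp).mul
    hadj).congr fun p hp => ?_
  simp [mUp, Matrix.inv_def, Ring.inverse_eq_inv']

theorem funOf_mUp (hS : S.IsAdapted Ω) (i e : Fin (k + 1)) : FunOf Ω {.v}ᶜ (S.mUp i e) := by
  intro p hp q hq h
  have : (Matrix.of fun a b => S.m a b p) = Matrix.of fun a b => S.m a b q := by
    ext a b
    exact hS.funOf_m a b p hp q hq h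
  unfold mUp
  rw [this]

theorem smooth_W (hS : S.IsAdapted Ω) (i : Fin (k + 1)) : Smooth Ω (S.W i) :=
  Smooth.sum fun e _ => (smooth_mUp hS i e).mul (hS.smooth_What e)

theorem funOf_W (hS : S.IsAdapted Ω) (i : Fin (k + 1)) : FunOf Ω {.v}ᶜ (S.W i) := by
  intro p hp q hq h
  unfold W
  exact Finset.sum_congr rfl fun e _ => by
    rw [funOf_mUp hS i e p hp q hq h, hS.funOf_What e p hp q hq h]

theorem smooth_gT (hS : S.IsAdapted Ω) (e f : Fin (k + 1)) : Smooth Ω (S.gT e f) :=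
  Smooth.sum fun i _ => (hS.smooth_m i e).mul (hS.smooth_m i f)

theorem funOf_gT (hS : S.IsAdapted Ω) (e f : Fin (k + 1)) : FunOf Ω {.v}ᶜ (S.gT e f) := by
  intro p hp q hq h
  unfold gT
  exact Finset.sum_congr rfl fun i _ => by
    rw [hS.funOf_m i e p hp q hq h, hS.funOf_m i f p hp q hq h]

theorem smooth_metric (hS : S.IsAdapted Ω) (a b : Coord k) :
    Smooth Ω (fun q => S.metric q a b) := by
  cases a <;> cases b <;> simp only [metric]
  all_goals first
    | exact Smooth.const _
    | exact hS.smooth_What _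
    | exact smooth_gT hS _ _
    | exact (Smooth.const 2).mul hS.smooth_H

theorem metric_symm (S : Data k) (p : Pt k) (a b : Coord k) : S.metric p a b = S.metric p b a := by
  cases a <;> cases b <;> simp only [metric]
  exact Finset.sum_congr rfl fun i _ => mul_comm _ _

theorem smooth_frame (hS : S.IsAdapted Ω) (a : FrameIdx k) (c : Coord k) :
    Smooth Ω (fun q => S.frame a q c) := by
  cases a <;> cases c <;> simp only [frame]
  all_goals first
    | exact Smooth.const _
    | exact hS.smooth_H.neg
    | exact (smooth_W hS _).neg
    | exact smooth_mUp hS _ _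

/-! ### Frame components -/

/-- The inner product `g(V, Z)` at a point. -/
noncomputable def ip (S : Data k) (p : Pt k) (V Z : Coord k → ℝ) : ℝ := ∑ d, ∑ e, V d * S.metric p d e * Z e

/-- The components of the commutator `[e_a, e_b]`. -/
noncomputable def bracket (S : Data k) (a b : FrameIdx k) (p : Pt k) (e : Coord k) : ℝ :=
  along (S.frame a) (fun q => S.frame b q e) p - along (S.frame b) (fun q => S.frame a q e) p

theorem ip_one (S : Data k) (p : Pt k) (V : Coord k → ℝ) : S.ip p (S.frame .one p) V = V .u := by
  simp [ip, sum_coord, frame, metric]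

theorem ip_two (S : Data k) (p : Pt k) (V : Coord k → ℝ) :
    S.ip p (S.frame .two p) V = S.H p * V .u + V .v + ∑ e, S.What e p * V (.x e) := by
  simp [ip, sum_coord, frame, metric]; ring

/-- Lowering the index of `m_i` gives the covector `m_ie dx^e`: contracting `g_ef` with `m_i^e`
leaves `m_if`, and the two `du` terms, `-W_i` from the `∂_v` part and `m_i^e Ŵ_e`, cancel. -/
theorem ip_tr (hS : S.IsAdapted Ω) (hp : p ∈ Ω) (i : Fin (k + 1)) (V : Coord k → ℝ) :
    S.ip p (S.frame (.tr i) p) V = ∑ f, S.m i f p * V (.x f) := by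
  have h1 : ∀ f, ∑ e, S.mUp i e p * S.gT e f p = S.m i f p := by
    intro f
    simp_rw [gT, Finset.mul_sum]
    rw [Finset.sum_comm]
    have : ∀ j, ∑ e, S.mUp i e p * (S.m j e p * S.m j f p)
        = (∑ e, S.m j e p * S.mUp i e p) * S.m j f p := by
      intro j; rw [Finset.sum_mul]; exact Finset.sum_congr rfl fun e _ => by ring
    simp [this, sum_m_mUp hS hp]
  have h2 : ∑ e, (S.mUp i e p * S.What e p * V .u + ∑ f, S.mUp i e p * S.gT e f p * V (.x f))
      = S.W i p * V .u + ∑ f, S.m i f p * V (.x f) := by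
    rw [Finset.sum_add_distrib, ← Finset.sum_mul, Finset.sum_comm]
    congr 1
    exact Finset.sum_congr rfl fun f _ => by rw [← Finset.sum_mul, h1]
  simp only [ip, sum_coord, frame, metric]
  simp only [mul_zero, zero_mul, add_zero, zero_add, Finset.sum_const_zero, mul_one]
  rw [h2]; ring

theorem ip_comm (S : Data k) (p : Pt k) (V Z : Coord k → ℝ) : S.ip p V Z = S.ip p Z V := by
  unfold ip
  rw [Finset.sum_comm]
  exact Finset.sum_congr rfl fun d _ => Finset.sum_congr rfl fun e _ => by
    rw [metric_symm S p e d]; ring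

/-- The frame components `η_ab` of the metric. -/
noncomputable def eta : FrameIdx k → FrameIdx k → ℝ
  | .one, .two => 1
  | .two, .one => 1
  | .tr i, .tr j => if i = j then 1 else 0
  | _, _ => 0

theorem ip_frame (hS : S.IsAdapted Ω) (hp : p ∈ Ω) (a b : FrameIdx k) :
    S.ip p (S.frame a p) (S.frame b p) = eta a b := by
  rcases a with _ | _ | i
  · rw [ip_one]; rcases b with _ | _ | j <;> simp [frame, eta]
  · rw [ip_two]; rcases b with _ | _ | j <;> simp [frame, eta]
    simp [W, mul_comm]
  · rw [ip_tr hS hp]; rcases b with _ | _ | j <;> simp [frame, eta]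
    exact sum_m_mUp hS hp i j

/-- The product rule applied to the constant `g(e_a, e_b) = η_ab`. -/
theorem along_metric_frame (hΩ : IsBox Ω) (hS : S.IsAdapted Ω) (hp : p ∈ Ω)
    (a b : FrameIdx k) (Y : VF k) :
    ∑ d, ∑ e, (along Y (fun q => S.frame a q d) p * S.metric p d e * S.frame b p e
      + S.frame a p d * along Y (fun q => S.metric q d e) p * S.frame b p e
      + S.frame a p d * S.metric p d e * along Y (fun q => S.frame b q e) p) = 0 := by
  have ho := hΩ.isOpen
  have h : along Y (fun q => ∑ d, ∑ e, S.frame a q d * S.metric q d e * S.frame b q e) p = 0 := by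
    rw [along_congr (f := fun q => ∑ d, ∑ e, S.frame a q d * S.metric q d e * S.frame b q e)
      (g := fun _ => eta a b) ho (fun q hq => ip_frame hS hq a b) hp, along_const]
  have da : ∀ d, DifferentiableAt ℝ (fun q => S.frame a q d) p := fun d =>
    (smooth_frame hS a d).differentiableAt ho hp
  have db : ∀ d, DifferentiableAt ℝ (fun q => S.frame b q d) p := fun d =>
    (smooth_frame hS b d).differentiableAt ho hp
  have dg : ∀ d e, DifferentiableAt ℝ (fun q => S.metric q d e) p := fun d e =>
    (smooth_metric hS d e).differentiableAt ho hp
  rw [along_sum fun d _ => DifferentiableAt.fun_sum fun e _ =>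
    ((da d).fun_mul (dg d e)).fun_mul (db e)] at h
  rw [← h]
  refine Finset.sum_congr rfl fun d _ => ?_
  rw [along_sum fun e _ => ((da d).fun_mul (dg d e)).fun_mul (db e)]
  refine Finset.sum_congr rfl fun e _ => ?_
  rw [along_mul ((da d).fun_mul (dg d e)) (db e), along_mul (da d) (dg d e)]
  ring

/-- Metric compatibility. The two Christoffel symbols add up to a derivative of the metric, and the
total is the derivative of the constant `η_ab` along `e_c`. -/
theorem Γ_add_swap (hΩ : IsBox Ω) (hS : S.IsAdapted Ω) (hp : p ∈ Ω) (a b c : FrameIdx k) :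
    S.Γ a b c p + S.Γ b a c p = 0 := by
  rw [← along_metric_frame hΩ hS hp a b (S.frame c)]
  have h1 : ∑ d, ∑ e, S.frame b p d * S.metric p d e
      * along (S.frame c) (fun q => S.frame a q e) p
      = ∑ d, ∑ e, along (S.frame c) (fun q => S.frame a q d) p * S.metric p d e
      * S.frame b p e := by
    rw [Finset.sum_comm]
    exact Finset.sum_congr rfl fun d _ => Finset.sum_congr rfl fun e _ => by
      rw [metric_symm S p e d]; ring
  have h2 : ∑ d, ∑ e, ∑ f, S.christoffel p d e f * S.frame b p d * S.frame c p e * S.frame a p f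
      = ∑ d, ∑ e, ∑ f, S.christoffel p f e d * S.frame b p f * S.frame c p e * S.frame a p d := by
    rw [Finset.sum_comm]
    conv_rhs => rw [Finset.sum_comm]
    exact Finset.sum_congr rfl fun e _ => Finset.sum_comm
  have h3 : ∀ d e f, S.christoffel p d e f + S.christoffel p f e d
      = pd e (fun q => S.metric q d f) p := by
    intro d e f
    simp only [christoffel, metric_symm S _ f d, metric_symm S _ f e, metric_symm S _ e d]
    ring
  have h4 : ∑ d, ∑ e, S.frame a p d * along (S.frame c) (fun q => S.metric q d e) p * S.frame b p e
      = ∑ d, ∑ e, ∑ f, (S.christoffel p d e f + S.christoffel p f e d) * S.frame a p d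
        * S.frame c p e * S.frame b p f := by
    refine Finset.sum_congr rfl fun d _ => ?_
    rw [Finset.sum_comm]
    refine Finset.sum_congr rfl fun f _ => ?_
    rw [along_eq_sum, Finset.mul_sum, Finset.sum_mul]
    exact Finset.sum_congr rfl fun e _ => by rw [h3]; ring
  simp only [Finset.sum_add_distrib]
  rw [h4]
  unfold Γ
  rw [h1, h2]
  have h5 : ∑ d, ∑ e, ∑ f, (S.christoffel p d e f + S.christoffel p f e d) * S.frame a p d
        * S.frame c p e * S.frame b p f
      = ∑ d, ∑ e, ∑ f, S.christoffel p d e f * S.frame a p d * S.frame c p e * S.frame b p f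
      + ∑ d, ∑ e, ∑ f, S.christoffel p f e d * S.frame b p f * S.frame c p e * S.frame a p d := by
    simp only [← Finset.sum_add_distrib]
    exact Finset.sum_congr rfl fun d _ => Finset.sum_congr rfl fun e _ =>
      Finset.sum_congr rfl fun f _ => by ring
  rw [h5]; ring

/-- Vanishing torsion. The Christoffel symbol is symmetric in its last two slots and drops out of
the difference. -/
theorem Γ_sub_swap (S : Data k) (p : Pt k) (a b c : FrameIdx k) :
    S.Γ a b c p - S.Γ a c b p = S.ip p (S.frame a p) (S.bracket c b p) := by
  have h2 : ∑ d, ∑ e, ∑ f, S.christoffel p d e f * S.frame a p d * S.frame c p e * S.frame b p f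
      = ∑ d, ∑ e, ∑ f, S.christoffel p d e f * S.frame a p d * S.frame b p e * S.frame c p f := by
    refine Finset.sum_congr rfl fun d _ => ?_
    rw [Finset.sum_comm]
    refine Finset.sum_congr rfl fun e _ => Finset.sum_congr rfl fun f _ => ?_
    simp only [christoffel, metric_symm S _ f e]
    ring
  unfold Γ ip bracket
  rw [h2, add_sub_add_right_eq_sub]
  simp only [← Finset.sum_sub_distrib, mul_sub]

theorem bracket_swap (S : Data k) (a b : FrameIdx k) (p : Pt k) :
    S.bracket a b p = - S.bracket b a p := by
  ext e; simp [bracket]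

theorem ip_neg_right (S : Data k) (p : Pt k) (V Z : Coord k → ℝ) :
    S.ip p V (-Z) = - S.ip p V Z := by
  simp [ip, Finset.sum_neg_distrib]

theorem ip_bracket_swap (S : Data k) (a b c : FrameIdx k) (p : Pt k) :
    S.ip p (S.frame a p) (S.bracket b c p) = - S.ip p (S.frame a p) (S.bracket c b p) := by
  rw [bracket_swap, ip_neg_right]

/-- Koszul's formula in the frame. -/
theorem two_mul_Γ (hΩ : IsBox Ω) (hS : S.IsAdapted Ω) (hp : p ∈ Ω) (a b c : FrameIdx k) :
    2 * S.Γ a b c p = S.ip p (S.frame a p) (S.bracket c b p)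
      + S.ip p (S.frame b p) (S.bracket a c p) + S.ip p (S.frame c p) (S.bracket a b p) := by
  linarith [Γ_sub_swap S p a b c, Γ_sub_swap S p b c a, Γ_sub_swap S p c b a,
    Γ_add_swap hΩ hS hp a b c, Γ_add_swap hΩ hS hp b c a, Γ_add_swap hΩ hS hp a c b]

/-- Symmetrising Koszul's formula cancels the term `g(e_c, [e_a, e_b])`. What remains is the
combination of commutators that occurs in the Lie derivative of the metric. -/
theorem Γ_add_Γ (hΩ : IsBox Ω) (hS : S.IsAdapted Ω) (hp : p ∈ Ω) (a b c : FrameIdx k) :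
    S.Γ c a b p + S.Γ c b a p = S.ip p (S.frame a p) (S.bracket c b p)
      + S.ip p (S.frame b p) (S.bracket c a p) := by
  linarith [two_mul_Γ hΩ hS hp c a b, two_mul_Γ hΩ hS hp c b a, ip_bracket_swap S c a b p]

/-! ### The commutators of the frame -/

theorem bracket_u (S : Data k) (a b : FrameIdx k) (p : Pt k) : S.bracket a b p .u = 0 := by
  have h : ∀ (b : FrameIdx k) (Y : VF k), along Y (fun q => S.frame b q .u) p = 0 := by
    intro b Y
    rcases b with _ | _ | i <;> simp only [frame] <;> exact along_const _
  simp [bracket, h]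

/-- All frame components are independent of `v`, and `ℓ = ∂_v` has constant components. -/
theorem bracket_one (hΩ : IsBox Ω) (hS : S.IsAdapted Ω) (hp : p ∈ Ω) (b : FrameIdx k) :
    S.bracket .one b p = 0 := by
  have ho := hΩ.isOpen
  ext e
  have h1 : along (S.frame b) (fun q => S.frame .one q e) p = 0 := along_const _
  have h2 : pd .v (fun q => S.frame b q e) p = 0 := by
    rcases b with _ | _ | i <;> cases e <;> simp only [frame]
    all_goals first
      | exact pd_const _
      | (rw [pd_neg, hS.funOf_H.pd_eq_zero ho hp (by simp), neg_zero])
      | (rw [pd_neg, (funOf_W hS _).pd_eq_zero ho hp (by simp), neg_zero])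
      | exact (funOf_mUp hS _ _).pd_eq_zero ho hp (by simp)
  simp [bracket, h1, along_one, h2]

/-- Differentiating the duality relation moves the derivative from the inverse coframe to the
coframe, where `B` and `Dten` are defined. -/
theorem sum_m_along_mUp (hΩ : IsBox Ω) (hS : S.IsAdapted Ω) (hp : p ∈ Ω) (Y : VF k)
    (l i : Fin (k + 1)) :
    ∑ f, S.m l f p * along Y (S.mUp i f) p = - ∑ f, along Y (S.m l f) p * S.mUp i f p := by
  have ho := hΩ.isOpen
  have h : along Y (fun q => ∑ f, S.m l f q * S.mUp i f q) p = 0 := by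
    rw [along_congr ho (fun q hq => sum_m_mUp hS hq l i) hp, along_const]
  have dm : ∀ f, DifferentiableAt ℝ (S.m l f) p := fun f => (hS.smooth_m l f).differentiableAt ho hp
  have du : ∀ f, DifferentiableAt ℝ (S.mUp i f) p := fun f =>
    (smooth_mUp hS i f).differentiableAt ho hp
  rw [along_sum fun f _ => (dm f).fun_mul (du f),
    Finset.sum_congr rfl fun f _ => along_mul (dm f) (du f), Finset.sum_add_distrib] at h
  linarith

theorem sum_What_along_mUp (hΩ : IsBox Ω) (hS : S.IsAdapted Ω) (hp : p ∈ Ω) (Y : VF k)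
    (i : Fin (k + 1)) :
    ∑ f, S.What f p * along Y (S.mUp i f) p
      = - ∑ l, (∑ f, along Y (S.m l f) p * S.mUp i f p) * S.W l p := by
  have h := fun f => sum_m_sum_mUp hS hp (fun e => S.What e p) f
  calc _ = ∑ f, ∑ l, S.W l p * (S.m l f p * along Y (S.mUp i f) p) := by
        refine Finset.sum_congr rfl fun f _ => ?_
        rw [← h f, Finset.sum_mul]
        exact Finset.sum_congr rfl fun l _ => by unfold W; ring
    _ = _ := by
        rw [Finset.sum_comm, ← Finset.sum_neg_distrib]
        refine Finset.sum_congr rfl fun l _ => ?_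
        rw [← Finset.mul_sum, sum_m_along_mUp hΩ hS hp]; ring

theorem along_two_of_funOf (hΩ : IsBox Ω) (hp : p ∈ Ω) (hf : FunOf Ω {.v}ᶜ f) :
    along (S.frame .two) f p = pd .u f p := by
  rw [show along (S.frame .two) f p = S.D2 f p from rfl, D2_eq,
    hf.pd_eq_zero (c := .v) hΩ.isOpen hp (by simp)]; ring

theorem along_tr_of_funOf (hΩ : IsBox Ω) (hp : p ∈ Ω) (hf : FunOf Ω {.v}ᶜ f) (i : Fin (k + 1)) :
    along (S.frame (.tr i)) f p = ∑ e, S.mUp i e p * pd (.x e) f p := by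
  rw [show along (S.frame (.tr i)) f p = S.D i f p from rfl, D_eq,
    hf.pd_eq_zero (c := .v) hΩ.isOpen hp (by simp)]; ring

theorem ip_tr_bracket_two (hΩ : IsBox Ω) (hS : S.IsAdapted Ω) (hp : p ∈ Ω) (l i : Fin (k + 1)) :
    S.ip p (S.frame (.tr l) p) (S.bracket .two (.tr i) p) = - S.B l i p := by
  rw [ip_tr hS hp]
  have : ∀ f, S.bracket .two (.tr i) p (.x f) = along (S.frame .two) (S.mUp i f) p := by
    intro f
    simp only [bracket, frame]
    rw [along_const, sub_zero]
  simp only [this]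
  rw [sum_m_along_mUp hΩ hS hp]
  unfold B
  congr 1
  exact Finset.sum_congr rfl fun f _ => by rw [along_two_of_funOf hΩ hp (hS.funOf_m _ _)]

/-- The `∂_v` component of the commutator gives `D_i H - D_2 W_i`, and contraction of its transverse
part with `Ŵ` gives the `B` term of `J`. The tensor `A` arises in the same way from `[m_i, m_j]`. -/
theorem ip_two_bracket_two (hΩ : IsBox Ω) (hS : S.IsAdapted Ω) (hp : p ∈ Ω) (i : Fin (k + 1)) :
    S.ip p (S.frame .two p) (S.bracket .two (.tr i) p) = S.J i p := by
  rw [ip_two, bracket_u]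
  have h1 : ∀ f, S.bracket .two (.tr i) p (.x f) = along (S.frame .two) (S.mUp i f) p := by
    intro f
    simp only [bracket, frame]
    rw [along_const, sub_zero]
  have h2 : S.bracket .two (.tr i) p .v = S.D i S.H p - S.D2 (S.W i) p := by
    simp only [bracket, frame, D, D2]
    rw [along_neg, along_neg]; ring
  simp only [h1, h2]
  rw [sum_What_along_mUp hΩ hS hp]
  unfold J B
  simp only [along_two_of_funOf hΩ hp (hS.funOf_m _ _)]
  ring

theorem sum_along_tr (hΩ : IsBox Ω) (hS : S.IsAdapted Ω) (hp : p ∈ Ω) (l i j : Fin (k + 1)) :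
    ∑ f, along (S.frame (.tr j)) (S.m l f) p * S.mUp i f p
      - ∑ f, along (S.frame (.tr i)) (S.m l f) p * S.mUp j f p = S.Dten l i j p := by
  unfold Dten
  rw [← Finset.sum_sub_distrib]
  refine Finset.sum_congr rfl fun f _ => ?_
  rw [along_tr_of_funOf hΩ hp (hS.funOf_m _ _), along_tr_of_funOf hΩ hp (hS.funOf_m _ _),
    Finset.sum_mul, Finset.sum_mul, ← Finset.sum_sub_distrib]
  exact Finset.sum_congr rfl fun e _ => by ring

theorem ip_tr_bracket_tr (hΩ : IsBox Ω) (hS : S.IsAdapted Ω) (hp : p ∈ Ω) (l i j : Fin (k + 1)) :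
    S.ip p (S.frame (.tr l) p) (S.bracket (.tr i) (.tr j) p) = S.Dten l i j p := by
  rw [ip_tr hS hp]
  simp only [bracket, frame, mul_sub, Finset.sum_sub_distrib]
  change ∑ f, S.m l f p * along (S.frame (.tr i)) (S.mUp j f) p
    - ∑ f, S.m l f p * along (S.frame (.tr j)) (S.mUp i f) p = _
  rw [sum_m_along_mUp hΩ hS hp, sum_m_along_mUp hΩ hS hp, ← sum_along_tr hΩ hS hp]
  ring

theorem ip_two_bracket_tr (hΩ : IsBox Ω) (hS : S.IsAdapted Ω) (hp : p ∈ Ω) (i j : Fin (k + 1)) :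
    S.ip p (S.frame .two p) (S.bracket (.tr i) (.tr j) p) = S.A i j p := by
  rw [ip_two, bracket_u]
  have h2 : S.bracket (.tr i) (.tr j) p .v = S.D j (S.W i) p - S.D i (S.W j) p := by
    simp only [bracket, frame, D]
    rw [along_neg, along_neg]
    change - along (S.frame (.tr i)) (S.W j) p - - along (S.frame (.tr j)) (S.W i) p = _
    simp only [frame]; ring
  rw [h2]
  simp only [bracket, mul_sub, Finset.sum_sub_distrib]
  change _ + _ + (∑ f, S.What f p * along (S.frame (.tr i)) (S.mUp j f) p
    - ∑ f, S.What f p * along (S.frame (.tr j)) (S.mUp i f) p) = _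
  rw [sum_What_along_mUp hΩ hS hp, sum_What_along_mUp hΩ hS hp]
  unfold A
  simp only [← sum_along_tr hΩ hS hp, sub_mul, Finset.sum_sub_distrib]
  ring

/-! ### The Lie derivative of the metric in the frame -/

/-- The Leibniz rule for the Lie derivative along `ξ e_c`, evaluated on `e_a, e_b`. Since `η_ab` is
constant, only the derivatives of `ξ` and the commutators with `e_c` survive. -/
theorem lieMetric_frame (hΩ : IsBox Ω) (hS : S.IsAdapted Ω) (hp : p ∈ Ω) (ξ : SF k)
    (hξ : Smooth Ω ξ) (a b c : FrameIdx k) :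
    ∑ α, ∑ β, S.frame a p α * S.frame b p β
        * S.lieMetric (fun q γ => ξ q * S.frame c q γ) p α β
      = along (S.frame a) ξ p * eta c b + along (S.frame b) ξ p * eta c a
        - ξ p * (S.ip p (S.frame b p) (S.bracket c a p)
          + S.ip p (S.frame a p) (S.bracket c b p)) := by
  have ho := hΩ.isOpen
  have dξ := hξ.differentiableAt ho hp
  have dc : ∀ γ, DifferentiableAt ℝ (fun q => S.frame c q γ) p := fun γ =>
    (smooth_frame hS c γ).differentiableAt ho hp
  have key := along_metric_frame hΩ hS hp a b (S.frame c)
  have T1 : ∑ α, ∑ β, S.frame a p α * S.frame b p β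
      * ∑ γ, ξ p * S.frame c p γ * pd γ (fun q => S.metric q α β) p
      = ξ p * ∑ α, ∑ β, S.frame a p α * along (S.frame c) (fun q => S.metric q α β) p
        * S.frame b p β := by
    simp only [Finset.mul_sum]
    refine Finset.sum_congr rfl fun α _ => Finset.sum_congr rfl fun β _ => ?_
    rw [along_eq_sum, Finset.mul_sum, Finset.sum_mul, Finset.mul_sum]
    exact Finset.sum_congr rfl fun γ _ => by ring
  have T : ∀ a b : FrameIdx k, ∑ α, ∑ β, S.frame a p α * S.frame b p β
      * ∑ γ, S.metric p γ β * pd α (fun q => ξ q * S.frame c q γ) p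
      = along (S.frame a) ξ p * eta c b
        + ξ p * ∑ γ, ∑ β, along (S.frame a) (fun q => S.frame c q γ) p
          * S.metric p γ β * S.frame b p β := by
    intro a b
    have e1 : ∑ α, ∑ β, S.frame a p α * S.frame b p β
        * ∑ γ, S.metric p γ β * pd α (fun q => ξ q * S.frame c q γ) p
        = ∑ γ, ∑ β, along (S.frame a) (fun q => ξ q * S.frame c q γ) p
          * S.metric p γ β * S.frame b p β := by
      simp only [along_eq_sum, Finset.mul_sum, Finset.sum_mul]
      rw [Finset.sum_comm]
      conv_rhs => rw [Finset.sum_comm]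
      refine Finset.sum_congr rfl fun β _ => ?_
      rw [Finset.sum_comm]
      exact Finset.sum_congr rfl fun γ _ => Finset.sum_congr rfl fun α _ => by ring
    rw [e1, ← ip_frame hS hp c b]
    unfold ip
    simp only [Finset.mul_sum, ← Finset.sum_add_distrib]
    refine Finset.sum_congr rfl fun γ _ => Finset.sum_congr rfl fun β _ => ?_
    rw [along_mul dξ (dc γ)]; ring
  have T' : ∑ α, ∑ β, S.frame a p α * S.frame b p β
      * ∑ γ, S.metric p α γ * pd β (fun q => ξ q * S.frame c q γ) p
      = along (S.frame b) ξ p * eta c a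
        + ξ p * ∑ γ, ∑ β, along (S.frame b) (fun q => S.frame c q γ) p
          * S.metric p γ β * S.frame a p β := by
    rw [← T b a, Finset.sum_comm]
    refine Finset.sum_congr rfl fun β _ => Finset.sum_congr rfl fun α _ => ?_
    rw [mul_comm (S.frame a p α)]
    congr 1
    exact Finset.sum_congr rfl fun γ _ => by rw [metric_symm S p α γ]
  have hl : ∑ α, ∑ β, S.frame a p α * S.frame b p β
        * S.lieMetric (fun q γ => ξ q * S.frame c q γ) p α β
      = (∑ α, ∑ β, S.frame a p α * S.frame b p β
      * ∑ γ, ξ p * S.frame c p γ * pd γ (fun q => S.metric q α β) p)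
      + (∑ α, ∑ β, S.frame a p α * S.frame b p β
      * ∑ γ, S.metric p γ β * pd α (fun q => ξ q * S.frame c q γ) p)
      + ∑ α, ∑ β, S.frame a p α * S.frame b p β
      * ∑ γ, S.metric p α γ * pd β (fun q => ξ q * S.frame c q γ) p := by
    simp only [lieMetric, Finset.sum_add_distrib, mul_add]
  have hb : ∀ a b : FrameIdx k, S.ip p (S.frame b p) (S.bracket c a p)
      = ∑ γ, ∑ β, along (S.frame c) (fun q => S.frame a q γ) p * S.metric p γ β * S.frame b p β
        - ∑ γ, ∑ β, along (S.frame a) (fun q => S.frame c q γ) p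
          * S.metric p γ β * S.frame b p β := by
    intro a b
    rw [ip_comm]
    unfold ip bracket
    simp only [← Finset.sum_sub_distrib, sub_mul]
  have hswap : ∑ d, ∑ e, S.frame a p d * S.metric p d e
      * along (S.frame c) (fun q => S.frame b q e) p
      = ∑ γ, ∑ β, along (S.frame c) (fun q => S.frame b q γ) p * S.metric p γ β
        * S.frame a p β := by
    rw [Finset.sum_comm]
    exact Finset.sum_congr rfl fun d _ => Finset.sum_congr rfl fun e _ => by
      rw [metric_symm S p e d]; ring
  simp only [Finset.sum_add_distrib] at key
  rw [hl, T1, T, T', hb, hb]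
  -- `key` says that `η_ab` is constant along `e_c`; subtracting it trades the derivative of the
  -- metric for derivatives of the frame, completing the commutators.
  rw [hswap] at key
  linear_combination ξ p * key

theorem lieMetric_add (hS : IsOpen Ω) (hp : p ∈ Ω) (X Y : VF k)
    (hX : ∀ c, Smooth Ω (fun q => X q c)) (hY : ∀ c, Smooth Ω (fun q => Y q c)) (a b : Coord k) :
    S.lieMetric (fun q c => X q c + Y q c) p a b
      = S.lieMetric X p a b + S.lieMetric Y p a b := by
  unfold lieMetric
  rw [← Finset.sum_add_distrib]
  refine Finset.sum_congr rfl fun c _ => ?_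
  rw [pd_add ((hX c).differentiableAt hS hp) ((hY c).differentiableAt hS hp),
    pd_add ((hX c).differentiableAt hS hp) ((hY c).differentiableAt hS hp)]
  ring

/-- The frame spans: `ℓ` isolates the `v` component, then `n` the `u` component, and the `m_i`
determine the rest. -/
theorem eq_zero_of_frame (hS : S.IsAdapted Ω) (hp : p ∈ Ω) {t : Coord k → ℝ}
    (h : ∀ a, ∑ α, S.frame a p α * t α = 0) (α : Coord k) : t α = 0 := by
  have h1 : t .v = 0 := by simpa [sum_coord, frame] using h .one
  have h2 : t .u = 0 := by simpa [sum_coord, frame, h1] using h .two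
  have h3 : ∀ i, ∑ e, S.mUp i e p * t (.x e) = 0 := fun i => by
    simpa [sum_coord, frame, h1] using h (.tr i)
  cases α with
  | u => exact h2
  | v => exact h1
  | x f => rw [← sum_m_sum_mUp hS hp (fun e => t (.x e)) f]; simp [h3]

theorem isKilling_iff_frame (hS : S.IsAdapted Ω) (X : VF k) :
    S.IsKilling Ω X ↔ ∀ p ∈ Ω, ∀ a b, ∑ α, ∑ β, S.frame a p α * S.frame b p β
      * S.lieMetric X p α β = 0 := by
  constructor
  · intro h p hp a b
    simp [h p hp]
  · intro h p hp α β
    refine eq_zero_of_frame hS hp (t := fun β => S.lieMetric X p α β) (fun b => ?_) β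
    refine eq_zero_of_frame hS hp
      (t := fun α => ∑ β, S.frame b p β * S.lieMetric X p α β) (fun a => ?_) α
    rw [← h p hp a b]
    refine Finset.sum_congr rfl fun α _ => ?_
    rw [Finset.mul_sum]
    exact Finset.sum_congr rfl fun β _ => by ring

/-- Linearity over the three summands of `X`. The coefficient of `ℓ` contributes no commutator term,
since `ℓ` commutes with the frame. -/
theorem lieMetric_field_frame (hΩ : IsBox Ω) (hS : S.IsAdapted Ω) (hp : p ∈ Ω) {X₁ X₂ X₃ : SF k}
    (h₁ : Smooth Ω X₁) (h₂ : Smooth Ω X₂) (h₃ : Smooth Ω X₃) (a b : FrameIdx k) :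
    ∑ α, ∑ β, S.frame a p α * S.frame b p β * S.lieMetric (S.field X₁ X₂ X₃) p α β
      = along (S.frame a) X₁ p * eta .two b + along (S.frame b) X₁ p * eta .two a
        + along (S.frame a) X₂ p * eta .one b + along (S.frame b) X₂ p * eta .one a
        + along (S.frame a) X₃ p * eta (.tr 0) b + along (S.frame b) X₃ p * eta (.tr 0) a
        - X₁ p * (S.ip p (S.frame b p) (S.bracket .two a p)
          + S.ip p (S.frame a p) (S.bracket .two b p))
        - X₃ p * (S.ip p (S.frame b p) (S.bracket (.tr 0) a p)
          + S.ip p (S.frame a p) (S.bracket (.tr 0) b p)) := by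
  have ho := hΩ.isOpen
  have sm : ∀ {ξ : SF k} (_ : Smooth Ω ξ) (d : FrameIdx k) (c : Coord k),
      Smooth Ω (fun q => ξ q * S.frame d q c) := fun hξ d c => hξ.mul (smooth_frame hS d c)
  have e : ∀ α β, S.lieMetric (S.field X₁ X₂ X₃) p α β
      = S.lieMetric (fun q γ => X₁ q * S.frame .two q γ) p α β
      + S.lieMetric (fun q γ => X₂ q * S.frame .one q γ) p α β
      + S.lieMetric (fun q γ => X₃ q * S.frame (.tr 0) q γ) p α β := by
    intro α β
    rw [← lieMetric_add ho hp _ _ (sm h₁ .two) (sm h₂ .one),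
      ← lieMetric_add ho hp _ _ (fun c => (sm h₁ .two c).add (sm h₂ .one c)) (sm h₃ (.tr 0))]
    rfl
  simp only [e, mul_add, Finset.sum_add_distrib]
  rw [lieMetric_frame hΩ hS hp _ h₁, lieMetric_frame hΩ hS hp _ h₂, lieMetric_frame hΩ hS hp _ h₃,
    bracket_one hΩ hS hp, bracket_one hΩ hS hp]
  have z : ∀ V, S.ip p V 0 = 0 := fun V => by simp [ip]
  rw [z, z]
  ring

end Data

end Kundt

/-! ### The Killing equations and their reduction by the triangular coframe -/

namespace Kundt

namespace Data

variable {k : ℕ} {Ω : Set (Pt k)} {S : Data k} {f g : SF k} {p : Pt k} {X₁ X₂ X₃ : SF k}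

/-! ### The Killing equations in the frame -/

/-- The conjuncts are the frame components of the Lie derivative on the pairs `ℓℓ`, `ℓn`, `ℓm_i`,
`nn`, `nm_i`, `m_im_j`, in this order; the other pairs follow by symmetry. -/
theorem isKilling_field_iff_tensors (hΩ : IsBox Ω) (hS : S.IsAdapted Ω)
    (h₁ : Smooth Ω X₁) (h₂ : Smooth Ω X₂) (h₃ : Smooth Ω X₃) :
    S.IsKilling Ω (S.field X₁ X₂ X₃) ↔ ∀ p ∈ Ω,
      pd .v X₁ p = 0 ∧
      pd .u X₁ p + pd .v X₂ p = 0 ∧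
      (∀ i, (∑ e, S.mUp i e p * pd (.x e) X₁ p) + (if i = 0 then pd .v X₃ p else 0) = 0) ∧
      S.D2 X₂ p + S.J 0 p * X₃ p = 0 ∧
      (∀ i, S.D i X₂ p + (if i = 0 then S.D2 X₃ p else 0) - S.J i p * X₁ p
        - (S.A 0 i p + S.B i 0 p) * X₃ p = 0) ∧
      (∀ i j, (if i = 0 then S.D j X₃ p else 0) + (if j = 0 then S.D i X₃ p else 0)
        + (S.B i j p + S.B j i p) * X₁ p - (S.Dten i 0 j p + S.Dten j 0 i p) * X₃ p = 0) := by
  rw [isKilling_iff_frame hS]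
  refine forall₂_congr fun p hp => ?_
  simp only [lieMetric_field_frame hΩ hS hp h₁ h₂ h₃]
  have br : ∀ a, S.bracket a .one p = 0 := fun a => by
    rw [bracket_swap, bracket_one hΩ hS hp, neg_zero]
  have bs : ∀ a, S.bracket a a p = 0 := fun a => by ext e; simp [bracket]
  have z : ∀ V, S.ip p V 0 = 0 := fun V => by simp [ip]
  have b2 : ∀ i, S.bracket (.tr i) .two p = - S.bracket .two (.tr i) p := fun i =>
    bracket_swap S _ _ p
  have h2 := ip_two_bracket_two hΩ hS hp
  have h3 := ip_tr_bracket_two hΩ hS hp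
  have h4 := ip_tr_bracket_tr hΩ hS hp
  have h5 := ip_two_bracket_tr hΩ hS hp
  have d2 : ∀ f, along (S.frame .two) f p = S.D2 f p := fun _ => rfl
  have dt : ∀ i f, along (S.frame (.tr i)) f p = S.D i f p := fun _ _ => rfl
  constructor
  · intro h
    have e11 : pd .v X₁ p = 0 := by
      have := h .one .one
      simp only [eta, ip_one, bracket_u, along_one] at this
      linarith
    refine ⟨e11, ?_, fun i => ?_, ?_, fun i => ?_, fun i j => ?_⟩
    · have := h .one .two
      simp only [eta, br, z, ip_one, bracket_u, along_one, d2, D2_eq, e11] at this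
      linarith
    · have := h .one (.tr i)
      simp only [eta, br, z, ip_one, bracket_u, along_one, dt, D_eq, e11, eq_comm (a := (0 : Fin (k + 1)))] at this
      split_ifs at this ⊢ <;> linarith
    · have := h .two .two
      simp only [eta, bs, z, b2, ip_neg_right, h2, d2] at this
      linarith
    · have := h .two (.tr i)
      simp only [eta, bs, z, b2, ip_neg_right, h2, h3, h5, d2, dt, eq_comm (a := (0 : Fin (k + 1)))] at this
      split_ifs at this ⊢ <;> linarith
    · have := h (.tr i) (.tr j)
      simp only [eta, h3, h4, dt, eq_comm (a := (0 : Fin (k + 1)))] at this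
      split_ifs at this ⊢ <;> linarith
  · rintro ⟨e1, e2, e3, e4, e5, e6⟩ a b
    rcases a with _ | _ | i <;> rcases b with _ | _ | j <;>
      simp only [eta, bs, z, b2, br, ip_neg_right, ip_one, bracket_u, h2, h3, h4, h5, d2, dt,
        along_one, e1, eq_comm (a := (0 : Fin (k + 1)))]
    · ring
    · rw [D2_eq, e1]; linarith
    · have := e3 j
      rw [D_eq, e1]
      split_ifs at this ⊢ <;> linarith
    · rw [D2_eq, e1]; linarith
    · linarith
    · have := e5 j
      split_ifs at this ⊢ <;> linarith
    · have := e3 i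
      rw [D_eq, e1]
      split_ifs at this ⊢ <;> linarith
    · have := e5 i
      split_ifs at this ⊢ <;> linarith
    · have := e6 i j
      split_ifs at this ⊢ <;> linarith

theorem Γ_tr_add (hΩ : IsBox Ω) (hS : S.IsAdapted Ω) (hp : p ∈ Ω) (l i j : Fin (k + 1)) :
    S.Γ (.tr l) (.tr i) (.tr j) p + S.Γ (.tr l) (.tr j) (.tr i) p
      = S.Dten i l j p + S.Dten j l i p := by
  rw [Γ_add_Γ hΩ hS hp, ip_tr_bracket_tr hΩ hS hp, ip_tr_bracket_tr hΩ hS hp]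

theorem isKilling_field_iff (hΩ : IsBox Ω) (hS : S.IsAdapted Ω)
    (h₁ : Smooth Ω X₁) (h₂ : Smooth Ω X₂) (h₃ : Smooth Ω X₃)
    (Xt : Fin (k + 1) → SF k) (hXt : Xt = fun i => if i = 0 then X₃ else 0) :
    S.IsKilling Ω (S.field X₁ X₂ X₃) ↔ ∀ p ∈ Ω,
        pd .v X₁ p = 0 ∧
        pd .u X₁ p + pd .v X₂ p = 0 ∧
        (∑ e, S.mUp 0 e p * pd (.x e) X₁ p) + pd .v X₃ p = 0 ∧
        (∀ n : Fin k, ∑ e, S.mUp n.succ e p * pd (.x e) X₁ p = 0) ∧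
        S.D2 X₂ p + ∑ i, S.J i p * Xt i p = 0 ∧
        (∀ i, S.D i X₂ p + S.D2 (Xt i) p - S.J i p * X₁ p
          - ∑ j, (S.A j i p + S.B i j p) * Xt j p = 0) ∧
        (∀ i j, S.D j (Xt i) p + S.D i (Xt j) p + 2 * S.Bsym i j p * X₁ p
          - ∑ l, (S.Γ (.tr l) (.tr i) (.tr j) p + S.Γ (.tr l) (.tr j) (.tr i) p) * Xt l p
            = 0) := by
  rw [isKilling_field_iff_tensors hΩ hS h₁ h₂ h₃]
  refine forall₂_congr fun p hp => ?_
  subst hXt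
  have hsum : ∀ F : Fin (k + 1) → ℝ, ∑ i, F i * (if i = 0 then X₃ else 0 : SF k) p = F 0 * X₃ p := by
    intro F
    rw [Finset.sum_eq_single 0] <;> simp +contextual
  have hD2 : ∀ i : Fin (k + 1), S.D2 (if i = 0 then X₃ else 0 : SF k) p
      = if i = 0 then S.D2 X₃ p else 0 := by
    intro i; split_ifs <;> [rfl; exact along_zero]
  have hD : ∀ i j : Fin (k + 1), S.D j (if i = 0 then X₃ else 0 : SF k) p
      = if i = 0 then S.D j X₃ p else 0 := by
    intro i j; split_ifs <;> [rfl; exact along_zero]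
  have hB : ∀ i j, 2 * S.Bsym i j p = S.B i j p + S.B j i p := fun i j => by unfold Bsym; ring
  simp only [hsum, hD2, hD, Γ_tr_add hΩ hS hp, hB]
  rw [Fin.forall_fin_succ (P := fun i => (∑ e, S.mUp i e p * pd (.x e) X₁ p)
    + (if i = 0 then pd .v X₃ p else 0) = 0)]
  simp [and_assoc]

/-! ### Components adapted to the triangular coframe -/

theorem pd_m_succ_zero (hΩ : IsBox Ω) (hS : S.IsAdapted Ω) (hp : p ∈ Ω) (n : Fin k) (c : Coord k) :
    pd c (S.m n.succ 0) p = 0 := by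
  rw [pd_congr (g := fun _ => 0) hΩ.isOpen (fun q hq => m_succ_zero hS hq n) hp, pd_const]

theorem W_zero (hS : S.IsAdapted Ω) (hp : p ∈ Ω) : S.W 0 p = 0 := by
  unfold W
  simp [Fin.sum_univ_succ, mUp_zero_succ hS hp, hS.What_three p hp]

theorem along_W_zero (hΩ : IsBox Ω) (hS : S.IsAdapted Ω) (hp : p ∈ Ω) (Y : VF k) :
    along Y (S.W 0) p = 0 := by
  rw [along_congr (g := fun _ => 0) hΩ.isOpen (fun q hq => W_zero hS hq) hp, along_const]

/-- Since `W_3 = 0` and `m_3^r = 0`, the vector `m_3` is a multiple of `∂_3`. This holds for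
functions depending on `v` as well. -/
theorem D_zero_eq (hS : S.IsAdapted Ω) (hp : p ∈ Ω) (f : SF k) :
    S.D 0 f p = pd (.x 0) f p / S.m 0 0 p := by
  rw [D_eq, W_zero hS hp]
  simp [Fin.sum_univ_succ, mUp_zero_succ hS hp, mUp_zero_zero hS hp]
  ring

theorem B_succ_zero (hΩ : IsBox Ω) (hS : S.IsAdapted Ω) (hp : p ∈ Ω) (n : Fin k) :
    S.B n.succ 0 p = 0 := by
  unfold B
  simp [Fin.sum_univ_succ, mUp_zero_succ hS hp, pd_m_succ_zero hΩ hS hp]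

theorem B_zero_zero (hS : S.IsAdapted Ω) (hp : p ∈ Ω) :
    S.B 0 0 p = pd .u (S.m 0 0) p / S.m 0 0 p := by
  unfold B
  simp [Fin.sum_univ_succ, mUp_zero_succ hS hp, mUp_zero_zero hS hp]
  ring

theorem B_succ_succ (hΩ : IsBox Ω) (hS : S.IsAdapted Ω) (hp : p ∈ Ω) (n r : Fin k) :
    S.B n.succ r.succ p = ∑ s : Fin k, pd .u (S.m n.succ s.succ) p * S.mUp r.succ s.succ p := by
  unfold B
  simp [Fin.sum_univ_succ, pd_m_succ_zero hΩ hS hp]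

theorem J_zero (hΩ : IsBox Ω) (hS : S.IsAdapted Ω) (hp : p ∈ Ω) : S.J 0 p = S.D 0 S.H p := by
  have : S.D2 (S.W 0) p = 0 := along_W_zero hΩ hS hp _
  unfold J
  simp [Fin.sum_univ_succ, this, W_zero hS hp, B_succ_zero hΩ hS hp]

theorem J_succ (hS : S.IsAdapted Ω) (hp : p ∈ Ω) (n : Fin k) :
    S.J n.succ p = S.D n.succ S.H p - S.D2 (S.W n.succ) p
      - ∑ r : Fin k, S.B r.succ n.succ p * S.W r.succ p := by
  unfold J
  simp [Fin.sum_univ_succ, W_zero hS hp]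

theorem Dten_zero_right (S : Data k) (i : Fin (k + 1)) (p : Pt k) : S.Dten i 0 0 p = 0 := by
  unfold Dten
  exact Finset.sum_eq_zero fun e _ => Finset.sum_eq_zero fun f _ => by ring

theorem Dten_succ_zero_succ (hΩ : IsBox Ω) (hS : S.IsAdapted Ω) (hp : p ∈ Ω) (n r : Fin k) :
    S.Dten n.succ 0 r.succ p = - ∑ s : Fin k,
      pd (.x 0) (S.m n.succ s.succ) p / S.m 0 0 p * S.mUp r.succ s.succ p := by
  unfold Dten
  simp [Fin.sum_univ_succ, pd_m_succ_zero hΩ hS hp, mUp_zero_succ hS hp, mUp_zero_zero hS hp]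
  exact Finset.sum_congr rfl fun s _ => by ring

theorem Dten_zero_zero_succ (hS : S.IsAdapted Ω) (hp : p ∈ Ω) (n : Fin k) :
    S.Dten 0 0 n.succ p = ∑ r : Fin k, S.mUp n.succ r.succ p *
      ((pd (.x r.succ) (S.m 0 0) p - pd (.x 0) (S.m 0 r.succ) p) / S.m 0 0 p) := by
  unfold Dten
  simp [Fin.sum_univ_succ, mUp_zero_succ hS hp, mUp_zero_zero hS hp]
  rw [← Finset.sum_neg_distrib, add_assoc, ← Finset.sum_add_distrib, mul_comm (S.m 0 0 p)⁻¹,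
    sub_self, mul_zero, zero_add]
  exact Finset.sum_congr rfl fun s _ => by ring

theorem A_zero_zero (S : Data k) (p : Pt k) : S.A 0 0 p = 0 := by
  simp [A, Dten_zero_right]

theorem A_zero_succ (hΩ : IsBox Ω) (hS : S.IsAdapted Ω) (hp : p ∈ Ω) (n : Fin k) :
    S.A 0 n.succ p = - S.D 0 (S.W n.succ) p
      + ∑ r : Fin k, S.Dten r.succ 0 n.succ p * S.W r.succ p := by
  have : S.D n.succ (S.W 0) p = 0 := along_W_zero hΩ hS hp _
  unfold A
  simp [Fin.sum_univ_succ, this, W_zero hS hp]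

theorem sum_mUp_succ_m (hS : S.IsAdapted Ω) (hp : p ∈ Ω) (s t : Fin k) :
    ∑ r : Fin k, S.mUp r.succ s.succ p * S.m r.succ t.succ p = if s = t then 1 else 0 := by
  have := sum_mUp_m hS hp s.succ t.succ
  simpa [Fin.sum_univ_succ, mUp_zero_succ hS hp] using this

/-- Because `m_3^s = 0`, the block of the inverse coframe with indices from `4` on is itself
invertible, with inverse the corresponding block of the coframe. -/
theorem eq_zero_of_sum_mUp_succ (hS : S.IsAdapted Ω) (hp : p ∈ Ω) {t : Fin k → ℝ}
    (h : ∀ n : Fin k, ∑ r : Fin k, S.mUp n.succ r.succ p * t r = 0) (s : Fin k) : t s = 0 := by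
  have h1 : ∑ n : Fin k, S.m n.succ s.succ p * ∑ r : Fin k, S.mUp n.succ r.succ p * t r = t s := by
    simp_rw [Finset.mul_sum]
    rw [Finset.sum_comm]
    have : ∀ r, ∑ n : Fin k, S.m n.succ s.succ p * (S.mUp n.succ r.succ p * t r)
        = (∑ n : Fin k, S.mUp n.succ r.succ p * S.m n.succ s.succ p) * t r := by
      intro r; rw [Finset.sum_mul]; exact Finset.sum_congr rfl fun e _ => by ring
    simp [this, sum_mUp_succ_m hS hp]
  rw [← h1]; simp [h]

/-- An upper triangular matrix `Q` vanishes if `Q Uᵀ` is antisymmetric, where `U` is lower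
triangular and invertible with inverse `mᵀ`. -/
theorem eq_zero_of_antisymm_of_triangular {n : ℕ} {U m Q : Fin n → Fin n → ℝ}
    (hU : ∀ r s, r < s → U r s = 0) (hUm : ∀ s t, ∑ r, U r s * m r t = if s = t then 1 else 0)
    (hQ : ∀ a s, s < a → Q a s = 0)
    (h : ∀ a r, ∑ s, Q a s * U r s + ∑ s, Q r s * U a s = 0) (a t : Fin n) : Q a t = 0 := by
  have h1 : ∀ a r, r < a → ∑ s, Q a s * U r s = 0 := by
    intro a r hr
    refine Finset.sum_eq_zero fun s _ => ?_
    rcases lt_or_ge s a with hs | hs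
    · rw [hQ a s hs, zero_mul]
    · rw [hU r s (lt_of_lt_of_le hr hs), mul_zero]
  -- On the diagonal antisymmetry gives twice the entry equal to zero; above the diagonal an entry
  -- is minus one below it, which vanishes by `h1`.
  have h2 : ∀ a r, ∑ s, Q a s * U r s = 0 := by
    intro a r
    rcases lt_trichotomy r a with hr | rfl | hr
    · exact h1 a r hr
    · linarith [h r r]
    · linarith [h a r, h1 r a hr]
  have h3 : ∑ r, (∑ s, Q a s * U r s) * m r t = Q a t := by
    simp_rw [Finset.sum_mul]
    rw [Finset.sum_comm]
    have : ∀ s, ∑ r, Q a s * U r s * m r t = Q a s * ∑ r, U r s * m r t := fun s => by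
      rw [Finset.mul_sum]; exact Finset.sum_congr rfl fun r _ => by ring
    simp [this, hUm]
  rw [← h3]; simp [h2]

theorem eq_zero_of_antisymm (hS : S.IsAdapted Ω) (hp : p ∈ Ω) {Q : Fin k → Fin k → ℝ}
    (hQ : ∀ n s, s < n → Q n s = 0)
    (h : ∀ n r : Fin k, ∑ s : Fin k, Q n s * S.mUp r.succ s.succ p
      + ∑ s : Fin k, Q r s * S.mUp n.succ s.succ p = 0) (n s : Fin k) : Q n s = 0 :=
  eq_zero_of_antisymm_of_triangular
    (fun _ _ hrs => mUp_eq_zero hS hp (Fin.succ_lt_succ_iff.2 hrs))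
    (sum_mUp_succ_m hS hp) hQ h n s

theorem pd_m_lower (hΩ : IsBox Ω) (hS : S.IsAdapted Ω) (hp : p ∈ Ω) (c : Coord k) {n s : Fin k}
    (h : s < n) : pd c (S.m n.succ s.succ) p = 0 := by
  rw [pd_congr (g := fun _ => 0) hΩ.isOpen
    (fun q hq => hS.upper _ _ (Fin.succ_lt_succ_iff.2 h) q hq) hp, pd_const]

/-- The Killing equations for `X₁ n + X₂ ℓ + X₃ m_3`, reduced with the help of the triangular
coframe. -/
structure KillingAt (S : Data k) (X₁ X₂ X₃ : SF k) (p : Pt k) : Prop where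
  v₁ : pd .v X₁ p = 0
  v₂ : pd .u X₁ p + pd .v X₂ p = 0
  v₃ : pd (.x 0) X₁ p / S.m 0 0 p + pd .v X₃ p = 0
  r₁ : ∀ n : Fin k, ∑ e, S.mUp n.succ e p * pd (.x e) X₁ p = 0
  nn : S.D2 X₂ p + S.D 0 S.H p * X₃ p = 0
  n₃ : S.D 0 X₂ p + S.D2 X₃ p - S.D 0 S.H p * X₁ p
    - pd .u (S.m 0 0) p / S.m 0 0 p * X₃ p = 0
  nr : ∀ n : Fin k, S.D n.succ X₂ p - (S.D n.succ S.H p - S.D2 (S.W n.succ) p) * X₁ p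
    + S.D 0 (S.W n.succ) p * X₃ p = 0
  e₃₃ : pd (.x 0) X₃ p + pd .u (S.m 0 0) p * X₁ p = 0
  e₃r : ∀ r : Fin k, pd (.x r.succ) X₃ p - S.What r.succ p * pd .v X₃ p
    + pd .u (S.m 0 r.succ) p * X₁ p
    + (pd (.x 0) (S.m 0 r.succ) p - pd (.x r.succ) (S.m 0 0) p) / S.m 0 0 p * X₃ p = 0
  ers : ∀ n r : Fin k, pd .u (S.m n.succ r.succ) p * X₁ p
    + pd (.x 0) (S.m n.succ r.succ) p / S.m 0 0 p * X₃ p = 0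

/-- For indices from `4` on, the symmetrised `m_n m_r` equations say that a triangular matrix, times
the transposed inverse coframe, is antisymmetric; so its entries `m_{nr,u} X₁ + m_{nr,3} X₃ / m_33`
vanish. Once they do, the sums with `W_r` disappear from the `n m_n` equations, and modulo the `m_3
m_3` equation the `m_3 m_n` equations are an invertible contraction of the `e₃r` equations. -/
theorem isKilling_iff_killingAt (hΩ : IsBox Ω) (hS : S.IsAdapted Ω)
    (h₁ : Smooth Ω X₁) (h₂ : Smooth Ω X₂) (h₃ : Smooth Ω X₃) :
    S.IsKilling Ω (S.field X₁ X₂ X₃) ↔ ∀ p ∈ Ω, S.KillingAt X₁ X₂ X₃ p := by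
  rw [isKilling_field_iff_tensors hΩ hS h₁ h₂ h₃]
  refine forall₂_congr fun p hp => ?_
  have m0 := hS.diag 0 p hp
  have hD0 : ∑ e, S.mUp 0 e p * pd (.x e) X₁ p = pd (.x 0) X₁ p / S.m 0 0 p := by
    simp [Fin.sum_univ_succ, mUp_zero_succ hS hp, mUp_zero_zero hS hp]; ring
  have hBsum : ∀ n r : Fin k, S.B n.succ r.succ p * X₁ p - S.Dten n.succ 0 r.succ p * X₃ p
      = ∑ s : Fin k, (pd .u (S.m n.succ s.succ) p * X₁ p
        + pd (.x 0) (S.m n.succ s.succ) p / S.m 0 0 p * X₃ p) * S.mUp r.succ s.succ p := by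
    intro n r
    rw [B_succ_succ hΩ hS hp, Dten_succ_zero_succ hΩ hS hp, neg_mul, sub_neg_eq_add,
      Finset.sum_mul, Finset.sum_mul, ← Finset.sum_add_distrib]
    exact Finset.sum_congr rfl fun s _ => by ring
  have hrs : (∀ n r : Fin k, (S.B n.succ r.succ p + S.B r.succ n.succ p) * X₁ p
      - (S.Dten n.succ 0 r.succ p + S.Dten r.succ 0 n.succ p) * X₃ p = 0) ↔
      ∀ n r : Fin k, pd .u (S.m n.succ r.succ) p * X₁ p
        + pd (.x 0) (S.m n.succ r.succ) p / S.m 0 0 p * X₃ p = 0 := by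
    constructor
    · intro h
      refine eq_zero_of_antisymm hS hp (Q := fun n r => pd .u (S.m n.succ r.succ) p * X₁ p
        + pd (.x 0) (S.m n.succ r.succ) p / S.m 0 0 p * X₃ p) (fun n s hs => ?_) fun n r => ?_
      · simp [pd_m_lower hΩ hS hp _ hs]
      · rw [← hBsum, ← hBsum]; linarith [h n r]
    · intro h n r
      have e1 := hBsum n r
      have e2 := hBsum r n
      simp only [h, zero_mul, Finset.sum_const_zero] at e1 e2
      linarith
  -- The contraction with `m_n^e` has a term `e = 3`, which is `m_n^3` times the `m_3 m_3` equation;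
  -- hence that equation is a premise here.
  have h3r : ∀ n : Fin k, pd (.x 0) X₃ p + pd .u (S.m 0 0) p * X₁ p = 0 →
      S.D n.succ X₃ p + (S.B 0 n.succ p + S.B n.succ 0 p) * X₁ p
        - (S.Dten 0 0 n.succ p + S.Dten n.succ 0 0 p) * X₃ p
      = ∑ r : Fin k, S.mUp n.succ r.succ p * (pd (.x r.succ) X₃ p - S.What r.succ p * pd .v X₃ p
    + pd .u (S.m 0 r.succ) p * X₁ p
    + (pd (.x 0) (S.m 0 r.succ) p - pd (.x r.succ) (S.m 0 0) p) / S.m 0 0 p * X₃ p) := by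
    intro n h
    rw [D_eq, B_succ_zero hΩ hS hp, Dten_zero_right, Dten_zero_zero_succ hS hp]
    unfold W B
    simp only [Fin.sum_univ_succ, hS.What_three p hp, mul_add, Finset.sum_add_distrib,
      mul_sub, Finset.sum_sub_distrib, Finset.sum_mul, add_mul, mul_zero, zero_add, add_zero,
      neg_mul, ← Finset.sum_neg_distrib]
    have e : ∀ r : Fin k, S.mUp n.succ r.succ p
        * ((pd (.x 0) (S.m 0 r.succ) p - pd (.x r.succ) (S.m 0 0) p) / S.m 0 0 p * X₃ p)
        = - (S.mUp n.succ r.succ p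
        * ((pd (.x r.succ) (S.m 0 0) p - pd (.x 0) (S.m 0 r.succ) p) / S.m 0 0 p) * X₃ p) :=
      fun r => by ring
    have e' : ∀ r : Fin k, S.mUp n.succ r.succ p * (pd .u (S.m 0 r.succ) p * X₁ p)
        = pd .u (S.m 0 r.succ) p * S.mUp n.succ r.succ p * X₁ p := fun r => by ring
    have e'' : ∀ r : Fin k, S.mUp n.succ r.succ p * (S.What r.succ p * pd .v X₃ p)
        = S.mUp n.succ r.succ p * S.What r.succ p * pd .v X₃ p := fun r => by ring
    simp only [e, e', e'', Finset.sum_neg_distrib]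
    linear_combination S.mUp n.succ 0 p * h
  have hnr : ∀ n : Fin k, (∀ n r : Fin k, pd .u (S.m n.succ r.succ) p * X₁ p
        + pd (.x 0) (S.m n.succ r.succ) p / S.m 0 0 p * X₃ p = 0) →
      S.D n.succ X₂ p - S.J n.succ p * X₁ p - (S.A 0 n.succ p + S.B n.succ 0 p) * X₃ p
      = S.D n.succ X₂ p - (S.D n.succ S.H p - S.D2 (S.W n.succ) p) * X₁ p
        + S.D 0 (S.W n.succ) p * X₃ p := by
    intro n h
    -- The sum contributed by `J` cancels the one contributed by `A`, term by term in `r`, by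
    -- `hBsum` with vanishing right-hand side.
    have : (∑ r : Fin k, S.B r.succ n.succ p * S.W r.succ p) * X₁ p
        - (∑ r : Fin k, S.Dten r.succ 0 n.succ p * S.W r.succ p) * X₃ p = 0 := by
      rw [Finset.sum_mul, Finset.sum_mul, ← Finset.sum_sub_distrib]
      refine Finset.sum_eq_zero fun r _ => ?_
      have e1 := hBsum r n
      simp only [h, zero_mul, Finset.sum_const_zero] at e1
      linear_combination S.W r.succ p * e1
    rw [J_succ hS hp, A_zero_succ hΩ hS hp, B_succ_zero hΩ hS hp]
    linear_combination this
  have h33 : S.D 0 X₃ p + S.D 0 X₃ p + (S.B 0 0 p + S.B 0 0 p) * X₁ p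
      - (S.Dten 0 0 0 p + S.Dten 0 0 0 p) * X₃ p
      = 2 / S.m 0 0 p * (pd (.x 0) X₃ p + pd .u (S.m 0 0) p * X₁ p) := by
    rw [D_zero_eq hS hp, Dten_zero_right, B_zero_zero hS hp]; field_simp; ring
  constructor
  · rintro ⟨e1, e2, e3, e4, e5, e6⟩
    have k33 : pd (.x 0) X₃ p + pd .u (S.m 0 0) p * X₁ p = 0 := by
      have := e6 0 0
      simp only [if_true] at this
      rw [h33] at this
      exact (mul_eq_zero.1 this).resolve_left (by positivity)
    have kers := hrs.1 fun n r => by simpa using e6 n.succ r.succ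
    refine ⟨e1, e2, ?_, fun n => by simpa using e3 n.succ, ?_, ?_, fun n => ?_, k33, ?_, kers⟩
    · simpa [hD0] using e3 0
    · rw [← J_zero hΩ hS hp]; exact e4
    · have := e5 0
      simpa [J_zero hΩ hS hp, A_zero_zero S p, B_zero_zero hS hp] using this
    · rw [← hnr n kers]; simpa using e5 n.succ
    · refine eq_zero_of_sum_mUp_succ hS hp fun n => ?_
      rw [← h3r n k33]
      simpa using e6 0 n.succ
  · intro h
    refine ⟨h.v₁, h.v₂, fun i => ?_, ?_, fun i => ?_, ?_⟩
    · induction i using Fin.cases with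
      | zero => simpa [hD0] using h.v₃
      | succ n => simpa using h.r₁ n
    · rw [J_zero hΩ hS hp]; exact h.nn
    · induction i using Fin.cases with
      | zero => simpa [J_zero hΩ hS hp, A_zero_zero S p, B_zero_zero hS hp] using h.n₃
      | succ n =>
        have := h.nr n
        rw [← hnr n h.ers] at this
        simpa using this
    · have k3 : ∀ n : Fin k, S.D n.succ X₃ p + (S.B 0 n.succ p + S.B n.succ 0 p) * X₁ p
        - (S.Dten 0 0 n.succ p + S.Dten n.succ 0 0 p) * X₃ p = 0 := fun n => by
        rw [h3r n h.e₃₃]; simp [h.e₃r]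
      intro i j
      induction i using Fin.cases with
      | zero =>
        induction j using Fin.cases with
        | zero => simp only [if_true]; rw [h33, h.e₃₃, mul_zero]
        | succ n => simpa using k3 n
      | succ n =>
        induction j using Fin.cases with
        | zero =>
          have := k3 n
          simp only [Fin.succ_ne_zero, if_false, if_true]
          linarith
        | succ r => simpa using hrs.2 h.ers n r

end Data

end Kundt

/-! ### Parallelism of `m_3`, the commutator with `ℓ`, and the two cases -/

namespace Kundt

/-- `f` is differentiable at `p` and its derivative along `Y` there is `a`. -/
structure HasAlong {k : ℕ} (Y : VF k) (f : SF k) (p : Pt k) (a : ℝ) : Prop where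
  diff : DifferentiableAt ℝ f p
  eq : along Y f p = a

namespace HasAlong

variable {k : ℕ} {Ω : Set (Pt k)} {Y : VF k} {f g : SF k} {p : Pt k} {a b : ℝ}

theorem add (hf : HasAlong Y f p a) (hg : HasAlong Y g p b) :
    HasAlong Y (fun q => f q + g q) p (a + b) :=
  ⟨hf.1.fun_add hg.1, by rw [along_add hf.1 hg.1, hf.2, hg.2]⟩

theorem sub (hf : HasAlong Y f p a) (hg : HasAlong Y g p b) :
    HasAlong Y (fun q => f q - g q) p (a - b) :=
  ⟨hf.1.fun_sub hg.1, by rw [along_sub hf.1 hg.1, hf.2, hg.2]⟩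

theorem neg (hf : HasAlong Y f p a) : HasAlong Y (fun q => - f q) p (-a) :=
  ⟨hf.1.fun_neg, by rw [along_neg, hf.2]⟩

theorem mul (hf : HasAlong Y f p a) (hg : HasAlong Y g p b) :
    HasAlong Y (fun q => f q * g q) p (a * g p + f p * b) :=
  ⟨hf.1.fun_mul hg.1, by rw [along_mul hf.1 hg.1, hf.2, hg.2]⟩

theorem div (hf : HasAlong Y f p a) (hg : HasAlong Y g p b) (h : g p ≠ 0) :
    HasAlong Y (fun q => f q / g q) p ((a * g p - f p * b) / g p ^ 2) :=
  ⟨by simpa only [div_eq_mul_inv] using hf.1.fun_mul (hg.1.fun_inv h), by rw [along_div hf.1 hg.1 h, hf.2, hg.2]⟩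

theorem const (c : ℝ) : HasAlong Y (fun _ => c) p 0 := ⟨differentiableAt_const c, along_const c⟩

theorem congr (ho : IsOpen Ω) (hp : p ∈ Ω) (hf : HasAlong Y f p a) (h : ∀ q ∈ Ω, g q = f q) :
    along Y g p = a := by
  rw [along_congr ho h hp, hf.2]

theorem pd_congr {c : Coord k} (ho : IsOpen Ω) (hp : p ∈ Ω)
    (hf : HasAlong (fun _ => Pi.single c 1) f p a) (h : ∀ q ∈ Ω, g q = f q) : pd c g p = a :=
  hf.congr ho hp h

/-- Used to differentiate the Killing equations, which hold on all of `Ω`. -/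
theorem eq_zero (ho : IsOpen Ω) (hp : p ∈ Ω) (hf : HasAlong Y f p a) (h : ∀ q ∈ Ω, f q = 0) :
    a = 0 := by
  rw [← hf.2, along_congr (g := fun _ => 0) ho h hp, along_const]

theorem of_eq (hf : HasAlong Y f p a) (h : a = b) : HasAlong Y f p b := h ▸ hf

end HasAlong

variable {k : ℕ} {Ω : Set (Pt k)} {f g : SF k} {p : Pt k}

theorem Smooth.hasPd (hf : Smooth Ω f) (ho : IsOpen Ω) (hp : p ∈ Ω) (c : Coord k) :
    HasAlong (fun _ => Pi.single c 1) f p (Kundt.pd c f p) :=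
  ⟨hf.differentiableAt ho hp, rfl⟩

theorem hasPd_coord (c d : Coord k) (p : Pt k) :
    HasAlong (fun _ => Pi.single c 1) (fun q => q d) p (if d = c then 1 else 0) :=
  ⟨(Smooth.coord (Ω := Set.univ) d).differentiableAt isOpen_univ trivial, pd_coord d⟩

theorem hasPd_v_of_funOf (hf : Smooth Ω f) (h : FunOf Ω {.v}ᶜ f) (ho : IsOpen Ω) (hp : p ∈ Ω) :
    HasAlong (fun _ => Pi.single .v 1) f p 0 :=
  (hf.hasPd ho hp .v).of_eq (h.pd_eq_zero ho hp (by simp))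

/-- If `g f` vanishes on an open set then `g` vanishes wherever `f` has a nonzero derivative. -/
theorem eq_zero_of_mul_eq_zero_of_pd_ne_zero (ho : IsOpen Ω) (hg : ContinuousOn g Ω) (hp : p ∈ Ω)
    (h : ∀ q ∈ Ω, g q * f q = 0) {c : Coord k} (hf : pd c f p ≠ 0) : g p = 0 := by
  by_contra hne
  apply hf
  have h0 : f =ᶠ[nhds p] fun _ => 0 := by
    filter_upwards [(hg.continuousAt (ho.mem_nhds hp)).eventually_ne hne, ho.mem_nhds hp]
      with q h1 h2
    exact (mul_eq_zero.1 (h q h2)).resolve_left h1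
  unfold pd
  rw [h0.fderiv_eq]; simp

namespace Data

variable {S : Data k} {X₁ X₂ X₃ : SF k}

theorem smooth_D2 (hΩ : IsBox Ω) (hS : S.IsAdapted Ω) (hf : Smooth Ω f) : Smooth Ω (S.D2 f) :=
  hf.along hΩ.isOpen (smooth_frame hS .two)

theorem smooth_D (hΩ : IsBox Ω) (hS : S.IsAdapted Ω) (hf : Smooth Ω f) (i : Fin (k + 1)) :
    Smooth Ω (S.D i f) :=
  hf.along hΩ.isOpen (smooth_frame hS (.tr i))

/-! ### Parallelism of the distinguished transverse direction -/

theorem Dten_zero_eq (S : Data k) (p : Pt k) (j l : Fin (k + 1)) :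
    S.Dten 0 j l p = ∑ e, S.mUp j e p * ∑ f, S.mUp l f p *
      (pd (.x f) (S.m 0 e) p - pd (.x e) (S.m 0 f) p) := by
  unfold Dten
  simp only [mul_sub, Finset.sum_sub_distrib, Finset.mul_sum]
  congr 1
  · exact Finset.sum_congr rfl fun e _ => Finset.sum_congr rfl fun f _ => by ring
  · rw [Finset.sum_comm]
    exact Finset.sum_congr rfl fun e _ => Finset.sum_congr rfl fun f _ => by ring

/-- Up to sign the `D_3jl` are the frame components of the exterior derivative of the covector `m_3e
dx^e` at fixed `u`, and contraction with the frame is invertible. -/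
theorem Dten_zero_eq_zero_iff (hS : S.IsAdapted Ω) (hp : p ∈ Ω) :
    (∀ j l, S.Dten 0 j l p = 0) ↔ ∀ e f, pd (.x f) (S.m 0 e) p = pd (.x e) (S.m 0 f) p := by
  constructor
  · intro h e f
    have h1 : ∀ l, ∑ f, S.mUp l f p * (pd (.x f) (S.m 0 e) p - pd (.x e) (S.m 0 f) p) = 0 := by
      intro l
      rw [← sum_m_sum_mUp hS hp (fun e => ∑ f, S.mUp l f p *
        (pd (.x f) (S.m 0 e) p - pd (.x e) (S.m 0 f) p)) e]
      simp [← Dten_zero_eq, h]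
    have h2 := sum_m_sum_mUp hS hp (fun f => pd (.x f) (S.m 0 e) p - pd (.x e) (S.m 0 f) p) f
    simp only [h1, mul_zero, Finset.sum_const_zero] at h2
    linarith
  · intro h j l
    rw [Dten_zero_eq]
    simp [h]

theorem Dten_swap (S : Data k) (p : Pt k) (i j l : Fin (k + 1)) :
    S.Dten i j l p = - S.Dten i l j p := by
  unfold Dten
  simp only [← Finset.sum_neg_distrib]
  exact Finset.sum_congr rfl fun e _ => Finset.sum_congr rfl fun f _ => by ring

/-- By Koszul's formula, `Γ_{3i1}` vanishes identically. The part of `Γ_{3nr}` symmetric in `n, r`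
vanishes, by triangularity, exactly when `m_{nr,3} = 0`; the rest of the transverse conditions is
then closedness of `m_3` at fixed `u`, and `Γ_{3n2} = 0` becomes the relation between `D_3 W_n` and
`B_3n`. -/
theorem threeParallel_iff (hΩ : IsBox Ω) (hS : S.IsAdapted Ω) :
    S.ThreeParallel Ω ↔ ∀ p ∈ Ω,
      (∀ n s : Fin k, pd (.x 0) (S.m n.succ s.succ) p = 0) ∧
      (∀ e f, pd (.x f) (S.m 0 e) p = pd (.x e) (S.m 0 f) p) ∧
      (∀ n : Fin k, S.D 0 (S.W n.succ) p + S.B 0 n.succ p = 0) := by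
  refine forall₂_congr fun p hp => ?_
  have m0 := hS.diag 0 p hp
  have z : ∀ V, S.ip p V 0 = 0 := fun V => by simp [ip]
  have g1 : ∀ i, 2 * S.Γ (.tr 0) (.tr i) .one p = 0 := fun i => by
    rw [two_mul_Γ hΩ hS hp, bracket_one hΩ hS hp, bracket_swap S _ .one, bracket_one hΩ hS hp,
      ip_one, bracket_u]
    simp [z]
  have g2 : ∀ i, 2 * S.Γ (.tr 0) (.tr i) .two p = - S.B 0 i p + S.B i 0 p + S.A 0 i p :=
    fun i => by
    rw [two_mul_Γ hΩ hS hp, bracket_swap S (.tr 0) .two, ip_neg_right, ip_tr_bracket_two hΩ hS hp,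
      ip_tr_bracket_two hΩ hS hp, ip_two_bracket_tr hΩ hS hp]
    ring
  have g3 : ∀ i j, 2 * S.Γ (.tr 0) (.tr i) (.tr j) p
      = S.Dten 0 j i p + S.Dten i 0 j p + S.Dten j 0 i p := fun i j => by
    rw [two_mul_Γ hΩ hS hp, ip_tr_bracket_tr hΩ hS hp, ip_tr_bracket_tr hΩ hS hp,
      ip_tr_bracket_tr hΩ hS hp]
  constructor
  · intro h
    have h0 : ∀ n s : Fin k, pd (.x 0) (S.m n.succ s.succ) p = 0 := by
      refine eq_zero_of_antisymm hS hp (Q := fun n s : Fin k => pd (.x 0) (S.m n.succ s.succ) p)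
        (fun n s hs => pd_m_lower hΩ hS hp _ hs) fun n r => ?_
      have e : ∀ n r : Fin k, ∑ s : Fin k, pd (.x 0) (S.m n.succ s.succ) p
          * S.mUp r.succ s.succ p = - S.m 0 0 p * S.Dten n.succ 0 r.succ p := by
        intro n r
        rw [Dten_succ_zero_succ hΩ hS hp, neg_mul_neg, Finset.mul_sum]
        exact Finset.sum_congr rfl fun s _ => by field_simp
      rw [e, e]
      have a1 := g3 n.succ r.succ
      have a2 := g3 r.succ n.succ
      rw [h] at a1 a2
      -- Adding the conditions for `(n, r)` and `(r, n)` cancels the `D_3nr` terms.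
      have a3 := Dten_swap S p 0 n.succ r.succ
      linear_combination (S.m 0 0 p / 2) * (a1 + a2) + (S.m 0 0 p / 2) * a3
    have hD : ∀ n r : Fin k, S.Dten n.succ 0 r.succ p = 0 := fun n r => by
      rw [Dten_succ_zero_succ hΩ hS hp]; simp [h0]
    have hD0 : ∀ j l, S.Dten 0 j l p = 0 := by
      have c1 : ∀ n : Fin k, S.Dten 0 0 n.succ p = 0 := fun n => by
        have := g3 n.succ 0
        rw [h, Dten_zero_right] at this
        linarith
      intro j l
      induction j using Fin.cases with
      | zero =>
        induction l using Fin.cases with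
        | zero => exact Dten_zero_right S _ p
        | succ n => exact c1 n
      | succ n =>
        induction l using Fin.cases with
        | zero => rw [Dten_swap, c1, neg_zero]
        | succ r =>
          have := g3 r.succ n.succ
          rw [h, hD, hD] at this
          linarith
    refine ⟨h0, (Dten_zero_eq_zero_iff hS hp).1 hD0, fun n => ?_⟩
    have := g2 n.succ
    rw [h, B_succ_zero hΩ hS hp, A_zero_succ hΩ hS hp] at this
    simp only [hD, zero_mul, Finset.sum_const_zero] at this
    linarith
  · rintro ⟨h0, h1, h2⟩ i a
    have hD : ∀ n r : Fin k, S.Dten n.succ 0 r.succ p = 0 := fun n r => by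
      rw [Dten_succ_zero_succ hΩ hS hp]; simp [h0]
    have hD0 := (Dten_zero_eq_zero_iff hS hp).2 h1
    suffices 2 * S.Γ (.tr 0) (.tr i) a p = 0 by linarith
    rcases a with _ | _ | j
    · exact g1 i
    · rw [g2]
      induction i using Fin.cases with
      | zero => rw [A_zero_zero]; ring
      | succ n =>
        rw [B_succ_zero hΩ hS hp, A_zero_succ hΩ hS hp]
        simp only [hD, zero_mul, Finset.sum_const_zero]
        linarith [h2 n]
    · rw [g3, hD0]
      induction i using Fin.cases with
      | zero => rw [hD0, Dten_zero_right]; ring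
      | succ n =>
        induction j using Fin.cases with
        | zero => rw [hD0, Dten_zero_right]; ring
        | succ r => rw [hD, hD]; ring

/-! ### The derivative of a Killing vector along `ℓ` -/

/-- The coefficients of the frame do not depend on `v`; the same argument gives `pd_v_D`. -/
theorem pd_v_D2 (hΩ : IsBox Ω) (hS : S.IsAdapted Ω) (hf : Smooth Ω f) (hp : p ∈ Ω) :
    pd .v (S.D2 f) p = S.D2 (pd .v f) p := by
  have ho := hΩ.isOpen
  have := (((hf.pd ho .u).hasPd ho hp .v).sub
    ((hasPd_v_of_funOf hS.smooth_H hS.funOf_H ho hp).mul ((hf.pd ho .v).hasPd ho hp .v))).pd_congr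
    ho hp (g := S.D2 f) (fun q _ => D2_eq S f q)
  rw [this, D2_eq, pd_comm hf ho hp .v .u]; ring

theorem pd_v_D (hΩ : IsBox Ω) (hS : S.IsAdapted Ω) (hf : Smooth Ω f) (hp : p ∈ Ω)
    (i : Fin (k + 1)) : pd .v (S.D i f) p = S.D i (pd .v f) p := by
  have ho := hΩ.isOpen
  have hsum : HasAlong (fun _ => Pi.single .v 1)
      (fun q => ∑ e, S.mUp i e q * pd (.x e) f q) p
      (∑ e, S.mUp i e p * pd (.x e) (pd .v f) p) := by
    refine ⟨DifferentiableAt.fun_sum fun e _ => (((smooth_mUp hS i e).mul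
      (hf.pd ho _)).differentiableAt ho hp), ?_⟩
    rw [along_sum fun e _ => ((smooth_mUp hS i e).mul (hf.pd ho _)).differentiableAt ho hp]
    refine Finset.sum_congr rfl fun e _ => ?_
    rw [((hasPd_v_of_funOf (smooth_mUp hS i e) (funOf_mUp hS i e) ho hp).mul
      ((hf.pd ho (.x e)).hasPd ho hp .v)).2, pd_comm hf ho hp]
    ring
  have := (((hasPd_v_of_funOf (smooth_W hS i) (funOf_W hS i) ho hp).neg.mul
    ((hf.pd ho .v).hasPd ho hp .v)).add hsum).pd_congr
    ho hp (g := S.D i f) (fun q _ => D_eq S i f q)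
  rw [this, D_eq]; ring

theorem hasPd_v_D2_of_funOf (hΩ : IsBox Ω) (hS : S.IsAdapted Ω) (hf : Smooth Ω f)
    (h : FunOf Ω {.v}ᶜ f) (hp : p ∈ Ω) : HasAlong (fun _ => Pi.single .v 1) (S.D2 f) p 0 := by
  refine ((smooth_D2 hΩ hS hf).hasPd hΩ.isOpen hp .v).of_eq ?_
  rw [pd_v_D2 hΩ hS hf hp]
  exact (along_congr (g := fun _ => 0) hΩ.isOpen
    (fun q hq => h.pd_eq_zero hΩ.isOpen hq (by simp)) hp).trans (along_const _)

theorem hasPd_v_D_of_funOf (hΩ : IsBox Ω) (hS : S.IsAdapted Ω) (hf : Smooth Ω f)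
    (h : FunOf Ω {.v}ᶜ f) (hp : p ∈ Ω) (i : Fin (k + 1)) :
    HasAlong (fun _ => Pi.single .v 1) (S.D i f) p 0 := by
  refine ((smooth_D hΩ hS hf i).hasPd hΩ.isOpen hp .v).of_eq ?_
  rw [pd_v_D hΩ hS hf hp]
  exact (along_congr (g := fun _ => 0) hΩ.isOpen
    (fun q hq => h.pd_eq_zero hΩ.isOpen hq (by simp)) hp).trans (along_const _)

theorem funOf_v_of_hasPd (hΩ : IsBox Ω) (hf : Smooth Ω f)
    (h : ∀ p ∈ Ω, pd .v f p = 0) : FunOf Ω {.v}ᶜ f :=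
  funOf_of_pd hΩ hf fun p hp c hc => by
    simp only [Set.mem_compl_iff, Set.mem_singleton_iff, not_not] at hc
    exact hc ▸ h p hp

/-- The commutator of a Killing vector with `ℓ = ∂_v` is again Killing. -/
theorem killingAt_pd_v (hΩ : IsBox Ω) (hS : S.IsAdapted Ω)
    (h₁ : Smooth Ω X₁) (h₂ : Smooth Ω X₂) (h₃ : Smooth Ω X₃)
    (K : ∀ p ∈ Ω, S.KillingAt X₁ X₂ X₃ p) (hp : p ∈ Ω) :
    S.KillingAt 0 (pd .v X₂) (pd .v X₃) p := by
  have ho := hΩ.isOpen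
  have m0 := fun q hq => hS.diag 0 q hq
  have hX₁ : FunOf Ω {.v}ᶜ X₁ := funOf_v_of_hasPd hΩ h₁ fun q hq => (K q hq).v₁
  have i₁ := hasPd_v_of_funOf h₁ hX₁ ho hp
  have ipd : ∀ {f : SF k} (_ : Smooth Ω f) (_ : FunOf Ω {.v}ᶜ f) (c : Coord k),
      HasAlong (fun _ => Pi.single .v 1) (pd c f) p 0 := fun hf h c =>
    hasPd_v_of_funOf (hf.pd ho c) (h.pd hΩ hf c) ho hp
  have im : ∀ i e c, HasAlong (fun _ => Pi.single .v 1) (pd c (S.m i e)) p 0 := fun i e c =>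
    ipd (hS.smooth_m i e) (hS.funOf_m i e) c
  have im0 := hasPd_v_of_funOf (hS.smooth_m 0 0) (hS.funOf_m 0 0) ho hp
  have dH := hasPd_v_D_of_funOf hΩ hS hS.smooth_H hS.funOf_H hp
  have dW := fun n i => hasPd_v_D_of_funOf hΩ hS (smooth_W hS n) (funOf_W hS n) hp i
  have dW2 := fun n => hasPd_v_D2_of_funOf hΩ hS (smooth_W hS n) (funOf_W hS n) hp
  have d3 := h₃.hasPd ho hp .v
  have m0p := m0 p hp
  refine ⟨pd_zero, ?_, ?_, fun n => by simp [pd_zero], ?_, ?_, fun n => ?_, ?_, fun r => ?_,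
    fun n r => ?_⟩
  · have := ((ipd h₁ hX₁ .u).add ((h₂.pd ho .v).hasPd ho hp .v)).eq_zero ho hp
      (fun q hq => (K q hq).v₂)
    rw [pd_zero]; exact this
  · have := (((ipd h₁ hX₁ (.x 0)).div im0 m0p).add
      ((h₃.pd ho .v).hasPd ho hp .v)).eq_zero ho hp (fun q hq => (K q hq).v₃)
    rw [pd_zero]; simpa using this
  · have := (((smooth_D2 hΩ hS h₂).hasPd ho hp .v).add ((dH 0).mul d3)).eq_zero ho hp
      (fun q hq => (K q hq).nn)
    rw [pd_v_D2 hΩ hS h₂ hp] at this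
    linear_combination this
  · have := (((((smooth_D hΩ hS h₂ 0).hasPd ho hp .v).add
      ((smooth_D2 hΩ hS h₃).hasPd ho hp .v)).sub ((dH 0).mul i₁)).sub
      (((im 0 0 .u).div im0 m0p).mul d3)).eq_zero ho hp (fun q hq => (K q hq).n₃)
    rw [pd_v_D2 hΩ hS h₃ hp, pd_v_D hΩ hS h₂ hp] at this
    simp only [Pi.zero_apply]
    linear_combination this
  · have := ((((smooth_D hΩ hS h₂ n.succ).hasPd ho hp .v).sub
      (((dH n.succ).sub (dW2 n.succ)).mul i₁)).add ((dW n.succ 0).mul d3)).eq_zero ho hp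
      (fun q hq => (K q hq).nr n)
    rw [pd_v_D hΩ hS h₂ hp] at this
    simp only [Pi.zero_apply]
    linear_combination this
  · have := (((h₃.pd ho (.x 0)).hasPd ho hp .v).add ((im 0 0 .u).mul i₁)).eq_zero ho hp
      (fun q hq => (K q hq).e₃₃)
    rw [pd_comm h₃ ho hp] at this
    simp only [Pi.zero_apply]
    linear_combination this
  · have := (((((h₃.pd ho (.x r.succ)).hasPd ho hp .v).sub
      ((hasPd_v_of_funOf (hS.smooth_What r.succ) (hS.funOf_What r.succ) ho hp).mul
        ((h₃.pd ho .v).hasPd ho hp .v))).add ((im 0 r.succ .u).mul i₁)).add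
      ((((im 0 r.succ (.x 0)).sub (im 0 0 (.x r.succ))).div im0 m0p).mul d3)).eq_zero ho hp
      (fun q hq => (K q hq).e₃r r)
    rw [pd_comm h₃ ho hp] at this
    simp only [Pi.zero_apply]
    linear_combination this
  · have := (((im n.succ r.succ .u).mul i₁).add
      (((im n.succ r.succ (.x 0)).div im0 m0p).mul d3)).eq_zero ho hp
      (fun q hq => (K q hq).ers n r)
    simp only [Pi.zero_apply]
    linear_combination this

theorem exists_const_of_pd (hΩ : IsBox Ω) (hf : Smooth Ω f) (h : ∀ p ∈ Ω, ∀ c, pd c f p = 0) :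
    ∃ a, ∀ p ∈ Ω, f p = a := by
  obtain ⟨o, ho⟩ := hΩ.nonempty
  exact ⟨f o, fun p hp => funOf_of_pd hΩ (s := ∅) hf (fun q hq c _ => h q hq c) p hp o ho (by simp)⟩

/-- For a Killing vector `X`, the transverse differential of `X₁` is a constant multiple of the
covector `m_3`. -/
theorem exists_const_of_killingAt (hΩ : IsBox Ω) (hS : S.IsAdapted Ω)
    (h₁ : Smooth Ω X₁) (h₂ : Smooth Ω X₂) (h₃ : Smooth Ω X₃)
    (K : ∀ p ∈ Ω, S.KillingAt X₁ X₂ X₃ p) :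
    ∃ c : ℝ, ∀ p ∈ Ω, pd .v X₃ p = -c ∧ ∀ e, pd (.x e) X₁ p = c * S.m 0 e p := by
  have ho := hΩ.isOpen
  have K' := fun p hp => killingAt_pd_v hΩ hS h₁ h₂ h₃ K (p := p) hp
  have s3 := h₃.pd ho .v
  -- In the transverse frame the differential of `X₁` has no component along `m_n` by `r₁`; its
  -- `m_3` component is `-X_{3,v}` by `v₃`.
  have hg : ∀ p ∈ Ω, ∀ e, pd (.x e) X₁ p = - (pd .v X₃ p * S.m 0 e p) := by
    intro p hp e
    have m0 := hS.diag 0 p hp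
    have := sum_m_sum_mUp hS hp (fun e => pd (.x e) X₁ p) e
    rw [← this, Fin.sum_univ_succ]
    simp only [(K p hp).r₁, mul_zero, Finset.sum_const_zero, add_zero]
    simp only [Fin.sum_univ_succ, mUp_zero_succ hS hp, mUp_zero_zero hS hp, zero_mul,
      Finset.sum_const_zero, add_zero]
    linear_combination S.m 0 e p * (K p hp).v₃
  -- Write `ψ = X_{3,v}`. The commutator with `ℓ` gives `ψ_{,v} = ψ_{,3} = 0` directly. For `ψ_{,u}`
  -- and `ψ_{,r}`, its equations are combined with equality of mixed partials of `X₁`: the terms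
  -- with derivatives of `m_3e` cancel and twice the derivative of `ψ` is left.
  have hψ : ∀ p ∈ Ω, ∀ c, pd c (pd .v X₃) p = 0 := by
    intro p hp c
    have m0 := hS.diag 0 p hp
    have hd : ∀ e d, pd d (pd (.x e) X₁) p
        = - (pd d (pd .v X₃) p * S.m 0 e p + pd .v X₃ p * pd d (S.m 0 e) p) := fun e d =>
      (((s3.hasPd ho hp d).mul ((hS.smooth_m 0 e).hasPd ho hp d)).neg).pd_congr ho hp
        (fun q hq => hg q hq e)
    have hv : pd .v (pd .v X₃) p = 0 := by
      have := (K' p hp).v₃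
      rw [pd_zero] at this
      simpa using this
    have h0 : pd (.x 0) (pd .v X₃) p = 0 := by
      have := (K' p hp).e₃₃
      simp only [Pi.zero_apply] at this
      linarith
    cases c with
    | v => exact hv
    | u =>
      have e1 := (K' p hp).n₃
      rw [D_zero_eq hS hp, D2_eq, hv] at e1
      have e2 : pd (.x 0) (pd .v X₂) p = - pd (.x 0) (pd .u X₁) p :=
        ((h₁.pd ho .u).hasPd ho hp (.x 0)).neg.pd_congr ho hp
          (fun q hq => by linarith [(K q hq).v₂])
      rw [e2, pd_comm h₁ ho hp, hd] at e1
      simp only [Pi.zero_apply] at e1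
      field_simp at e1
      have : S.m 0 0 p * pd .u (pd .v X₃) p = 0 := by linarith
      exact (mul_eq_zero.1 this).resolve_left m0
    | x e =>
      induction e using Fin.cases with
      | zero => exact h0
      | succ r =>
        have e1 := (K' p hp).e₃r r
        have e2 := pd_comm h₁ ho hp (.x 0) (.x r.succ)
        rw [hd, hd, h0] at e2
        rw [hv] at e1
        simp only [Pi.zero_apply] at e1
        field_simp at e1
        have : S.m 0 0 p * pd (.x r.succ) (pd .v X₃) p = 0 := by linarith
        exact (mul_eq_zero.1 this).resolve_left m0
  obtain ⟨a, ha⟩ := exists_const_of_pd hΩ s3 hψ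
  refine ⟨-a, fun p hp => ⟨by rw [ha p hp, neg_neg], fun e => ?_⟩⟩
  rw [hg p hp, ha p hp]; ring

/-- The commutator with `ℓ` is a Killing vector with `n` component zero and constant nonzero `m_3`
component. Its `ers` equations give `m_{nr,3} = 0` and its `nr` equations give `D_3 W_n + B_3n = 0`;
closedness of `m_3` holds because `c m_3e` is the transverse gradient of `X₁`. -/
theorem threeParallel_of_killingAt (hΩ : IsBox Ω) (hS : S.IsAdapted Ω)
    (h₁ : Smooth Ω X₁) (h₂ : Smooth Ω X₂) (h₃ : Smooth Ω X₃)
    (K : ∀ p ∈ Ω, S.KillingAt X₁ X₂ X₃ p) {c : ℝ} (hc : c ≠ 0)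
    (h : ∀ p ∈ Ω, pd .v X₃ p = -c ∧ ∀ e, pd (.x e) X₁ p = c * S.m 0 e p) :
    S.ThreeParallel Ω := by
  have ho := hΩ.isOpen
  rw [threeParallel_iff hΩ hS]
  intro p hp
  have K' := killingAt_pd_v hΩ hS h₁ h₂ h₃ K hp
  have m0 := hS.diag 0 p hp
  have hd : ∀ e d, pd d (pd (.x e) X₁) p = c * pd d (S.m 0 e) p := fun e d => by
    rw [((HasAlong.const c).mul ((hS.smooth_m 0 e).hasPd ho hp d)).pd_congr ho hp
        (fun q hq => (h q hq).2 e)]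
    ring
  refine ⟨fun n s => ?_, fun e f => ?_, fun n => ?_⟩
  · have := K'.ers n s
    rw [(h p hp).1] at this
    simp only [Pi.zero_apply] at this
    field_simp at this
    simpa [hc] using this
  · have := pd_comm h₁ ho hp (.x f) (.x e)
    rw [hd, hd] at this
    exact mul_left_cancel₀ hc this
  · have e1 := K'.nr n
    have e2 : ∀ e, pd (.x e) (pd .v X₂) p = - (c * pd .u (S.m 0 e) p) := fun e => by
      rw [((h₁.pd ho .u).hasPd ho hp (.x e)).neg.pd_congr ho hp
          (fun q hq => by linarith [(K q hq).v₂]), pd_comm h₁ ho hp, hd]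
    have e3 : pd .v (pd .v X₂) p = 0 := by
      have := K'.v₂
      rw [pd_zero] at this
      linarith
    rw [D_eq, e3, (h p hp).1] at e1
    simp only [e2, Pi.zero_apply] at e1
    have e4 : ∑ e, S.mUp n.succ e p * -(c * pd .u (S.m 0 e) p) = - c * S.B 0 n.succ p := by
      unfold B
      rw [Finset.mul_sum]
      exact Finset.sum_congr rfl fun e _ => by ring
    rw [e4] at e1
    have : c * (S.D 0 (S.W n.succ) p + S.B 0 n.succ p) = 0 := by linarith
    exact (mul_eq_zero.1 this).resolve_left hc

theorem killing_form (hΩ : IsBox Ω) (hS : S.IsAdapted Ω)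
    (h₁ : Smooth Ω X₁) (h₂ : Smooth Ω X₂) (h₃ : Smooth Ω X₃)
    (K : ∀ p ∈ Ω, S.KillingAt X₁ X₂ X₃ p) :
    ∃ F₁ F₂ F₃ : SF k, Smooth Ω F₁ ∧ Smooth Ω F₂ ∧ Smooth Ω F₃ ∧
        FunOf Ω {.v}ᶜ F₁ ∧ FunOf Ω {.v}ᶜ F₂ ∧ FunOf Ω {.v}ᶜ F₃ ∧
        ∀ p ∈ Ω, X₁ p = F₁ p ∧ X₂ p = - S.D2 X₁ p * p .v + F₂ p ∧
          X₃ p = - S.D 0 X₁ p * p .v + F₃ p := by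
  have ho := hΩ.isOpen
  have hX₁ : FunOf Ω {.v}ᶜ X₁ := funOf_v_of_hasPd hΩ h₁ fun q hq => (K q hq).v₁
  have s2 : Smooth Ω fun p => X₂ p + S.D2 X₁ p * p .v :=
    h₂.add ((smooth_D2 hΩ hS h₁).mul (Smooth.coord .v))
  have s3 : Smooth Ω fun p => X₃ p + S.D 0 X₁ p * p .v :=
    h₃.add ((smooth_D hΩ hS h₁ 0).mul (Smooth.coord .v))
  refine ⟨X₁, _, _, h₁, s2, s3, hX₁, funOf_v_of_hasPd hΩ s2 fun p hp => ?_,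
    funOf_v_of_hasPd hΩ s3 fun p hp => ?_, fun p hp => ⟨rfl, by ring, by ring⟩⟩
  · have := ((h₂.hasPd ho hp .v).add ((hasPd_v_D2_of_funOf hΩ hS h₁ hX₁ hp).mul
      (hasPd_coord .v .v p))).2
    refine Eq.trans this ?_
    rw [D2_eq, (K p hp).v₁]
    simp only [if_true]
    linear_combination (K p hp).v₂
  · have := ((h₃.hasPd ho hp .v).add ((hasPd_v_D_of_funOf hΩ hS h₁ hX₁ hp 0).mul
      (hasPd_coord .v .v p))).2
    refine Eq.trans this ?_
    rw [D_zero_eq hS hp]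
    simp only [if_true]
    linear_combination (K p hp).v₃

/-- With `c = 0` the function `X₁` depends on `u` only, and `X_{3,v} = 0`. The `nn` equation of the
commutator with `ℓ` then reads `D_2 X_{2,v} = 0`, that is `X_{1,uu} = 0`. -/
theorem killing_affine (hΩ : IsBox Ω) (hS : S.IsAdapted Ω)
    (h₁ : Smooth Ω X₁) (h₂ : Smooth Ω X₂) (h₃ : Smooth Ω X₃)
    (K : ∀ p ∈ Ω, S.KillingAt X₁ X₂ X₃ p) (h : ∀ p ∈ Ω, S.D 0 X₁ p = 0) :
    ∃ c₁ c₂ : ℝ, ∀ p ∈ Ω, X₁ p = c₁ * p .u + c₂ := by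
  have ho := hΩ.isOpen
  obtain ⟨c, hc⟩ := exists_const_of_killingAt hΩ hS h₁ h₂ h₃ K
  obtain ⟨o, hoΩ⟩ := hΩ.nonempty
  have m0 := hS.diag 0 o hoΩ
  have c0 : c = 0 := by
    have := h o hoΩ
    rw [D_zero_eq hS hoΩ, (hc o hoΩ).2] at this
    simpa [m0] using this
  subst c0
  have hx : ∀ p ∈ Ω, ∀ e, pd (.x e) X₁ p = 0 := fun p hp e => by simpa using (hc p hp).2 e
  have z : ∀ {f : SF k} {p}, p ∈ Ω → ∀ d, (∀ q ∈ Ω, f q = 0) → pd d f p = 0 := fun hp d h => by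
    rw [pd_congr (g := fun _ => 0) ho h hp, pd_const]
  have huu : ∀ p ∈ Ω, ∀ d, pd d (pd .u X₁) p = 0 := by
    intro p hp d
    cases d with
    | v => rw [pd_comm h₁ ho hp]; exact z hp _ fun q hq => (K q hq).v₁
    | x e => rw [pd_comm h₁ ho hp]; exact z hp _ fun q hq => hx q hq e
    | u =>
      have K' := killingAt_pd_v hΩ hS h₁ h₂ h₃ K hp
      have e1 := K'.nn
      have e2 : pd .u (pd .v X₂) p = - pd .u (pd .u X₁) p :=
        ((h₁.pd ho .u).hasPd ho hp .u).neg.pd_congr ho hp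
          (fun q hq => by linarith [(K q hq).v₂])
      have e3 : pd .v (pd .v X₂) p = 0 := by
        have := K'.v₂
        rw [pd_zero] at this
        linarith
      rw [D2_eq, e2, e3, (hc p hp).1] at e1
      linarith
  obtain ⟨c₁, hc₁⟩ := exists_const_of_pd hΩ (h₁.pd ho .u) huu
  obtain ⟨c₂, hc₂⟩ := exists_const_of_pd hΩ (h₁.sub ((Smooth.const c₁).mul (Smooth.coord .u)))
    (fun p hp d => by
      refine ((h₁.hasPd ho hp d).sub ((HasAlong.const c₁).mul (hasPd_coord d .u p))).2.trans ?_
      cases d with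
      | u => simp [hc₁ p hp]
      | v => simp [(K p hp).v₁]
      | x e => simp [hx p hp])
  exact ⟨c₁, c₂, fun p hp => by linarith [hc₂ p hp]⟩

/-! ### The split form -/

theorem Split.pd_m_succ (hΩ : IsBox Ω) (h : S.Split Ω) (hp : p ∈ Ω) (n r : Fin k) :
    pd (.x 0) (S.m n.succ r.succ) p = 0 :=
  (h.2.2.1 n r).pd_eq_zero hΩ.isOpen hp (by simp)

theorem Split.m_zero_succ (h : S.Split Ω) (hp : p ∈ Ω) (r : Fin k) : S.m 0 r.succ p = 0 :=
  h.2.1 r p hp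

theorem Split.pd_m_zero_succ (hΩ : IsBox Ω) (h : S.Split Ω) (hp : p ∈ Ω) (r : Fin k)
    (c : Coord k) : pd c (S.m 0 r.succ) p = 0 := by
  rw [pd_congr (g := fun _ => 0) hΩ.isOpen (fun q hq => h.m_zero_succ hq r) hp, pd_const]

theorem Split.pd_m_zero (hΩ : IsBox Ω) (h : S.Split Ω) (hp : p ∈ Ω) (r : Fin k) :
    pd (.x r.succ) (S.m 0 0) p = 0 := by
  obtain ⟨M, hM, hMf, hm⟩ := h.1
  rw [pd_congr hΩ.isOpen hm hp]
  exact (hMf.pd hΩ hM _).pd_eq_zero hΩ.isOpen hp (by simp)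

theorem mUp_succ_zero (hS : S.IsAdapted Ω) (hp : p ∈ Ω) (h : ∀ r : Fin k, S.m 0 r.succ p = 0)
    (r : Fin k) : S.mUp r.succ 0 p = 0 := by
  have m0 := hS.diag 0 p hp
  have := sum_m_mUp hS hp 0 r.succ
  simp only [Fin.sum_univ_succ, h, zero_mul, Finset.sum_const_zero, add_zero,
    (Fin.succ_ne_zero r).symm, if_false] at this
  exact (mul_eq_zero.1 this).resolve_left m0

theorem Split.mUp_succ_zero (hS : S.IsAdapted Ω) (h : S.Split Ω) (hp : p ∈ Ω) (r : Fin k) :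
    S.mUp r.succ 0 p = 0 :=
  Data.mUp_succ_zero hS hp (fun s => h.m_zero_succ hp s) r

/-- In the triangular gauge a `u`-dependent rotation of the coframe is excluded, so the symmetric
part of `B` controls every `m_{nr,u}`. -/
theorem Bsym_eq_zero_iff (hΩ : IsBox Ω) (hS : S.IsAdapted Ω) (hp : p ∈ Ω) :
    (∀ n r : Fin k, S.Bsym n.succ r.succ p = 0) ↔
      ∀ n r : Fin k, pd .u (S.m n.succ r.succ) p = 0 := by
  constructor
  · intro h
    refine eq_zero_of_antisymm hS hp (Q := fun n s : Fin k => pd .u (S.m n.succ s.succ) p)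
        (fun n s hs => pd_m_lower hΩ hS hp _ hs) fun n r => ?_
    have := h n r
    rw [Bsym, B_succ_succ hΩ hS hp, B_succ_succ hΩ hS hp] at this
    linarith
  · intro h n r
    rw [Bsym, B_succ_succ hΩ hS hp, B_succ_succ hΩ hS hp]
    simp [h]

/-- The `ers` equations reduce to `m_{nr,u} X₁ = 0`. To turn this product into an alternative on all
of `Ω`, the zeros of `X₁` are controlled: its differential is nowhere zero if `c ≠ 0`, and otherwise
`X₁ = c₁ u + c₂`, whose differential is nowhere zero unless it is constant. -/
theorem Split.killing (hΩ : IsBox Ω) (hS : S.IsAdapted Ω) (hs : S.Split Ω)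
    (h₁ : Smooth Ω X₁) (h₂ : Smooth Ω X₂) (h₃ : Smooth Ω X₃)
    (K : ∀ p ∈ Ω, S.KillingAt X₁ X₂ X₃ p) :
    FunOf Ω {.u, .x 0} X₁ ∧
      (∀ p ∈ Ω, ∀ m n : Fin k, S.Bsym m.succ n.succ p * X₁ p = 0) ∧
      ((∀ p ∈ Ω, X₁ p = 0) ∨ (∀ p ∈ Ω, ∀ m n : Fin k, S.Bsym m.succ n.succ p = 0)) := by
  have ho := hΩ.isOpen
  obtain ⟨c, hc⟩ := exists_const_of_killingAt hΩ hS h₁ h₂ h₃ K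
  have hm : ∀ p ∈ Ω, ∀ n r : Fin k, pd .u (S.m n.succ r.succ) p * X₁ p = 0 := fun p hp n r => by
    have := (K p hp).ers n r
    rw [hs.pd_m_succ hΩ hp] at this
    simpa using this
  refine ⟨funOf_of_pd hΩ h₁ fun p hp d hd => ?_, fun p hp n r => ?_, ?_⟩
  · cases d with
    | u => simp at hd
    | v => exact (K p hp).v₁
    | x e =>
      induction e using Fin.cases with
      | zero => simp at hd
      | succ r => rw [(hc p hp).2, hs.m_zero_succ hp, mul_zero]
  · rw [Bsym, B_succ_succ hΩ hS hp, B_succ_succ hΩ hS hp, div_mul_eq_mul_div, add_mul,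
      Finset.sum_mul, Finset.sum_mul, Finset.sum_eq_zero, Finset.sum_eq_zero]
    · simp
    all_goals
      intro s _
      rw [mul_right_comm, hm p hp, zero_mul]
  · by_cases hz : ∀ p ∈ Ω, X₁ p = 0
    · exact Or.inl hz
    refine Or.inr fun p hp => (Bsym_eq_zero_iff hΩ hS hp).2 fun n r => ?_
    have hcont := ((hS.smooth_m n.succ r.succ).pd ho .u).continuousOn
    have key : ∀ d, pd d X₁ p ≠ 0 → pd .u (S.m n.succ r.succ) p = 0 := fun d hd =>
      eq_zero_of_mul_eq_zero_of_pd_ne_zero ho hcont hp (fun q hq => hm q hq n r) hd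
    by_cases c0 : c = 0
    · subst c0
      obtain ⟨c₁, c₂, hX⟩ := killing_affine hΩ hS h₁ h₂ h₃ K fun q hq => by
        rw [D_zero_eq hS hq, (hc q hq).2]; simp
      by_cases c1 : c₁ = 0
      · refine (mul_eq_zero.1 (hm p hp n r)).resolve_right fun h => hz fun q hq => ?_
        rw [hX p hp] at h
        rw [hX q hq]
        simpa [c1] using h
      · apply key .u
        rw [(((HasAlong.const c₁).mul (hasPd_coord .u .u p)).add (HasAlong.const c₂)).pd_congr
          ho hp hX]
        simpa using c1
    · apply key (.x 0)
      rw [(hc p hp).2]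
      exact mul_ne_zero c0 (hS.diag 0 p hp)

end Data

end Kundt

/-! ### Case 1 with `F₃ = 0` -/

namespace Kundt

variable {k : ℕ} {Ω : Set (Pt k)} {f g : SF k} {p : Pt k}

theorem pd_eq_of_hasDerivAt {c : Coord k} {a : ℝ} (hf : DifferentiableAt ℝ f p)
    (h : HasDerivAt (fun t => f (Function.update p c t)) a (p c)) : pd c f p = a :=
  (Kundt.hasDerivAt_update hf p (by simp)).unique h

theorem pd_update (hΩ : IsBox Ω) (hf : Smooth Ω f) {o : Pt k} (ho : o ∈ Ω) (hp : p ∈ Ω)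
    (c d : Coord k) : pd c (fun q => f (Function.update q d (o d))) p
      = if c = d then 0 else pd c f (Function.update p d (o d)) := by
  refine pd_eq_of_hasDerivAt ((hf.update hΩ ho d).differentiableAt hΩ.isOpen hp) ?_
  split_ifs with h
  · subst h
    simpa using hasDerivAt_const _ _
  · have : (fun t => f (Function.update (Function.update p c t) d (o d)))
        = fun t => f (Function.update (Function.update p d (o d)) c t) := by
      ext t; rw [Function.update_comm h]
    rw [this]
    exact Kundt.hasDerivAt_update
      (hf.differentiableAt hΩ.isOpen (hΩ.update_mem hp ho d)) _ (by
        conv_lhs => rw [← Function.update_eq_self c p]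
        rw [Function.update_comm h])

theorem funOf_insert_v_iff (hΩ : IsBox Ω) (hf : Smooth Ω f) (h : FunOf Ω {.v}ᶜ f) (c : Coord k) :
    FunOf Ω {c, .v}ᶜ f ↔ ∀ p ∈ Ω, pd c f p = 0 := by
  rw [funOf_iff hΩ hf]
  constructor
  · intro H p hp
    exact H p hp c (by simp)
  · intro H p hp d hd
    simp only [Set.mem_compl_iff, Set.mem_insert_iff, Set.mem_singleton_iff, not_not] at hd
    rcases hd with rfl | rfl
    · exact H p hp
    · exact h.pd_eq_zero hΩ.isOpen hp (by simp)

theorem funOf_v_insert_iff (hΩ : IsBox Ω) (hf : Smooth Ω f) (h : FunOf Ω {.v}ᶜ f) (c : Coord k) :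
    FunOf Ω {.v, c}ᶜ f ↔ ∀ p ∈ Ω, pd c f p = 0 := by
  rw [Set.pair_comm, funOf_insert_v_iff hΩ hf h]

theorem FunOf.mono {s t : Set (Coord k)} (h : FunOf Ω s f) (hst : s ⊆ t) : FunOf Ω t f :=
  fun p hp q hq hpq => h p hp q hq fun c hc => hpq c (hst hc)

theorem FunOf.insert_v {c : Coord k} (h : FunOf Ω {c, .v}ᶜ f) : FunOf Ω {.v}ᶜ f :=
  h.mono (Set.compl_subset_compl.2 (by simp))

theorem FunOf.v_insert {c : Coord k} (h : FunOf Ω {.v, c}ᶜ f) : FunOf Ω {.v}ᶜ f :=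
  h.mono (Set.compl_subset_compl.2 (by simp))

theorem FunOf.comp₂ {s : Set (Coord k)} (F : ℝ → ℝ → ℝ) (hf : FunOf Ω s f) (hg : FunOf Ω s g) :
    FunOf Ω s (fun p => F (f p) (g p)) := fun p hp q hq h => by
  simp only [hf p hp q hq h, hg p hp q hq h]

theorem FunOf.coord {c : Coord k} {s : Set (Coord k)} (h : c ∈ s) : FunOf Ω s (fun p => p c) :=
  fun _ _ _ _ hpq => hpq c h

/-- Every neighbourhood contains a coordinate box around its point. -/
theorem exists_isBox_subset {U : Set (Pt k)} (hU : U ∈ nhds p) :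
    ∃ Ω' : Set (Pt k), IsBox Ω' ∧ p ∈ Ω' ∧ Ω' ⊆ U := by
  obtain ⟨ε, hε, h⟩ := Metric.mem_nhds_iff.1 hU
  refine ⟨Metric.ball p ε, ⟨fun c => Metric.ball (p c) ε, fun c => ⟨Metric.isOpen_ball,
    ⟨p c, Metric.mem_ball_self hε⟩, (convex_ball _ _).ordConnected⟩, ball_pi p hε⟩,
    Metric.mem_ball_self hε, h⟩

namespace Data

variable {S : Data k} {X₁ X₂ X₃ F₂ F₃ : SF k}

theorem D2_of_funOf (hΩ : IsBox Ω) (hp : p ∈ Ω) (hf : FunOf Ω {.v}ᶜ f) : S.D2 f p = pd .u f p :=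
  along_two_of_funOf hΩ hp hf

theorem D_of_funOf (hΩ : IsBox Ω) (hp : p ∈ Ω) (hf : FunOf Ω {.v}ᶜ f) (i : Fin (k + 1)) :
    S.D i f p = ∑ e, S.mUp i e p * pd (.x e) f p :=
  along_tr_of_funOf hΩ hp hf i

theorem D_coord_u (S : Data k) (i : Fin (k + 1)) (p : Pt k) : S.D i (fun q => q .u) p = 0 := by
  rw [D_eq]; simp [pd_coord]

theorem D2_coord_u (S : Data k) (p : Pt k) : S.D2 (fun q => q .u) p = 1 := by
  rw [D2_eq]; simp [pd_coord]

theorem hasAlong_D (hf : Smooth Ω f) (hΩ : IsBox Ω) (hp : p ∈ Ω) (i : Fin (k + 1)) :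
    HasAlong (S.frame (.tr i)) f p (S.D i f p) :=
  ⟨hf.differentiableAt hΩ.isOpen hp, rfl⟩

theorem hasAlong_D2 (hf : Smooth Ω f) (hΩ : IsBox Ω) (hp : p ∈ Ω) :
    HasAlong (S.frame .two) f p (S.D2 f p) :=
  ⟨hf.differentiableAt hΩ.isOpen hp, rfl⟩

theorem hasAlong_D_u (S : Data k) (i : Fin (k + 1)) (p : Pt k) :
    HasAlong (S.frame (.tr i)) (fun q => q .u) p 0 :=
  ⟨(Smooth.coord (Ω := Set.univ) .u).differentiableAt isOpen_univ trivial, D_coord_u S i p⟩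

theorem hasAlong_D2_u (S : Data k) (p : Pt k) :
    HasAlong (S.frame .two) (fun q => q .u) p 1 :=
  ⟨(Smooth.coord (Ω := Set.univ) .u).differentiableAt isOpen_univ trivial, D2_coord_u S p⟩

theorem D_congr (hΩ : IsBox Ω) (hp : p ∈ Ω) (h : ∀ q ∈ Ω, f q = g q) (i : Fin (k + 1)) :
    S.D i f p = S.D i g p := along_congr hΩ.isOpen h hp

/-! ### The Killing equations when `X₁` is affine in `u` -/

/-- The equations `v₁`, `v₂`, `v₃`, `r₁` hold identically for these components. The terms `a H` and
`a W_n` come from differentiating `-a v` along `n` and `m_n`, whose `∂_v` components are `-H` and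
`-W_n`. -/
theorem killingAt_affine_iff (hΩ : IsBox Ω) (hS : S.IsAdapted Ω)
    (h₂ : Smooth Ω F₂) (hF₂ : FunOf Ω {.v}ᶜ F₂) (hF₃ : FunOf Ω {.v}ᶜ F₃)
    {a b : ℝ} (e₁ : ∀ p, X₁ p = a * p .u + b) (e₂ : ∀ p, X₂ p = - (a * p .v) + F₂ p) (hp : p ∈ Ω) :
    S.KillingAt X₁ X₂ F₃ p ↔
      S.D2 F₂ p + a * S.H p + S.D 0 S.H p * F₃ p = 0 ∧
      S.D 0 F₂ p + S.D2 F₃ p - S.D 0 S.H p * X₁ p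
        - pd .u (S.m 0 0) p / S.m 0 0 p * F₃ p = 0 ∧
      (∀ n : Fin k, S.D n.succ F₂ p + a * S.W n.succ p
        - (S.D n.succ S.H p - S.D2 (S.W n.succ) p) * X₁ p
        + S.D 0 (S.W n.succ) p * F₃ p = 0) ∧
      pd (.x 0) F₃ p + pd .u (S.m 0 0) p * X₁ p = 0 ∧
      (∀ r : Fin k, pd (.x r.succ) F₃ p + pd .u (S.m 0 r.succ) p * X₁ p
        + (pd (.x 0) (S.m 0 r.succ) p - pd (.x r.succ) (S.m 0 0) p) / S.m 0 0 p * F₃ p = 0) ∧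
      ∀ n r : Fin k, pd .u (S.m n.succ r.succ) p * X₁ p
        + pd (.x 0) (S.m n.succ r.succ) p / S.m 0 0 p * F₃ p = 0 := by
  have ho := hΩ.isOpen
  have p₁ : ∀ c, pd c X₁ p = if c = .u then a else 0 := fun c => by
    have := (((HasAlong.const a).mul (hasPd_coord c .u p)).add (HasAlong.const b)).pd_congr ho hp
      (fun q _ => e₁ q)
    rw [this]; simp [eq_comm]
  have p₂ : ∀ c, pd c X₂ p = - (if c = .v then a else 0) + pd c F₂ p := fun c => by
    have := (((HasAlong.const a).mul (hasPd_coord c .v p)).neg.add (h₂.hasPd ho hp c)).pd_congr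
      ho hp (fun q _ => e₂ q)
    rw [this]; simp [eq_comm]
  have q₂ : pd .v F₂ p = 0 := hF₂.pd_eq_zero ho hp (by simp)
  have q₃ : pd .v F₃ p = 0 := hF₃.pd_eq_zero ho hp (by simp)
  have d₂ : S.D2 X₂ p = S.D2 F₂ p + a * S.H p := by
    rw [D2_eq, D2_eq, p₂, p₂, q₂]; simp; ring
  have d : ∀ i, S.D i X₂ p = S.D i F₂ p + a * S.W i p := fun i => by
    rw [D_eq, D_eq]
    simp only [p₂, q₂]
    simp; ring
  constructor
  · intro K
    refine ⟨by rw [← d₂]; exact K.nn, ?_, fun n => by rw [← d]; exact K.nr n, K.e₃₃, fun r => ?_,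
      K.ers⟩
    · have := K.n₃
      rw [d, W_zero hS hp] at this
      linarith
    · have := K.e₃r r
      rw [q₃] at this
      linarith
  · rintro ⟨k1, k2, k3, k4, k5, k6⟩
    refine ⟨by simp [p₁], by simp [p₁, p₂, q₂], by simp [p₁, q₃], fun n => by simp [p₁],
      by rw [d₂]; exact k1, ?_, fun n => by rw [d]; exact k3 n, k4, fun r => ?_, k6⟩
    · rw [d, W_zero hS hp]; linarith
    · rw [q₃]; linarith [k5 r]

/-! ### Stationary transverse metrics -/

theorem funOf_mUp_of {s : Set (Coord k)} (h : ∀ a b, FunOf Ω s (S.m a b)) (i e : Fin (k + 1)) :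
    FunOf Ω s (S.mUp i e) := by
  intro p hp q hq hpq
  have : (Matrix.of fun a b => S.m a b p) = Matrix.of fun a b => S.m a b q := by
    ext a b
    exact h a b p hp q hq hpq
  unfold mUp
  rw [this]

theorem sum_mUp_sum_m (hS : S.IsAdapted Ω) (hp : p ∈ Ω) (t : Fin (k + 1) → ℝ)
    (a : Fin (k + 1)) : ∑ e, S.mUp a e p * ∑ i, S.m i e p * t i = t a := by
  simp_rw [Finset.mul_sum]
  rw [Finset.sum_comm]
  have : ∀ i, ∑ e, S.mUp a e p * (S.m i e p * t i)
      = (∑ e, S.m i e p * S.mUp a e p) * t i := fun i => by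
    rw [Finset.sum_mul]; exact Finset.sum_congr rfl fun f _ => by ring
  simp [this, sum_m_mUp hS hp]

/-- Contracting `g_{ef,u}` with two inverse coframes gives twice the symmetric part of `B`; in the
triangular gauge its vanishing forces every `m_{ie,u}` to vanish. -/
theorem pd_u_gT_iff (hΩ : IsBox Ω) (hS : S.IsAdapted Ω) (hp : p ∈ Ω) :
    (∀ e f, pd .u (S.gT e f) p = 0) ↔ ∀ i e, pd .u (S.m i e) p = 0 := by
  have ho := hΩ.isOpen
  have hg : ∀ e f, pd .u (S.gT e f) p
      = ∑ i, (pd .u (S.m i e) p * S.m i f p + S.m i e p * pd .u (S.m i f) p) := fun e f => by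
    unfold gT
    rw [pd_sum fun i _ => ((hS.smooth_m i e).mul (hS.smooth_m i f)).differentiableAt ho hp]
    exact Finset.sum_congr rfl fun i _ => pd_mul ((hS.smooth_m i e).differentiableAt ho hp)
      ((hS.smooth_m i f).differentiableAt ho hp)
  constructor
  · intro h
    refine eq_zero_of_antisymm_of_triangular (U := fun r s => S.mUp r s p)
      (m := fun r s => S.m r s p) (fun r s hrs => mUp_eq_zero hS hp hrs) (sum_mUp_m hS hp)
      (fun a s hs => ?_) fun a r => ?_
    · rw [pd_congr (g := fun _ => 0) ho (fun q hq => hS.upper _ _ hs q hq) hp, pd_const]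
    · have e1 : ∑ e, S.mUp a e p * ∑ f, S.mUp r f p * pd .u (S.gT e f) p = 0 := by simp [h]
      have e2 : ∀ e, ∑ f, S.mUp r f p * pd .u (S.gT e f) p
          = pd .u (S.m r e) p + ∑ i, S.m i e p * ∑ f, S.mUp r f p * pd .u (S.m i f) p := by
        intro e
        simp only [hg, Finset.mul_sum, mul_add, Finset.sum_add_distrib]
        congr 1
        · rw [Finset.sum_comm]
          have : ∀ i, ∑ f, S.mUp r f p * (pd .u (S.m i e) p * S.m i f p)
              = (∑ f, S.m i f p * S.mUp r f p) * pd .u (S.m i e) p := fun i => by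
            rw [Finset.sum_mul]; exact Finset.sum_congr rfl fun f _ => by ring
          simp [this, sum_m_mUp hS hp]
        · rw [Finset.sum_comm]
          exact Finset.sum_congr rfl fun i _ => Finset.sum_congr rfl fun f _ => by ring
      have e3 : ∑ e, S.mUp a e p * ∑ i, S.m i e p * ∑ f, S.mUp r f p * pd .u (S.m i f) p
          = ∑ f, S.mUp r f p * pd .u (S.m a f) p :=
        sum_mUp_sum_m hS hp _ a
      simp only [e2, mul_add, Finset.sum_add_distrib] at e1
      rw [e3] at e1
      rw [← e1, add_comm]
      congr 1 <;> exact Finset.sum_congr rfl fun e _ => mul_comm _ _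
  · intro h e f
    rw [hg]; simp [h]

theorem funOf_gT_iff (hΩ : IsBox Ω) (hS : S.IsAdapted Ω) :
    (∀ e f, FunOf Ω {.u, .v}ᶜ (S.gT e f)) ↔ ∀ p ∈ Ω, ∀ i e, pd .u (S.m i e) p = 0 := by
  simp only [funOf_insert_v_iff hΩ (smooth_gT hS _ _) (funOf_gT hS _ _)]
  constructor
  · intro h p hp
    exact (pd_u_gT_iff hΩ hS hp).1 fun e f => h e f p hp
  · intro h e f p hp
    exact (pd_u_gT_iff hΩ hS hp).2 (h p hp) e f

theorem pd_u_D (hΩ : IsBox Ω) (hS : S.IsAdapted Ω) (hm : ∀ p ∈ Ω, ∀ i e, pd .u (S.m i e) p = 0)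
    (hf : Smooth Ω f) (hfv : FunOf Ω {.v}ᶜ f) (hp : p ∈ Ω) (i : Fin (k + 1)) :
    pd .u (S.D i f) p = S.D i (pd .u f) p := by
  have ho := hΩ.isOpen
  have hU : ∀ e, pd .u (S.mUp i e) p = 0 := fun e =>
    (funOf_mUp_of (s := {.u, .v}ᶜ) (fun a b => (funOf_insert_v_iff hΩ (hS.smooth_m a b)
      (hS.funOf_m a b) .u).2 fun q hq => hm q hq a b) i e).pd_eq_zero ho hp (by simp)
  rw [pd_congr ho (fun q hq => D_of_funOf hΩ hq hfv i) hp, D_of_funOf hΩ hp (hfv.pd hΩ hf _),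
    pd_sum fun e _ => ((smooth_mUp hS i e).mul (hf.pd ho _)).differentiableAt ho hp]
  refine Finset.sum_congr rfl fun e _ => ?_
  rw [pd_mul ((smooth_mUp hS i e).differentiableAt ho hp) ((hf.pd ho _).differentiableAt ho hp),
    hU, pd_comm hf ho hp]
  ring

/-- With `F₃ = 0` the purely transverse equations are `m_{ie,u} X₁ = 0`, and `X₁` has no zero. -/
theorem stationary_iff (hΩ : IsBox Ω) (hS : S.IsAdapted Ω) (h₂ : Smooth Ω F₂)
    (hF₂ : FunOf Ω {.v}ᶜ F₂)
    {a b : ℝ} (e₁ : ∀ p, X₁ p = a * p .u + b) (e₂ : ∀ p, X₂ p = - (a * p .v) + F₂ p)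
    (hX₁ : ∀ p ∈ Ω, X₁ p ≠ 0) :
    S.IsKilling Ω (S.field X₁ X₂ 0) ↔ (∀ e f, FunOf Ω {.u, .v}ᶜ (S.gT e f)) ∧ ∀ p ∈ Ω,
      pd .u F₂ p + a * S.H p = 0 ∧ pd (.x 0) F₂ p = pd (.x 0) S.H p * X₁ p ∧
      ∀ n : Fin k, S.D n.succ F₂ p + a * S.W n.succ p
        - (S.D n.succ S.H p - pd .u (S.W n.succ) p) * X₁ p = 0 := by
  have s₁ : Smooth Ω X₁ := (((Smooth.const a).mul (Smooth.coord .u)).add (Smooth.const b)).congr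
    fun p _ => e₁ p
  have s₂ : Smooth Ω X₂ := (((Smooth.const a).mul (Smooth.coord .v)).neg.add h₂).congr
    fun p _ => e₂ p
  rw [isKilling_iff_killingAt hΩ hS s₁ s₂ Smooth.zero, funOf_gT_iff hΩ hS, ← forall₂_and]
  refine forall₂_congr fun p hp => ?_
  rw [killingAt_affine_iff hΩ hS h₂ hF₂ (fun _ _ _ _ _ => rfl) e₁ e₂ hp]
  have hX := hX₁ p hp
  have m0 := hS.diag 0 p hp
  have z2 : S.D2 0 p = 0 := along_zero
  have e0 : S.D 0 F₂ p - S.D 0 S.H p * X₁ p = (pd (.x 0) F₂ p - pd (.x 0) S.H p * X₁ p)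
      / S.m 0 0 p := by
    rw [D_zero_eq hS hp, D_zero_eq hS hp]; ring
  simp only [Pi.zero_apply, mul_zero, add_zero, sub_zero, pd_zero, zero_add, z2, e0,
    D2_of_funOf hΩ hp hF₂, D2_of_funOf hΩ hp (funOf_W hS _), mul_eq_zero, hX, or_false,
    div_eq_zero_iff, m0, sub_eq_zero (a := pd (.x 0) F₂ p)]
  constructor
  · rintro ⟨k1, k2, k3, k4, k5, k6⟩
    refine ⟨fun i e => ?_, k1, k2, k3⟩
    induction i using Fin.cases with
    | zero =>
      induction e using Fin.cases with
      | zero => exact k4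
      | succ r => exact k5 r
    | succ n =>
      induction e using Fin.cases with
      | zero => exact pd_m_succ_zero hΩ hS hp n _
      | succ r => exact k6 n r
  · rintro ⟨hm, k1, k2, k3⟩
    exact ⟨k1, k2, k3, hm 0 0, fun r => hm 0 _, fun n r => hm _ _⟩

/-- The Killing vectors `u n + (F₂ - v) ℓ`. -/
theorem isKilling_u_iff (hΩ : IsBox Ω) (hS : S.IsAdapted Ω) (hu : ∀ p ∈ Ω, p .u ≠ 0)
    (h₂ : Smooth Ω F₂) (hF₂ : FunOf Ω {.v}ᶜ F₂) :
    S.IsKilling Ω (S.field (fun p => p .u) (fun p => - p .v + F₂ p) 0) ↔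
        (∀ e f, FunOf Ω {.u, .v}ᶜ (S.gT e f)) ∧
        ∃ (f₂ g₂ : SF k) (b : Fin k → SF k),
          Smooth Ω f₂ ∧ FunOf Ω {.u, .v}ᶜ f₂ ∧ Smooth Ω g₂ ∧ FunOf Ω {.v, .x 0}ᶜ g₂ ∧
          (∀ n, Smooth Ω (b n) ∧ FunOf Ω {.u, .v}ᶜ (b n)) ∧
          ∀ p ∈ Ω, F₂ p = f₂ p / p .u + g₂ p / p .u ∧
            S.H p = f₂ p / p .u ^ 2 - pd .u g₂ p / p .u + g₂ p / p .u ^ 2 ∧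
            ∀ n : Fin k, S.W n.succ p = (b n p - S.D n.succ g₂ p) / p .u := by
  have ho := hΩ.isOpen
  have su : Smooth Ω (fun p => p .u) := Smooth.coord .u
  rw [stationary_iff hΩ hS h₂ hF₂ (a := 1) (b := 0) (by simp) (by simp) hu]
  refine and_congr_right fun hg => ?_
  have hm := (funOf_gT_iff hΩ hS).1 hg
  -- `W_n` is determined by a function independent of `u`
  have key : ∀ g₂ : SF k, Smooth Ω g₂ → FunOf Ω {.v}ᶜ g₂ →
      (∀ q ∈ Ω, pd .u g₂ q = F₂ q - q .u * S.H q) → ∀ p ∈ Ω, ∀ n : Fin k,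
      pd .u (fun q => q .u * S.W n.succ q + S.D n.succ g₂ q) p
        = S.D n.succ F₂ p + S.W n.succ p
          - (S.D n.succ S.H p - pd .u (S.W n.succ) p) * p .u := by
    intro g₂ sg fg hg₂ p hp n
    refine (((hasPd_coord .u .u p).mul ((smooth_W hS n.succ).hasPd ho hp .u)).add
      ((smooth_D hΩ hS sg n.succ).hasPd ho hp .u)).2.trans ?_
    rw [pd_u_D hΩ hS hm sg fg hp, D_congr hΩ hp hg₂,
      show S.D n.succ (fun q => F₂ q - q .u * S.H q) p
        = S.D n.succ F₂ p - (0 * S.H p + p .u * S.D n.succ S.H p) from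
        ((hasAlong_D h₂ hΩ hp n.succ).sub ((hasAlong_D_u S n.succ p).mul
          (hasAlong_D hS.smooth_H hΩ hp n.succ))).2]
    simp only [if_true]
    ring
  constructor
  · intro h
    obtain ⟨o, hoΩ⟩ := hΩ.nonempty
    -- The function `u F₂` must equal `f₂ + g₂`: take for `f₂` its value with `u` frozen at `o`, and
    -- for `g₂` the remainder. The `nn` equation says `(u F₂)_{,u} = F₂ - u H`.
    have sG : Smooth Ω fun p => p .u * F₂ p := su.mul h₂
    have fG : FunOf Ω {.v}ᶜ fun p => p .u * F₂ p :=
      (FunOf.coord (by simp)).comp₂ (· * ·) hF₂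
    have f2 := fG.update hΩ hoΩ .u
    have s2 := sG.update hΩ hoΩ .u
    have e2 : ({Coord.v}ᶜ \ {Coord.u} : Set (Coord k)) = {.u, .v}ᶜ := by
      ext; simp [and_comm]
    rw [e2] at f2
    have sg := sG.sub s2
    have fg : FunOf Ω {.v}ᶜ _ := fG.comp₂ (· - ·) f2.insert_v
    have hG : ∀ p ∈ Ω, pd .u (fun p => p .u * F₂ p) p = F₂ p - p .u * S.H p := fun p hp => by
      refine ((hasPd_coord .u .u p).mul (h₂.hasPd ho hp .u)).2.trans ?_
      simp only [if_true]
      linear_combination p .u * (h p hp).1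
    have hg₂ : ∀ p ∈ Ω, pd .u (fun p => p .u * F₂ p
        - Function.update p .u (o .u) .u * F₂ (Function.update p .u (o .u))) p
        = F₂ p - p .u * S.H p := fun p hp => by
      refine ((sG.hasPd ho hp .u).sub (s2.hasPd ho hp .u)).2.trans ?_
      rw [hG p hp, pd_update hΩ sG hoΩ hp]
      simp
    -- By the `n m_3` equation `(u F₂)_{,3}` is unchanged when `u` is frozen, which makes the
    -- remainder `g₂` independent of `x^3`.
    have h0G : FunOf Ω {.u, .v}ᶜ (pd (.x 0) fun p => p .u * F₂ p) := by
      rw [funOf_insert_v_iff hΩ (sG.pd ho _) (fG.pd hΩ sG _)]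
      intro p hp
      rw [pd_comm sG ho hp, pd_congr ho hG hp]
      refine ((h₂.hasPd ho hp (.x 0)).sub ((hasPd_coord (.x 0) .u p).mul
        (hS.smooth_H.hasPd ho hp (.x 0)))).2.trans ?_
      rw [(h p hp).2.1]
      simp; ring
    -- The choice of `B_n` is forced by the formula for `W_n`; by `key`, its independence of `u` is
    -- the remaining Killing equation.
    refine ⟨_, _, fun n q => q .u * S.W n.succ q + S.D n.succ (fun p => p .u * F₂ p
      - Function.update p .u (o .u) .u * F₂ (Function.update p .u (o .u))) q, s2, f2, sg,
      (funOf_v_insert_iff hΩ sg fg _).2 fun p hp => ?_, fun n => ?_, fun p hp => ?_⟩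
    · refine ((sG.hasPd ho hp (.x 0)).sub (s2.hasPd ho hp (.x 0))).2.trans ?_
      rw [pd_update hΩ sG hoΩ hp, if_neg (by simp), sub_eq_zero]
      exact h0G _ hp _ (hΩ.update_mem hp hoΩ _) fun c hc =>
        (Function.update_of_ne (fun h => hc (by simp [h])) _ _).symm
    · have sb := (su.mul (smooth_W hS n.succ)).add (smooth_D hΩ hS sg n.succ)
      refine ⟨sb, (funOf_insert_v_iff hΩ sb (funOf_v_of_hasPd hΩ sb fun p hp => ?_) _).2
        fun p hp => ?_⟩
      · refine (((hasPd_coord .v .u p).mul (hasPd_v_of_funOf (smooth_W hS n.succ)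
          (funOf_W hS _) ho hp)).add (hasPd_v_D_of_funOf hΩ hS sg fg hp n.succ)).2.trans ?_
        simp
      · rw [key _ sg fg hg₂ p hp]
        linarith [(h p hp).2.2 n]
    · have hup := hu p hp
      refine ⟨by field_simp; ring, ?_, fun n => ?_⟩
      · rw [hg₂ p hp]
        field_simp
        ring
      · field_simp
        ring
  · rintro ⟨f₂, g₂, b, sf, ff, sg, fg, hb, h⟩ p hp
    have hg₂ : ∀ q ∈ Ω, pd .u g₂ q = F₂ q - q .u * S.H q := fun q hq => by
      have := hu q hq
      rw [(h q hq).1, (h q hq).2.1]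
      field_simp
      ring
    have hup := hu p hp
    refine ⟨?_, ?_, fun n => ?_⟩
    · have e1 : pd .u (fun q => q .u * F₂ q) p = pd .u f₂ p + pd .u g₂ p :=
        ((sf.hasPd ho hp .u).add (sg.hasPd ho hp .u)).pd_congr ho hp fun q hq => by
          have := hu q hq
          rw [(h q hq).1]; field_simp
      have e2 : pd .u (fun q => q .u * F₂ q) p = (if Coord.u = Coord.u then 1 else 0) * F₂ p
          + p .u * pd .u F₂ p := ((hasPd_coord .u .u p).mul (h₂.hasPd ho hp .u)).2
      rw [e1, ff.pd_eq_zero ho hp (by simp), hg₂ p hp] at e2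
      simp only [if_true] at e2
      apply mul_left_cancel₀ hup
      linarith
    · have e1 : pd (.x 0) (pd .u g₂) p = pd (.x 0) F₂ p - ((if Coord.u = Coord.x 0 then 1 else 0)
          * S.H p + p .u * pd (.x 0) S.H p) :=
        ((h₂.hasPd ho hp (.x 0)).sub ((hasPd_coord (.x 0) .u p).mul
        (hS.smooth_H.hasPd ho hp (.x 0)))).pd_congr ho hp hg₂
      rw [pd_comm sg ho hp, pd_congr (g := fun _ => 0) ho
        (fun q hq => fg.pd_eq_zero ho hq (by simp)) hp, pd_const] at e1
      simp at e1
      linarith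
    · have e1 := key g₂ sg fg.v_insert hg₂ p hp n
      rw [pd_congr (g := b n) ho (fun q hq => by
        have := hu q hq
        rw [(h q hq).2.2 n]; field_simp; ring) hp, (hb n).2.pd_eq_zero ho hp (by simp)] at e1
      linarith

/-- The Killing vectors `n + F₂ ℓ`. -/
theorem isKilling_one_iff (hΩ : IsBox Ω) (hS : S.IsAdapted Ω) {o : Pt k} (hoΩ : o ∈ Ω)
    (h₂ : Smooth Ω F₂) (hF₂ : FunOf Ω {.v}ᶜ F₂) :
    S.IsKilling Ω (S.field (fun _ => 1) F₂ 0) ↔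
        (∀ e f, FunOf Ω {.u, .v}ᶜ (S.gT e f)) ∧
        (∀ p ∈ Ω, pd .u F₂ p = 0) ∧
        ∃ (A₀ : SF k) (C : Fin k → SF k), Smooth Ω A₀ ∧ FunOf Ω {.v, .x 0}ᶜ A₀ ∧
          (∀ n, Smooth Ω (C n) ∧ FunOf Ω {.u, .v}ᶜ (C n)) ∧
          ∀ p ∈ Ω, S.H p = F₂ p + A₀ p ∧
            ∀ n : Fin k, S.W n.succ p = antider o .u (S.D n.succ A₀) p + C n p := by
  have ho := hΩ.isOpen
  rw [stationary_iff hΩ hS h₂ hF₂ (a := 0) (b := 1) (by simp) (by simp) (by simp)]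
  refine and_congr_right fun _ => ?_
  have e2 : ({.u, .v}ᶜ : Set (Coord k)) = {Coord.v}ᶜ \ {Coord.u} := by
    ext; simp [and_comm]
  constructor
  · intro h
    -- Here `A₀ = H - F₂`: the `n m_3` equation removes its dependence on `x^3`, and the `n m_n`
    -- equation is `W_{n,u} = D_n A₀`.
    have sA := hS.smooth_H.sub h₂
    have fA : FunOf Ω {.v}ᶜ _ := hS.funOf_H.comp₂ (· - ·) hF₂
    have hC := fun n : Fin k => (exists_antider_iff hΩ (smooth_W hS n.succ) (funOf_W hS n.succ) e2
      (smooth_D hΩ hS sA n.succ) hoΩ).2 fun p hp => by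
        have e3 := (h p hp).2.2 n
        have e4 : S.D n.succ (fun p => S.H p - F₂ p) p = S.D n.succ S.H p - S.D n.succ F₂ p :=
          ((hasAlong_D hS.smooth_H hΩ hp n.succ).sub (hasAlong_D h₂ hΩ hp n.succ)).2
        rw [e4]
        linarith
    choose C sC fC hC using hC
    refine ⟨fun p hp => by linarith [(h p hp).1], _, C, sA,
      (funOf_v_insert_iff hΩ sA fA _).2 fun p hp => ?_, fun n => ⟨sC n, fC n⟩,
      fun p hp => ⟨by ring, fun n => hC n p hp⟩⟩
    refine ((hS.smooth_H.hasPd ho hp (.x 0)).sub (h₂.hasPd ho hp (.x 0))).2.trans ?_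
    linarith [(h p hp).2.1]
  · rintro ⟨hF, A₀, C, sA, fA, hC, h⟩ p hp
    refine ⟨by linarith [hF p hp], ?_, fun n => ?_⟩
    · rw [((h₂.hasPd ho hp (.x 0)).add (sA.hasPd ho hp (.x 0))).pd_congr ho hp
        (fun q hq => (h q hq).1), fA.pd_eq_zero ho hp (by simp)]
      ring
    · have := (exists_antider_iff hΩ (smooth_W hS n.succ) (funOf_W hS n.succ) e2
        (smooth_D hΩ hS sA n.succ) hoΩ).1 ⟨C n, (hC n).1, (hC n).2, fun p hp => (h p hp).2 n⟩ p hp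
      rw [this, D_congr hΩ hp (fun q hq => (h q hq).1) n.succ,
        show S.D n.succ (fun q => F₂ q + A₀ q) p = S.D n.succ F₂ p + S.D n.succ A₀ p from
        ((hasAlong_D h₂ hΩ hp n.succ).add (hasAlong_D sA hΩ hp n.succ)).2]
      ring

end Data

end Kundt

/-! ### Changes of coordinates in `u` and in `v` -/

namespace Kundt

variable {k : ℕ} {Ω : Set (Pt k)} {f g : SF k} {p : Pt k}

namespace Data

variable {S : Data k} {X₁ X₂ X₃ F₂ F₃ : SF k}

theorem IsAdapted.mono {Ω' : Set (Pt k)} (hS : S.IsAdapted Ω) (h : Ω' ⊆ Ω) : S.IsAdapted Ω' where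
  smooth_H := hS.smooth_H.mono h
  smooth_What e := (hS.smooth_What e).mono h
  smooth_m i e := (hS.smooth_m i e).mono h
  funOf_H := hS.funOf_H.mono_left h
  funOf_What e := (hS.funOf_What e).mono_left h
  funOf_m i e := (hS.funOf_m i e).mono_left h
  What_three p hp := hS.What_three p (h hp)
  upper i e hie p hp := hS.upper i e hie p (h hp)
  diag i p hp := hS.diag i p (h hp)

/-! ### Translations of `u` -/

/-- The data transported by a map of the coordinate space. -/
def comp (S : Data k) (Φ : Pt k → Pt k) : Data k where
  H q := S.H (Φ q)
  What e q := S.What e (Φ q)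
  m i e q := S.m i e (Φ q)

theorem comp_metric (S : Data k) (Φ : Pt k → Pt k) (q : Pt k) (a b : Coord k) :
    (S.comp Φ).metric q a b = S.metric (Φ q) a b := by
  cases a <;> cases b <;> rfl

theorem comp_frame (S : Data k) (Φ : Pt k → Pt k) (q : Pt k) (a : FrameIdx k) (c : Coord k) :
    (S.comp Φ).frame a q c = S.frame a (Φ q) c := by
  cases a <;> cases c <;> rfl

/-- A translation has the identity as Jacobian, so metric and frame are transported by mere
composition; at the translated point `c₁⁻¹ X₁` equals the new `u`. -/
theorem exists_translation (hΩ : IsBox Ω) (hS : S.IsAdapted Ω)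
    (h₂ : Smooth Ω X₂) (h₃ : Smooth Ω X₃) {c₁ c₂ : ℝ}
    (hX₁ : ∀ p ∈ Ω, X₁ p = c₁ * p .u + c₂) (hc : c₁ ≠ 0) :
    ∃ (S' : Data k) (Ω' : Set (Pt k)) (Φ : Pt k → Pt k) (X₂' X₃' : SF k),
        IsBox Ω' ∧ S'.IsAdapted Ω' ∧ Smooth Ω' X₂' ∧ Smooth Ω' X₃' ∧
        (∀ q, Φ q = Function.update q .u (q .u - c₂ / c₁)) ∧ Φ '' Ω' = Ω ∧
        IsCoordChange S Ω (fun p c => c₁⁻¹ * S.field X₁ X₂ X₃ p c)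
          S' Ω' (S'.field (fun q => q .u) X₂' X₃') Φ := by
  set a := c₂ / c₁ with ha
  set Φ : Pt k → Pt k := fun q => Function.update q .u (q .u - a) with hΦ
  have hcoord : ∀ c, (fun q => Φ q c) = fun q => q c - if c = .u then a else 0 := by
    intro c
    ext q
    by_cases h : c = .u
    · subst h; simp [hΦ]
    · simp [hΦ, h]
  have hsm : ∀ (U : Set (Pt k)) c, Smooth U (fun q => Φ q c) := fun U c => by
    rw [hcoord]; exact (Smooth.coord c).sub (Smooth.const _)
  have hmaps : Set.MapsTo Φ (Φ ⁻¹' Ω) Ω := fun q hq => hq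
  have hpd : ∀ c b q, pd b (fun q => Φ q c) q = if c = b then 1 else 0 := fun c b q => by
    rw [hcoord]
    refine ((hasPd_coord b c q).sub (HasAlong.const _)).2.trans (sub_zero _)
  have hagree : ∀ q q' : Pt k, (∀ c ∈ ({.v}ᶜ : Set (Coord k)), q c = q' c) →
      ∀ c ∈ ({.v}ᶜ : Set (Coord k)), Φ q c = Φ q' c := by
    intro q q' h c hc
    rw [congr_fun (hcoord c) q, congr_fun (hcoord c) q', h c hc]
  have hfun : ∀ {f : SF k}, FunOf Ω {.v}ᶜ f → FunOf (Φ ⁻¹' Ω) {.v}ᶜ (fun q => f (Φ q)) :=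
    fun hf q hq q' hq' h => hf _ hq _ hq' (hagree q q' h)
  have hinj : Function.Injective Φ := by
    intro q q' h
    ext c
    have := congr_fun h c
    rw [congr_fun (hcoord c) q, congr_fun (hcoord c) q'] at this
    linarith
  have hsurj : Function.Surjective Φ := by
    intro p
    refine ⟨Function.update p .u (p .u + a), ?_⟩
    simp [hΦ]
  refine ⟨S.comp Φ, Φ ⁻¹' Ω, Φ, fun q => c₁⁻¹ * X₂ (Φ q), fun q => c₁⁻¹ * X₃ (Φ q), ?_, ?_, ?_, ?_,
    fun q => rfl, Set.image_preimage_eq _ hsurj, ?_⟩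
  · obtain ⟨I, hI, rfl⟩ := hΩ
    refine ⟨fun c => (fun t => t - if c = .u then a else 0) ⁻¹' I c, fun c => ⟨?_, ?_, ?_⟩, ?_⟩
    · exact (hI c).1.preimage (by fun_prop)
    · obtain ⟨t, ht⟩ := (hI c).2.1
      exact ⟨t + if c = .u then a else 0, by simpa using ht⟩
    · exact (hI c).2.2.preimage_mono fun x y hxy => sub_le_sub_right hxy _
    · ext q
      simp only [Set.mem_preimage, Set.mem_pi, Set.mem_univ, true_imp_iff]
      exact forall_congr' fun c => by rw [← congr_fun (hcoord c) q]
  · exact {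
      smooth_H := hS.smooth_H.comp (hsm _) hmaps
      smooth_What := fun e => (hS.smooth_What e).comp (hsm _) hmaps
      smooth_m := fun i e => (hS.smooth_m i e).comp (hsm _) hmaps
      funOf_H := hfun hS.funOf_H
      funOf_What := fun e => hfun (hS.funOf_What e)
      funOf_m := fun i e => hfun (hS.funOf_m i e)
      What_three := fun q hq => hS.What_three _ hq
      upper := fun i e h q hq => hS.upper i e h _ hq
      diag := fun i q hq => hS.diag i _ hq }
  · exact (Smooth.const _).mul (h₂.comp (hsm _) hmaps)
  · exact (Smooth.const _).mul (h₃.comp (hsm _) hmaps)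
  · refine ⟨hsm _, hmaps, hinj.injOn, fun q _ c => hpd c .v q, fun q _ b c => ?_, fun q hq c => ?_⟩
    · rw [comp_metric]; simp [hpd]
    · simp only [hpd, field, comp_frame]
      have e : q .u = c₁⁻¹ * X₁ (Φ q) := by
        rw [hX₁ _ hq, show Φ q .u = q .u - a by simp [hΦ], ha]
        field_simp
        ring
      simp only [mul_ite, mul_one, mul_zero, Finset.sum_ite_eq, Finset.mem_univ, if_true, e]
      ring

/-! ### Shifts of `v` -/

/-- The pull-back of a bilinear form under a Jacobian that differs from the identity only in the row
of `v`. -/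
theorem sum_sum_shift (G : Coord k → Coord k → ℝ) (a b : Coord k) (A B : ℝ) :
    ∑ c, ∑ d, G c d * ((if c = a then 1 else 0) + if c = .v then A else 0)
      * ((if d = b then 1 else 0) + if d = .v then B else 0)
      = G a b + A * G .v b + B * G a .v + A * B * G .v .v := by
  have e : ∀ (F : Coord k → ℝ) (a : Coord k) (A : ℝ),
      ∑ c, F c * ((if c = a then 1 else 0) + if c = .v then A else 0) = F a + A * F .v := by
    intro F a A
    have : ∀ c, F c * ((if c = a then 1 else 0) + if c = .v then A else 0)
        = (if c = a then F c else 0) + if c = .v then A * F c else 0 := fun c => by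
      split_ifs <;> ring
    simp [this, Finset.sum_add_distrib]
  have h2 : ∀ c, ∑ d, G c d * ((if c = a then 1 else 0) + if c = .v then A else 0)
      * ((if d = b then 1 else 0) + if d = .v then B else 0)
      = (G c b + B * G c .v) * ((if c = a then 1 else 0) + if c = .v then A else 0) := fun c => by
    rw [e (fun d => G c d * ((if c = a then 1 else 0) + if c = .v then A else 0))]
    ring
  rw [Finset.sum_congr rfl fun c _ => h2 c, e (fun c => G c b + B * G c .v)]
  ring

/-- The data in the coordinate `v' = v - h`. -/
noncomputable def shift (S : Data k) (h : SF k) : Data k where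
  H q := S.H q + pd .u h q
  What e q := S.What e q + pd (.x e) h q
  m := S.m

theorem shift_mUp (S : Data k) (h : SF k) : (S.shift h).mUp = S.mUp := rfl

theorem shift_isAdapted (hΩ : IsBox Ω) (hS : S.IsAdapted Ω) {h : SF k} (sh : Smooth Ω h)
    (fh : FunOf Ω {.v, .x 0}ᶜ h) : (S.shift h).IsAdapted Ω where
  smooth_H := hS.smooth_H.add (sh.pd hΩ.isOpen _)
  smooth_What e := (hS.smooth_What e).add (sh.pd hΩ.isOpen _)
  smooth_m := hS.smooth_m
  funOf_H := hS.funOf_H.comp₂ (· + ·) (fh.v_insert.pd hΩ sh _)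
  funOf_What e := (hS.funOf_What e).comp₂ (· + ·) (fh.v_insert.pd hΩ sh _)
  funOf_m := hS.funOf_m
  What_three p hp := by
    change S.What 0 p + pd (.x 0) h p = 0
    rw [hS.What_three p hp, fh.pd_eq_zero hΩ.isOpen hp (by simp), add_zero]
  upper := hS.upper
  diag := hS.diag

theorem shift_W (hΩ : IsBox Ω) {h : SF k} (fh : FunOf Ω {.v, .x 0}ᶜ h) (hp : p ∈ Ω)
    (i : Fin (k + 1)) : (S.shift h).W i p = S.W i p + S.D i h p := by
  rw [D_of_funOf hΩ hp fh.v_insert]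
  unfold W
  rw [shift_mUp, ← Finset.sum_add_distrib]
  exact Finset.sum_congr rfl fun e _ => by simp only [shift]; ring

/-- The substitution adds `2 du dh` to the metric, which is absorbed into `H` and `Ŵ_e`. The other
ingredients do not depend on `v`, so evaluating them at the shifted point changes nothing; `F₂`
loses `h` because `X₂` contains `-v`. -/
theorem shift_isCoordChange (hS : S.IsAdapted Ω) {Ω' : Set (Pt k)} (hΩ' : IsBox Ω')
    (hsub : Ω' ⊆ Ω) {h : SF k} (sh : Smooth Ω' h) (fh : FunOf Ω' {.v, .x 0}ᶜ h)
    (hmaps : ∀ q ∈ Ω', Function.update q .v (q .v + h q) ∈ Ω)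
    (hF₂ : FunOf Ω {.v}ᶜ F₂) :
    IsCoordChange S Ω (S.field (fun p => p .u) (fun p => - p .v + F₂ p) 0)
      (S.shift h) Ω' ((S.shift h).field (fun p => p .u)
        (fun p => - p .v + (F₂ p - h p)) 0)
      (fun q => Function.update q .v (q .v + h q)) := by
  have ho := hΩ'.isOpen
  set Φ : Pt k → Pt k := fun q => Function.update q .v (q .v + h q) with hΦ
  have hcoord : ∀ c, (fun q => Φ q c) = fun q => q c + (if c = .v then 1 else 0) * h q := by
    intro c
    ext q
    by_cases hc : c = .v
    · subst hc; simp [hΦ]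
    · simp [hΦ, hc]
  have hpd : ∀ c b, ∀ q ∈ Ω', pd b (fun q => Φ q c) q
      = (if c = b then 1 else 0) + if c = .v then pd b h q else 0 := fun c b q hq => by
    rw [hcoord]
    refine ((hasPd_coord b c q).add ((HasAlong.const _).mul (sh.hasPd ho hq b))).2.trans ?_
    split_ifs <;> ring
  have hinv : ∀ {f : SF k}, FunOf Ω {.v}ᶜ f → ∀ q ∈ Ω', f (Φ q) = f q := fun hf q hq =>
    hf _ (hmaps q hq) _ (hsub hq) fun c hc => Function.update_of_ne hc _ _
  have hmet : ∀ q ∈ Ω', ∀ a b, S.metric (Φ q) a b = S.metric q a b := by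
    intro q hq a b
    cases a <;> cases b <;> simp only [metric]
    · rw [hinv hS.funOf_H q hq]
    · exact hinv (hS.funOf_What _) q hq
    · exact hinv (hS.funOf_What _) q hq
    · exact hinv (funOf_gT hS _ _) q hq
  refine ⟨fun c => ?_, hmaps, fun q hq q' hq' hqq => ?_, fun q hq c => ?_, fun q hq a b => ?_,
    fun q hq c => ?_⟩
  · rw [hcoord]; exact (Smooth.coord c).add ((Smooth.const _).mul sh)
  · have hne : ∀ c, c ≠ .v → q c = q' c := fun c hc => by
      have := congr_fun hqq c
      simpa [hΦ, hc] using this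
    ext c
    by_cases hc : c = .v
    · subst hc
      have := congr_fun hqq .v
      simp only [hΦ, Function.update_self] at this
      rw [fh.v_insert q hq q' hq' fun c hc => hne c hc] at this
      linarith
    · exact hne c hc
  · rw [hpd c .v q hq, fh.pd_eq_zero ho hq (by simp)]; simp
  · rw [Finset.sum_congr rfl fun c _ => Finset.sum_congr rfl fun d _ => by
      rw [hpd c a q hq, hpd d b q hq, hmet q hq c d], sum_sum_shift]
    have hv : pd .v h q = 0 := fh.pd_eq_zero ho hq (by simp)
    cases a <;> cases b <;> (simp [metric, shift, hv, gT]; try ring)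
  · rw [Finset.sum_congr rfl fun b _ => by rw [hpd c b q hq]]
    simp only [mul_add, Finset.sum_add_distrib, mul_ite, mul_one, mul_zero, Finset.sum_ite_eq,
      Finset.mem_univ, if_true]
    have hv : pd .v h q = 0 := fh.pd_eq_zero ho hq (by simp)
    by_cases hc : c = .v
    · subst hc
      simp only [if_true, field, sum_coord, frame, shift, Pi.zero_apply]
      rw [hinv hS.funOf_H q hq, hinv hF₂ q hq]
      simp [hΦ, hv]
      ring
    · cases c with
      | v => exact absurd rfl hc
      | u => simp [field, frame, hΦ]
      | x e => simp [field, frame]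

/-- Under the shift, `g₂` is replaced by `g₂ - u h`, so `h = g₂ / u - κ` leaves `κ u`. Independence
of `g₂` from `x^3` makes `h` an admissible shift preserving `Ŵ_3 = 0`. -/
theorem exists_shift (hΩ : IsBox Ω) (hS : S.IsAdapted Ω) (hu : ∀ p ∈ Ω, p .u ≠ 0)
    (h₂ : Smooth Ω F₂) (hF₂ : FunOf Ω {.v}ᶜ F₂)
    (K : S.IsKilling Ω (S.field (fun p => p .u) (fun p => - p .v + F₂ p) 0))
    (p₀ : Pt k) (hp₀ : p₀ ∈ Ω) :
    ∃ (S' : Data k) (Ω' : Set (Pt k)) (Φ : Pt k → Pt k) (h F₂' f₂ g₂ : SF k)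
          (b : Fin k → SF k),
          IsBox Ω' ∧ S'.IsAdapted Ω' ∧ p₀ ∈ Φ '' Ω' ∧
          Smooth Ω' h ∧ FunOf Ω' {.v, .x 0}ᶜ h ∧
          (∀ q ∈ Ω', Φ q = Function.update q .v (q .v + h q)) ∧
          Smooth Ω' F₂' ∧ FunOf Ω' {.v}ᶜ F₂' ∧
          IsCoordChange S Ω (S.field (fun p => p .u) (fun p => - p .v + F₂ p) 0)
            S' Ω' (S'.field (fun p => p .u) (fun p => - p .v + F₂' p) 0) Φ ∧
          (∀ e f, FunOf Ω' {.u, .v}ᶜ (S'.gT e f)) ∧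
          Smooth Ω' f₂ ∧ FunOf Ω' {.u, .v}ᶜ f₂ ∧ Smooth Ω' g₂ ∧ FunOf Ω' {.u} g₂ ∧
          (∀ n, Smooth Ω' (b n) ∧ FunOf Ω' {.u, .v}ᶜ (b n)) ∧
          ∀ q ∈ Ω', F₂' q = f₂ q / q .u + g₂ q / q .u ∧
            S'.H q = f₂ q / q .u ^ 2 - pd .u g₂ q / q .u + g₂ q / q .u ^ 2 ∧
            ∀ n : Fin k, S'.W n.succ q = b n q / q .u := by
  have ho := hΩ.isOpen
  have su : Smooth Ω (fun p => p .u) := Smooth.coord .u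
  obtain ⟨hg, f₂, g₂, b, sf, ff, sg, fg, hb, hdat⟩ := (isKilling_u_iff hΩ hS hu h₂ hF₂).1 K
  -- The constant makes `h` vanish at `p₀`. The shift then fixes `p₀`, and a small box around it is
  -- mapped into `Ω`.
  set κ := g₂ p₀ / p₀ .u with hκ
  set h : SF k := fun q => g₂ q / q .u - κ with hh
  have sh : Smooth Ω h := (sg.div su hu).sub (Smooth.const _)
  have fh : FunOf Ω {.v, .x 0}ᶜ h :=
    fg.comp₂ (fun a b => a / b - κ) (FunOf.coord (c := .u) (by simp))
  have h0 : h p₀ = 0 := by simp [hh, hκ]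
  obtain ⟨Ω', hΩ', hp', hsub⟩ : ∃ Ω' : Set (Pt k), IsBox Ω' ∧ p₀ ∈ Ω' ∧
      Ω' ⊆ {q | q ∈ Ω ∧ Function.update q .v (q .v + h q) ∈ Ω} := by
    apply exists_isBox_subset
    have hc : ContinuousAt (fun q : Pt k => Function.update q .v (q .v + h q)) p₀ :=
      ContinuousAt.update (f := fun q : Pt k => q) continuousAt_id .v
        ((continuous_apply Coord.v).continuousAt.fun_add
          (sh.differentiableAt ho hp₀).continuousAt)
    have hm := hc.eventually_mem (s := Ω) (by
      simp only [h0, add_zero, Function.update_eq_self]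
      exact ho.mem_nhds hp₀)
    filter_upwards [hm, ho.mem_nhds hp₀] with q h1 h2 using ⟨h2, h1⟩
  have hs : Ω' ⊆ Ω := fun q hq => (hsub hq).1
  have ho' := hΩ'.isOpen
  have hpdh : ∀ q ∈ Ω', pd .u h q = (pd .u g₂ q * q .u - g₂ q * 1) / q .u ^ 2 := fun q hq => by
    refine (((sg.hasPd ho (hs hq) .u).div (hasPd_coord .u .u q) (hu q (hs hq))).sub
      (HasAlong.const κ)).2.trans ?_
    simp
  refine ⟨S.shift h, Ω', fun q => Function.update q .v (q .v + h q), h, fun q => F₂ q - h q, f₂,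
    fun q => κ * q .u, b, hΩ', shift_isAdapted hΩ' (hS.mono hs) (sh.mono hs) (fh.mono_left hs),
    ⟨p₀, hp', by simp [h0]⟩, sh.mono hs, fh.mono_left hs, fun q _ => rfl,
    (h₂.sub sh).mono hs, (hF₂.comp₂ (· - ·) fh.v_insert).mono_left hs, ?_,
    fun e f => (hg e f).mono_left hs, sf.mono hs, ff.mono_left hs,
    (Smooth.const _).mul (Smooth.coord _), fun p _ q _ hpq => by simp [hpq .u rfl],
    fun n => ⟨(hb n).1.mono hs, (hb n).2.mono_left hs⟩, fun q hq => ?_⟩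
  · exact shift_isCoordChange hS hΩ' hs (sh.mono hs) (fh.mono_left hs)
      (fun q hq => (hsub hq).2) hF₂
  · have hup := hu q (hs hq)
    refine ⟨?_, ?_, fun n => ?_⟩
    · simp only [hh]
      rw [(hdat q (hs hq)).1]
      field_simp
      ring
    · change S.H q + pd .u h q = _
      have : pd .u (fun q : Pt k => κ * q .u) q = κ := by
        refine ((HasAlong.const κ).mul (hasPd_coord .u .u q)).2.trans ?_
        simp
      rw [this, hpdh q hq, (hdat q (hs hq)).2.1]
      field_simp
      ring
    · rw [shift_W hΩ' (fh.mono_left hs) hq, (hdat q (hs hq)).2.2 n,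
        show S.D n.succ h q = (S.D n.succ g₂ q * q .u - g₂ q * 0) / q .u ^ 2 - 0 from
        (((hasAlong_D sg hΩ (hs hq) n.succ).div (hasAlong_D_u S n.succ q) hup).sub
          (HasAlong.const κ)).2]
      field_simp
      ring

end Data

end Kundt

/-! ### Case 1 with general `F₃` -/

namespace Kundt

variable {k : ℕ} {Ω : Set (Pt k)} {f g : SF k} {p : Pt k}

theorem exists_neg_antider_iff {c : Coord k} (hΩ : IsBox Ω) (hg : Smooth Ω g)
    {s s' : Set (Coord k)}
    (hgs : FunOf Ω s g) (hs : s' = s \ {c}) (hf : Smooth Ω f) {o : Pt k} (ho : o ∈ Ω) :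
    (∃ A : SF k, Smooth Ω A ∧ FunOf Ω s' A ∧ ∀ p ∈ Ω, g p = - antider o c f p + A p) ↔
      ∀ p ∈ Ω, pd c g p = - f p := by
  rw [← exists_antider_iff hΩ hg hgs hs hf.neg ho]
  simp only [antider, intervalIntegral.integral_neg]

theorem compl_u_v : ({.u, .v}ᶜ : Set (Coord k)) = {Coord.v}ᶜ \ {Coord.u} := by
  ext; simp [and_comm]

theorem compl_v_x : ({.v, .x 0}ᶜ : Set (Coord k)) = {Coord.v}ᶜ \ {Coord.x 0} := by
  ext; simp

theorem exists_family_neg_antider_iff {ι : Type*} {G F : ι → SF k} {c : Coord k} (hΩ : IsBox Ω)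
    (hg : ∀ i, Smooth Ω (G i)) {s s' : Set (Coord k)}
    (hgs : ∀ i, FunOf Ω s (G i)) (hs : s' = s \ {c}) (hf : ∀ i, Smooth Ω (F i)) {o : Pt k}
    (ho : o ∈ Ω) :
    (∃ A : ι → SF k, (∀ i, Smooth Ω (A i) ∧ FunOf Ω s' (A i)) ∧
      ∀ p ∈ Ω, ∀ i, G i p = - antider o c (F i) p + A i p) ↔
      ∀ p ∈ Ω, ∀ i, pd c (G i) p = - F i p := by
  have key := fun i => exists_neg_antider_iff hΩ (hg i) (hgs i) hs (hf i) ho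
  constructor
  · rintro ⟨A, hA, h⟩ p hp i
    exact (key i).1 ⟨A i, (hA i).1, (hA i).2, fun p hp => h p hp i⟩ p hp
  · intro h
    choose A h1 h2 h3 using fun i => (key i).2 fun p hp => h p hp i
    exact ⟨A, fun i => ⟨h1 i, h2 i⟩, fun p hp i => h3 i p hp⟩

namespace Data

variable {S : Data k} {X₁ X₂ X₃ F₂ F₃ : SF k}

theorem D_sq (hΩ : IsBox Ω) (hf : Smooth Ω f) (hp : p ∈ Ω) (i : Fin (k + 1)) :
    S.D i (f ^ 2) p = 2 * f p * S.D i f p := along_sq (hf.differentiableAt hΩ.isOpen hp)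

theorem D2_sq (hΩ : IsBox Ω) (hf : Smooth Ω f) (hp : p ∈ Ω) :
    S.D2 (f ^ 2) p = 2 * f p * S.D2 f p := along_sq (hf.differentiableAt hΩ.isOpen hp)

theorem pd_zero_eq_D_zero (hS : S.IsAdapted Ω) (hp : p ∈ Ω) (f : SF k) :
    pd (.x 0) f p = S.m 0 0 p * S.D 0 f p := by
  have := hS.diag 0 p hp
  rw [D_zero_eq hS hp]; field_simp

theorem pd_u_m_zero_iff (hS : S.IsAdapted Ω) {o : Pt k} (hoΩ : o ∈ Ω) (hΩ : IsBox Ω)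
    (hf : Smooth Ω f) :
    (∃ A₁ : SF k, Smooth Ω A₁ ∧ FunOf Ω {.u, .v}ᶜ A₁ ∧
      ∀ p ∈ Ω, S.m 0 0 p = - antider o .u f p + A₁ p) ↔ ∀ p ∈ Ω, pd .u (S.m 0 0) p = - f p :=
  exists_neg_antider_iff hΩ (hS.smooth_m 0 0) (hS.funOf_m 0 0) compl_u_v hf hoΩ

/-- After the integral formula is replaced by an equation for `m_{33,u}`, both sides are pointwise
conditions. The `m_3 m_3` equation gives `m_{33,u}`, substituting it into `n m_3` gives `D_3 H`, and
substituting that into `nn` gives `H`. -/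
theorem isKilling_u_general_iff (hΩ : IsBox Ω) (hS : S.IsAdapted Ω) (hu : ∀ p ∈ Ω, p .u ≠ 0)
    {o : Pt k} (hoΩ : o ∈ Ω) (h₂ : Smooth Ω F₂) (h₃ : Smooth Ω F₃)
    (hF₂ : FunOf Ω {.v}ᶜ F₂) (hF₃ : FunOf Ω {.v}ᶜ F₃) :
    S.IsKilling Ω (S.field (fun p => p .u) (fun p => - p .v + F₂ p) F₃) ↔
        (∃ A₁ : SF k, Smooth Ω A₁ ∧ FunOf Ω {.u, .v}ᶜ A₁ ∧
          ∀ p ∈ Ω, S.m 0 0 p = - antider o .u (fun q => pd (.x 0) F₃ q / q .u) p + A₁ p) ∧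
        (∀ p ∈ Ω, ∀ n r : Fin k, pd .u (S.m n.succ r.succ) p =
          - pd (.x 0) (S.m n.succ r.succ) p * F₃ p / (S.m 0 0 p * p .u)) ∧
        (∀ p ∈ Ω, ∀ r : Fin k, pd .u (S.m 0 r.succ) p =
          - pd (.x r.succ) F₃ p / p .u - (pd (.x 0) (S.m 0 r.succ) p
            - pd (.x r.succ) (S.m 0 0) p) * S.mUp 0 0 p * F₃ p / p .u) ∧
        (∀ p ∈ Ω, S.H p = - S.D2 F₂ p - S.D2 (F₃ ^ 2) p / (2 * p .u)
          - F₃ p * S.D 0 F₂ p / p .u - F₃ p * S.D 0 (F₃ ^ 2) p / (2 * p .u ^ 2)) ∧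
        (∀ p ∈ Ω, p .u * S.D 0 S.H p =
          S.D 0 F₂ p + S.D2 F₃ p + S.D 0 (F₃ ^ 2) p / (2 * p .u)) ∧
        (∀ p ∈ Ω, ∀ n : Fin k, S.D2 (fun q => q .u * S.W n.succ q) p
          + F₃ p * S.D 0 (S.W n.succ) p
          + S.D n.succ (fun q => F₂ q - q .u * S.H q) p = 0) := by
  have ho := hΩ.isOpen
  have su : Smooth Ω (fun p => p .u) := Smooth.coord .u
  have sv : Smooth Ω (fun p => - p .v + F₂ p) := (Smooth.coord .v).neg.add h₂
  rw [pd_u_m_zero_iff hS hoΩ hΩ ((h₃.pd ho _).div su hu),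
    isKilling_iff_killingAt hΩ hS su sv h₃]
  simp only [← forall₂_and]
  refine forall₂_congr fun p hp => ?_
  rw [killingAt_affine_iff hΩ hS h₂ hF₂ hF₃ (a := 1) (b := 0) (by simp) (by simp) hp]
  have hup := hu p hp
  have m0 := hS.diag 0 p hp
  have eW : ∀ n : Fin k, S.D2 (fun q => q .u * S.W n.succ q) p
      = 1 * S.W n.succ p + p .u * S.D2 (S.W n.succ) p := fun n =>
    ((hasAlong_D2_u S p).mul (hasAlong_D2 (smooth_W hS n.succ) hΩ hp)).2
  have eH : ∀ n : Fin k, S.D n.succ (fun q => F₂ q - q .u * S.H q) p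
      = S.D n.succ F₂ p - (0 * S.H p + p .u * S.D n.succ S.H p) := fun n =>
    ((hasAlong_D h₂ hΩ hp n.succ).sub ((hasAlong_D_u S n.succ p).mul
          (hasAlong_D hS.smooth_H hΩ hp n.succ))).2
  simp only [D_sq hΩ h₃ hp, D2_sq hΩ h₃ hp, eW, eH, mUp_zero_zero hS hp]
  rw [pd_zero_eq_D_zero hS hp F₃]
  constructor
  · rintro ⟨k1, k2, k3, k4, k5, k6⟩
    have k4' : pd .u (S.m 0 0) p = -(S.m 0 0 p * S.D 0 F₃ p / p .u) := by
      field_simp; linarith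
    rw [k4'] at k2
    have hH : p .u * S.D 0 S.H p = S.D 0 F₂ p + S.D2 F₃ p + 2 * F₃ p * S.D 0 F₃ p / (2 * p .u) := by
      field_simp at k2 ⊢; linarith
    refine ⟨k4', fun n r => ?_, fun r => ?_, ?_, hH, fun n => by linarith [k3 n]⟩
    · have := k6 n r
      field_simp at this ⊢; linarith
    · have := k5 r
      field_simp at this ⊢; linarith
    · have : S.D 0 S.H p = (S.D 0 F₂ p + S.D2 F₃ p + 2 * F₃ p * S.D 0 F₃ p / (2 * p .u)) / p .u := by
        rw [← hH]; field_simp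
      rw [this] at k1
      field_simp at k1 ⊢; linarith
  · rintro ⟨k4, k6, k5, k1, hH, k3⟩
    have hH' : S.D 0 S.H p = (S.D 0 F₂ p + S.D2 F₃ p + 2 * F₃ p * S.D 0 F₃ p / (2 * p .u)) / p .u := by
      rw [← hH]; field_simp
    refine ⟨?_, ?_, fun n => by linarith [k3 n], ?_, fun r => ?_, fun n r => ?_⟩
    · rw [k1, hH']; field_simp; ring
    · rw [k4, hH']; field_simp; ring
    · rw [k4]; field_simp; ring
    · rw [k5 r]; field_simp; ring
    · rw [k6 n r]; field_simp; ring

/-- Here `H` enters the equations only through its derivatives. The `n m_3` equation says that `H -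
F₂ - F₃² / 2` has `x^3` derivative `m_33 D_2 F₃`, which is then integrated. -/
theorem isKilling_one_general_iff (hΩ : IsBox Ω) (hS : S.IsAdapted Ω)
    {o : Pt k} (hoΩ : o ∈ Ω) (h₂ : Smooth Ω F₂) (h₃ : Smooth Ω F₃)
    (hF₂ : FunOf Ω {.v}ᶜ F₂) (hF₃ : FunOf Ω {.v}ᶜ F₃) :
    S.IsKilling Ω (S.field (fun _ => 1) F₂ F₃) ↔
        (∃ A₁ : SF k, Smooth Ω A₁ ∧ FunOf Ω {.u, .v}ᶜ A₁ ∧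
          ∀ p ∈ Ω, S.m 0 0 p = - antider o .u (pd (.x 0) F₃) p + A₁ p) ∧
        (∀ p ∈ Ω, ∀ n r : Fin k, pd .u (S.m n.succ r.succ) p =
          - pd (.x 0) (S.m n.succ r.succ) p * F₃ p / S.m 0 0 p) ∧
        (∀ p ∈ Ω, ∀ r : Fin k, pd .u (S.m 0 r.succ) p =
          - pd (.x r.succ) F₃ p - (pd (.x 0) (S.m 0 r.succ) p
            - pd (.x r.succ) (S.m 0 0) p) * S.mUp 0 0 p * F₃ p) ∧
        (∀ p ∈ Ω, S.D2 F₂ p + F₃ p * S.D 0 F₂ p + 1 / 2 * S.D2 (F₃ ^ 2) p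
          + 1 / 2 * F₃ p * S.D 0 (F₃ ^ 2) p = 0) ∧
        (∃ A₂ : SF k, Smooth Ω A₂ ∧ FunOf Ω {.v, .x 0}ᶜ A₂ ∧
          ∀ p ∈ Ω, S.H p = antider o (.x 0) (fun q => S.m 0 0 q * S.D2 F₃ q) p
            + F₂ p + 1 / 2 * F₃ p ^ 2 + A₂ p) ∧
        (∀ p ∈ Ω, ∀ n : Fin k, F₃ p * S.D 0 (S.W n.succ) p + S.D2 (S.W n.succ) p
          = S.D n.succ (fun q => S.H q - F₂ q) p) := by
  have ho := hΩ.isOpen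
  have s3 : Smooth Ω (fun p => 1 / 2 * F₃ p ^ 2) := (Smooth.const _).mul (h₃.pow 2)
  have sG : Smooth Ω (fun p => S.H p - (F₂ p + 1 / 2 * F₃ p ^ 2)) := hS.smooth_H.sub (h₂.add s3)
  have fG : FunOf Ω {.v}ᶜ (fun p => S.H p - (F₂ p + 1 / 2 * F₃ p ^ 2)) :=
    hS.funOf_H.comp₂ (· - ·) (hF₂.comp₂ (fun a b => a + 1 / 2 * b ^ 2) hF₃)
  have hA := exists_antider_iff hΩ sG fG compl_v_x
    ((hS.smooth_m 0 0).mul (smooth_D2 hΩ hS h₃)) hoΩ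
  have hA' : (∃ A₂ : SF k, Smooth Ω A₂ ∧ FunOf Ω {.v, .x 0}ᶜ A₂ ∧
          ∀ p ∈ Ω, S.H p = antider o (.x 0) (fun q => S.m 0 0 q * S.D2 F₃ q) p
            + F₂ p + 1 / 2 * F₃ p ^ 2 + A₂ p) ↔ ∀ p ∈ Ω,
      pd (.x 0) (fun p => S.H p - (F₂ p + 1 / 2 * F₃ p ^ 2)) p = S.m 0 0 p * S.D2 F₃ p := by
    rw [← hA]
    refine exists_congr fun A => and_congr_right fun _ => and_congr_right fun _ =>
      forall₂_congr fun p _ => ⟨fun h => by rw [h]; ring, fun h => by linarith⟩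
  rw [pd_u_m_zero_iff hS hoΩ hΩ (h₃.pd ho _), hA',
    isKilling_iff_killingAt hΩ hS (Smooth.const 1) h₂ h₃]
  simp only [← forall₂_and]
  refine forall₂_congr fun p hp => ?_
  rw [killingAt_affine_iff hΩ hS h₂ hF₂ hF₃ (a := 0) (b := 1) (by simp) (by simp) hp]
  have m0 := hS.diag 0 p hp
  have d3 := h₃.hasPd ho hp (.x 0)
  have eG : pd (.x 0) (fun p => S.H p - (F₂ p + 1 / 2 * F₃ p ^ 2)) p
      = S.m 0 0 p * (S.D 0 S.H p - S.D 0 F₂ p - F₃ p * S.D 0 F₃ p) := by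
    rw [((hS.smooth_H.hasPd ho hp (.x 0)).sub ((h₂.hasPd ho hp (.x 0)).add
      ((HasAlong.const (1 / 2)).mul (d3.mul d3)))).pd_congr ho hp (fun q _ => by ring),
      pd_zero_eq_D_zero hS hp, pd_zero_eq_D_zero hS hp, pd_zero_eq_D_zero hS hp]
    ring
  have eH : ∀ n : Fin k, S.D n.succ (fun q => S.H q - F₂ q) p
      = S.D n.succ S.H p - S.D n.succ F₂ p := fun n =>
    ((hasAlong_D hS.smooth_H hΩ hp n.succ).sub (hasAlong_D h₂ hΩ hp n.succ)).2
  simp only [D_sq hΩ h₃ hp, D2_sq hΩ h₃ hp, eG, eH, mUp_zero_zero hS hp]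
  rw [pd_zero_eq_D_zero hS hp F₃, mul_right_inj' m0]
  constructor
  · rintro ⟨k1, k2, k3, k4, k5, k6⟩
    have k4' : pd .u (S.m 0 0) p = -(S.m 0 0 p * S.D 0 F₃ p) := by linarith
    rw [k4'] at k2
    have hH : S.D 0 S.H p = S.D 0 F₂ p + S.D2 F₃ p + F₃ p * S.D 0 F₃ p := by
      field_simp at k2; linarith
    refine ⟨k4', fun n r => ?_, fun r => ?_, ?_, by rw [hH]; ring, fun n => by linarith [k3 n]⟩
    · have := k6 n r
      field_simp at this ⊢; linarith
    · have := k5 r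
      field_simp at this ⊢; linarith
    · rw [hH] at k1; linarith
  · rintro ⟨k4, k6, k5, k1, hH, k3⟩
    have hH' : S.D 0 S.H p = S.D 0 F₂ p + S.D2 F₃ p + F₃ p * S.D 0 F₃ p := by linarith
    refine ⟨?_, ?_, fun n => by linarith [k3 n], by rw [k4]; ring, fun r => ?_, fun n r => ?_⟩
    · rw [hH']; linarith
    · rw [k4, hH']; field_simp; ring
    · rw [k5 r]; field_simp; ring
    · rw [k6 n r]; field_simp; ring

/-- With `X₁ = 0`, dividing by `F₃` turns the `nn` and `n m_n` equations into prescriptions for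
`H_{,3}` and `W_{n,3}`, and `n m_3` into the relation of logarithmic derivatives. -/
theorem isKilling_zero_general_iff (hΩ : IsBox Ω) (hS : S.IsAdapted Ω)
    {o : Pt k} (hoΩ : o ∈ Ω) (h₂ : Smooth Ω F₂) (h₃ : Smooth Ω F₃)
    (hF₂ : FunOf Ω {.v}ᶜ F₂) (hF₃ : FunOf Ω {.v}ᶜ F₃) (h0 : ∀ p ∈ Ω, F₃ p ≠ 0) :
    S.IsKilling Ω (S.field 0 F₂ F₃) ↔
        (∀ p ∈ Ω, pd (.x 0) F₃ p = 0) ∧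
        (∀ p ∈ Ω, ∀ n r : Fin k, pd (.x 0) (S.m n.succ r.succ) p = 0) ∧
        (∀ p ∈ Ω, ∀ r : Fin k, pd (.x r.succ) F₃ p + (pd (.x 0) (S.m 0 r.succ) p
            - pd (.x r.succ) (S.m 0 0) p) * S.mUp 0 0 p * F₃ p = 0) ∧
        (∀ p ∈ Ω, S.D2 (fun q => Real.log (S.m 0 0 q)) p =
          S.D 0 F₂ p / F₃ p + S.D2 (fun q => Real.log (F₃ q)) p) ∧
        (∃ E : Fin k → SF k, (∀ n, Smooth Ω (E n) ∧ FunOf Ω {.v, .x 0}ᶜ (E n)) ∧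
          ∀ p ∈ Ω, ∀ n : Fin k, S.W n.succ p =
            - antider o (.x 0) (fun q => S.m 0 0 q * S.D n.succ F₂ q / F₃ q) p + E n p) ∧
        (∃ A₃ : SF k, Smooth Ω A₃ ∧ FunOf Ω {.v, .x 0}ᶜ A₃ ∧
          ∀ p ∈ Ω, S.H p =
            - antider o (.x 0) (fun q => S.m 0 0 q * S.D2 F₂ q / F₃ q) p + A₃ p) := by
  have ho := hΩ.isOpen
  rw [exists_neg_antider_iff hΩ hS.smooth_H hS.funOf_H compl_v_x
      (((hS.smooth_m 0 0).mul (smooth_D2 hΩ hS h₂)).div h₃ h0) hoΩ,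
    exists_family_neg_antider_iff hΩ (fun n : Fin k => smooth_W hS n.succ)
      (fun n => funOf_W hS n.succ) compl_v_x
      (fun n : Fin k => ((hS.smooth_m 0 0).mul (smooth_D hΩ hS h₂ n.succ)).div h₃ h0) hoΩ,
    isKilling_iff_killingAt hΩ hS Smooth.zero h₂ h₃]
  simp only [← forall₂_and]
  refine forall₂_congr fun p hp => ?_
  rw [killingAt_affine_iff hΩ hS h₂ hF₂ hF₃ (a := 0) (b := 0) (by simp) (by simp) hp]
  have m0 := hS.diag 0 p hp
  have f0 := h0 p hp
  -- `Real.log` takes the absolute value of its argument, so the signs of `m_33` and `F₃` play no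
  -- role.
  have l1 : S.D2 (fun q => Real.log (S.m 0 0 q)) p = pd .u (S.m 0 0) p / S.m 0 0 p := by
    rw [← D2_of_funOf hΩ hp (hS.funOf_m 0 0)]
    exact along_log ((hS.smooth_m 0 0).differentiableAt ho hp) m0
  have l2 : S.D2 (fun q => Real.log (F₃ q)) p = S.D2 F₃ p / F₃ p :=
    along_log (h₃.differentiableAt ho hp) f0
  rw [l1, l2, mUp_zero_zero hS hp, pd_zero_eq_D_zero hS hp S.H]
  simp only [pd_zero_eq_D_zero hS hp (S.W _), Pi.zero_apply, mul_zero, zero_mul, add_zero, sub_zero]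
  constructor
  · rintro ⟨k1, k2, k3, k4, k5, k6⟩
    refine ⟨k4, fun n r => ?_, fun r => ?_, ?_, fun n => ?_, ?_⟩
    · simpa [m0, f0] using k6 n r
    · have := k5 r
      field_simp at this ⊢; linarith
    · field_simp at k2 ⊢; linarith
    · have := k3 n
      field_simp at this ⊢; linarith
    · field_simp at k1 ⊢; linarith
  · rintro ⟨k4, k6, k5, k2, k3, k1⟩
    refine ⟨?_, ?_, fun n => ?_, k4, fun r => ?_, fun n r => by simp [k6 n r]⟩
    · field_simp at k1; linarith
    · field_simp at k2 ⊢; linarith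
    · have := k3 n
      field_simp at this ⊢; linarith
    · have := k5 r
      field_simp at this ⊢; linarith

end Data

end Kundt

/-! ### Smooth dependence of integrals on parameters -/

open Topology in
-- A tube argument: the bound on the compact fibre, enlarged by one, persists on a neighbourhood
-- uniform in `t`. It is the constant dominating function in the next two results.
theorem exists_eventually_norm_le {E F : Type*} [TopologicalSpace E] [NormedAddCommGroup F]
    {V : Set (E × ℝ)} (hV : IsOpen V) {f : E × ℝ → F} (hf : ContinuousOn f V) {K : Set ℝ}
    (hK : IsCompact K) {x : E} (hx : ∀ t ∈ K, (x, t) ∈ V) :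
    ∃ C : ℝ, ∀ᶠ y in 𝓝 x, ∀ t ∈ K, (y, t) ∈ V ∧ ‖f (y, t)‖ ≤ C := by
  have hc : ContinuousOn (fun t => f (x, t)) K :=
    hf.comp (by fun_prop) fun t ht => hx t ht
  obtain ⟨C, hC⟩ := hK.exists_bound_of_continuousOn hc
  refine ⟨C + 1, hK.eventually_forall_of_forall_eventually
    (P := fun y t => (y, t) ∈ V ∧ ‖f (y, t)‖ ≤ C + 1) fun t ht => ?_⟩
  have h1 := (hf.continuousAt (hV.mem_nhds (hx t ht))).norm
  filter_upwards [hV.mem_nhds (hx t ht), h1.eventually_lt_const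
    (show ‖f (x, t)‖ < C + 1 by linarith [hC t ht])] with z hz1 hz2
  exact ⟨hz1, hz2.le⟩

open Topology in
theorem continuousOn_intervalIntegral_param {E F : Type*} [TopologicalSpace E]
    [FirstCountableTopology E] [NormedAddCommGroup F] [NormedSpace ℝ F] {V : Set (E × ℝ)}
    (hV : IsOpen V) {f : E × ℝ → F} (hf : ContinuousOn f V) {s : Set E}
    (hsV : ∀ x ∈ s, ∀ t ∈ Set.Icc (0 : ℝ) 1, (x, t) ∈ V) :
    ContinuousOn (fun x => ∫ t in (0 : ℝ)..1, f (x, t)) s := by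
  intro x hx
  obtain ⟨C, hC⟩ := exists_eventually_norm_le hV hf isCompact_Icc (hsV x hx)
  have hI : Set.uIoc (0 : ℝ) 1 ⊆ Set.Icc 0 1 := by
    rw [Set.uIoc_of_le zero_le_one]; exact Set.Ioc_subset_Icc_self
  refine (intervalIntegral.continuousAt_of_dominated_interval (bound := fun _ => C) ?_ ?_
    intervalIntegrable_const ?_).continuousWithinAt
  · filter_upwards [hC] with y hy
    refine (ContinuousOn.mono ?_ hI).aestronglyMeasurable measurableSet_uIoc
    exact hf.comp (by fun_prop) fun t ht => (hy t ht).1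
  · filter_upwards [hC] with y hy
    exact Filter.Eventually.of_forall fun t ht => (hy t (hI ht)).2
  · refine Filter.Eventually.of_forall fun t ht => ?_
    exact (hf.continuousAt (hV.mem_nhds (hsV x hx t (hI ht)))).comp
      (f := fun y => (y, t)) (by fun_prop)

open Topology in
theorem hasFDerivAt_intervalIntegral_param {E F : Type*} [NormedAddCommGroup E] [NormedSpace ℝ E]
    [NormedAddCommGroup F] [NormedSpace ℝ F] {V : Set (E × ℝ)} (hV : IsOpen V) {f : E × ℝ → F}
    (hf : ContDiffOn ℝ 1 f V) {x : E} (hx : ∀ t ∈ Set.Icc (0 : ℝ) 1, (x, t) ∈ V) :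
    HasFDerivAt (fun y => ∫ t in (0 : ℝ)..1, f (y, t))
      (∫ t in (0 : ℝ)..1, (fderiv ℝ f (x, t)).comp (ContinuousLinearMap.inl ℝ E ℝ)) x := by
  have hf' : ContinuousOn (fun z => (fderiv ℝ f z).comp (ContinuousLinearMap.inl ℝ E ℝ)) V :=
    (hf.continuousOn_fderiv_of_isOpen hV le_rfl).clm_comp continuousOn_const
  have hI : Set.uIoc (0 : ℝ) 1 ⊆ Set.Icc 0 1 := by
    rw [Set.uIoc_of_le zero_le_one]; exact Set.Ioc_subset_Icc_self
  obtain ⟨C, hC⟩ := exists_eventually_norm_le hV hf' isCompact_Icc hx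
  refine intervalIntegral.hasFDerivAt_integral_of_dominated_of_fderiv_le (bound := fun _ => C)
    (F' := fun y t => (fderiv ℝ f (y, t)).comp (ContinuousLinearMap.inl ℝ E ℝ)) hC ?_ ?_ ?_
    (Filter.Eventually.of_forall fun t ht y hy => (hy t (hI ht)).2) intervalIntegrable_const
    (Filter.Eventually.of_forall fun t ht y hy => ?_)
  · filter_upwards [hC] with y hy
    exact ((hf.continuousOn.comp (by fun_prop) fun t ht => (hy t ht).1).mono
      hI).aestronglyMeasurable measurableSet_uIoc
  · refine ContinuousOn.intervalIntegrable ?_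
    rw [Set.uIcc_of_le zero_le_one]
    exact hf.continuousOn.comp (by fun_prop) fun t ht => hx t ht
  · exact ((hf'.comp (by fun_prop) fun t ht => hx t ht).mono
      hI).aestronglyMeasurable measurableSet_uIoc
  · have hd := ((hf.contDiffAt (hV.mem_nhds (hy t (hI ht)).1)).differentiableAt
      (by simp)).hasFDerivAt
    exact hd.comp y (hasFDerivAt_prodMk_left y t)

/-- Integrals of smooth functions over a compact interval depend smoothly on parameters. -/
theorem contDiffOn_intervalIntegral_param.{u} {E : Type u} [NormedAddCommGroup E] [NormedSpace ℝ E]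
    {V : Set (E × ℝ)} (hV : IsOpen V) {s : Set E} (hs : IsOpen s)
    (hsV : ∀ x ∈ s, ∀ t ∈ Set.Icc (0 : ℝ) 1, (x, t) ∈ V) (n : ℕ) :
    ∀ {F : Type u} [NormedAddCommGroup F] [NormedSpace ℝ F] {f : E × ℝ → F},
      ContDiffOn ℝ n f V → ContDiffOn ℝ n (fun x => ∫ t in (0 : ℝ)..1, f (x, t)) s := by
  -- The target space stays universally quantified because the induction hypothesis is applied to
  -- the partial derivative, with values in `E →L[ℝ] F`; the common universe keeps this space
  -- admissible.
  induction n with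
  | zero =>
    intro F _ _ f hf
    simp only [Nat.cast_zero, contDiffOn_zero] at hf ⊢
    exact continuousOn_intervalIntegral_param hV hf hsV
  | succ n ih =>
    intro F _ _ f hf
    push_cast at hf ⊢
    rw [contDiffOn_succ_iff_hasFDerivWithinAt_of_uniqueDiffOn hs.uniqueDiffOn]
    refine ⟨by simp, _, ih ((hf.fderiv_of_isOpen hV le_rfl).clm_comp contDiffOn_const),
      fun x hx => (hasFDerivAt_intervalIntegral_param hV (hf.of_le (by simp))
        (hsV x hx)).hasFDerivWithinAt⟩

/-! ### Smooth antiderivatives and potentials on a box -/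

namespace Kundt

variable {k : ℕ} {Ω : Set (Pt k)} {f g : SF k} {p : Pt k}

theorem IsBox.update_lineMap_mem (hΩ : IsBox Ω) {o : Pt k} (ho : o ∈ Ω) (hp : p ∈ Ω) (c : Coord k)
    {t : ℝ} (ht : t ∈ Set.Icc (0 : ℝ) 1) :
    Function.update p c (o c + t * (p c - o c)) ∈ Ω := by
  refine hΩ.update_mem_of_uIcc hp ho ?_
  rw [← segment_eq_uIcc, segment_eq_image']
  exact ⟨t, ht, by simp⟩

/-- Rescaling to `[0, 1]` removes the point from the limits of integration, so that smooth
dependence on parameters applies. -/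
theorem antider_eq (o p : Pt k) (c : Coord k) (f : SF k) :
    antider o c f p = (p c - o c) *
      ∫ t in (0 : ℝ)..1, f (Function.update p c (o c + t * (p c - o c))) := by
  unfold antider
  simp only [mul_comm _ (p c - o c)]
  rw [← smul_eq_mul, intervalIntegral.smul_integral_comp_add_mul
    (fun s => f (Function.update p c s))]
  simp

theorem smooth_antider (hΩ : IsBox Ω) (hf : Smooth Ω f) {o : Pt k} (ho : o ∈ Ω) (c : Coord k) :
    Smooth Ω (antider o c f) := by
  let G : Pt k × ℝ → Pt k := fun z => Function.update z.1 c (o c + z.2 * (z.1 c - o c))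
  have hG : ContDiff ℝ ∞ G := by
    refine contDiff_pi.2 fun d => ?_
    by_cases hd : d = c
    · subst hd
      simp only [G, Function.update_self]
      fun_prop
    · simp only [G, Function.update_of_ne hd]
      fun_prop
  have hV : IsOpen (G ⁻¹' Ω) := hΩ.isOpen.preimage hG.continuous
  have hfG : ContDiffOn ℝ ∞ (fun z => f (G z)) (G ⁻¹' Ω) :=
    ContDiffOn.comp hf hG.contDiffOn fun z hz => hz
  have hI : Smooth Ω fun p => ∫ t in (0 : ℝ)..1, f (G (p, t)) :=
    contDiffOn_infty.2 fun n => contDiffOn_intervalIntegral_param hV hΩ.isOpen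
      (fun p hp t ht => hΩ.update_lineMap_mem ho hp c ht) n (contDiffOn_infty.1 hfG n)
  exact (((Smooth.coord c).sub (Smooth.const (o c))).mul hI).congr fun p _ => antider_eq o p c f

theorem pd_antider (hΩ : IsBox Ω) (hf : Smooth Ω f) {o : Pt k} (ho : o ∈ Ω) (c : Coord k)
    (hp : p ∈ Ω) : pd c (antider o c f) p = f p :=
  pd_eq_of_eq_antider hΩ (smooth_antider hΩ hf ho c) hf.continuousOn ho (fun _ _ => rfl) hp

/-- The coordinate `c` has to belong to `s` because it is the upper limit of integration. -/
theorem FunOf.antider (hΩ : IsBox Ω) {s : Set (Coord k)} (hf : FunOf Ω s f) {o : Pt k} (ho : o ∈ Ω)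
    {c : Coord k} (hc : c ∈ s) : FunOf Ω s (antider o c f) := by
  intro p hp q hq h
  unfold Kundt.antider
  rw [h c hc]
  refine intervalIntegral.integral_congr fun t ht => ?_
  refine hf _ (hΩ.update_mem_of_uIcc hp ho (by rwa [h c hc])) _
    (hΩ.update_mem_of_uIcc hq ho ht) fun d hd => ?_
  by_cases hdc : d = c
  · subst hdc; simp
  · simp [Function.update_of_ne hdc, h d hd]

/-- A family of functions with symmetric cross derivatives has a potential on a box. -/
theorem exists_potential (hΩ : IsBox Ω) {s : Set (Coord k)} (T : Finset (Coord k)) (hT : ↑T ⊆ s)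
    {w : Coord k → SF k} (hw : ∀ c ∈ T, Smooth Ω (w c)) (hws : ∀ c ∈ T, FunOf Ω s (w c))
    (h : ∀ c ∈ T, ∀ d ∈ T, ∀ p ∈ Ω, pd d (w c) p = pd c (w d) p) :
    ∃ M : SF k, Smooth Ω M ∧ FunOf Ω s M ∧ ∀ c ∈ T, ∀ p ∈ Ω, pd c M p = w c p := by
  have ho := hΩ.isOpen
  obtain ⟨o, hoΩ⟩ := hΩ.nonempty
  induction T using Finset.induction_on with
  | empty => exact ⟨0, Smooth.zero, fun _ _ _ _ _ => rfl, by simp⟩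
  | insert c T hc ih =>
    obtain ⟨M, hM, hMs, hMd⟩ := ih (fun d hd => hT (by simp [Finset.mem_coe.1 hd]))
      (fun d hd => hw d (by simp [hd])) (fun d hd => hws d (by simp [hd]))
      (fun d hd e he => h d (by simp [hd]) e (by simp [he]))
    have hcT : c ∈ insert c T := by simp
    have sg : Smooth Ω (fun p => w c p - pd c M p) := (hw c hcT).sub (hM.pd ho c)
    -- Symmetry of the cross derivatives makes the error in direction `c` independent of the
    -- coordinates already treated, so adding its `c`-antiderivative does not disturb the earlier
    -- derivatives.
    have fg : FunOf Ω (s \ T) (fun p => w c p - pd c M p) := by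
      refine funOf_of_pd hΩ sg fun p hp d hd => ?_
      by_cases hds : d ∈ s
      · have hdT : d ∈ T := by simpa [hds] using hd
        rw [pd_sub ((hw c hcT).differentiableAt ho hp) ((hM.pd ho c).differentiableAt ho hp),
          pd_comm hM ho hp, pd_congr ho (hMd d hdT) hp, h c hcT d (by simp [hdT]) p hp, sub_self]
      · exact ((hws c hcT).comp₂ (· - ·) (hMs.pd hΩ hM c)).pd_eq_zero ho hp hds
    have hcs : c ∈ s \ (T : Set (Coord k)) := ⟨hT (by simp), by simpa using hc⟩
    have sN := smooth_antider hΩ sg hoΩ c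
    have fN := fg.antider hΩ hoΩ hcs
    refine ⟨_, hM.add sN, hMs.comp₂ (· + ·) (fN.mono Set.sdiff_subset), fun d hd p hp => ?_⟩
    rw [pd_add (hM.differentiableAt ho hp) (sN.differentiableAt ho hp)]
    rcases Finset.mem_insert.1 hd with rfl | hd
    · rw [pd_antider hΩ sg hoΩ _ hp]; ring
    · rw [hMd d hd p hp, fN.pd_eq_zero ho hp (by simp [hd]), add_zero]

end Kundt

/-! ### Case 2: Killing vectors of split metrics -/

namespace Kundt

variable {k : ℕ} {Ω : Set (Pt k)} {f g : SF k} {p : Pt k}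

namespace Data

variable {S : Data k} {X₁ X₂ X₃ F₁ F₂ F₃ : SF k}

theorem pd_m_zero_succ_of_eq_zero (hΩ : IsBox Ω) (h : ∀ r : Fin k, ∀ p ∈ Ω, S.m 0 r.succ p = 0)
    (hp : p ∈ Ω) (r : Fin k) (c : Coord k) : pd c (S.m 0 r.succ) p = 0 := by
  rw [pd_congr (g := fun _ => 0) hΩ.isOpen (h r) hp, pd_const]

theorem B_zero_succ_of_eq_zero (hΩ : IsBox Ω) (hS : S.IsAdapted Ω)
    (h : ∀ r : Fin k, ∀ p ∈ Ω, S.m 0 r.succ p = 0) (hp : p ∈ Ω) (n : Fin k) :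
    S.B 0 n.succ p = 0 := by
  unfold B
  simp [Fin.sum_univ_succ, mUp_succ_zero hS hp (fun r => h r p hp),
    pd_m_zero_succ_of_eq_zero hΩ h hp]

/-- When `m_3r = 0`, closedness of `m_3` says that `m_33` is independent of the `x^r`, the tensor
component `B_3n` vanishes, and an `x^3`-antiderivative of `m_33` serves as `M`. -/
theorem threeParallel_iff_split (hΩ : IsBox Ω) (hS : S.IsAdapted Ω)
    (h : ∀ r : Fin k, ∀ p ∈ Ω, S.m 0 r.succ p = 0) : S.ThreeParallel Ω ↔ S.Split Ω := by
  have ho := hΩ.isOpen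
  rw [threeParallel_iff hΩ hS]
  constructor
  · intro H
    obtain ⟨o, hoΩ⟩ := hΩ.nonempty
    have fm : FunOf Ω {.u, .x 0} (S.m 0 0) := by
      refine funOf_of_pd hΩ (hS.smooth_m 0 0) fun p hp c hc => ?_
      cases c with
      | u => simp at hc
      | v => exact (hS.funOf_m 0 0).pd_eq_zero ho hp (by simp)
      | x e =>
        induction e using Fin.cases with
        | zero => simp at hc
        | succ r => rw [(H p hp).2.1, pd_m_zero_succ_of_eq_zero hΩ h hp]
    refine ⟨⟨_, smooth_antider hΩ (hS.smooth_m 0 0) hoΩ (.x 0), fm.antider hΩ hoΩ (by simp),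
      fun p hp => (pd_antider hΩ (hS.smooth_m 0 0) hoΩ _ hp).symm⟩, h, fun n r => ?_,
      fun n p hp => ?_⟩
    · rw [funOf_v_insert_iff hΩ (hS.smooth_m _ _) (hS.funOf_m _ _)]
      exact fun p hp => (H p hp).1 n r
    · simpa [B_zero_succ_of_eq_zero hΩ hS h hp] using (H p hp).2.2 n
  · intro hs p hp
    refine ⟨fun n r => hs.pd_m_succ hΩ hp n r, fun e f => ?_, fun n => ?_⟩
    · induction e using Fin.cases with
      | zero =>
        induction f using Fin.cases with
        | zero => rfl
        | succ r => rw [hs.pd_m_zero hΩ hp, hs.pd_m_zero_succ hΩ hp]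
      | succ s =>
        induction f using Fin.cases with
        | zero => rw [hs.pd_m_zero hΩ hp, hs.pd_m_zero_succ hΩ hp]
        | succ r => rw [hs.pd_m_zero_succ hΩ hp, hs.pd_m_zero_succ hΩ hp]
    · rw [hs.2.2.2 n p hp, B_zero_succ_of_eq_zero hΩ hS h hp, add_zero]

theorem Split.D_succ_eq (hΩ : IsBox Ω) (hS : S.IsAdapted Ω) (hs : S.Split Ω)
    (hf : FunOf Ω {.v}ᶜ f) (hp : p ∈ Ω) (n : Fin k) :
    S.D n.succ f p = ∑ r : Fin k, S.mUp n.succ r.succ p * pd (.x r.succ) f p := by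
  rw [D_of_funOf hΩ hp hf, Fin.sum_univ_succ, hs.mUp_succ_zero hS hp]
  simp

theorem Split.D_succ_eq_zero_iff (hΩ : IsBox Ω) (hS : S.IsAdapted Ω) (hs : S.Split Ω)
    (hf : FunOf Ω {.v}ᶜ f) (hp : p ∈ Ω) :
    (∀ n : Fin k, S.D n.succ f p = 0) ↔ ∀ r : Fin k, pd (.x r.succ) f p = 0 := by
  constructor
  · intro h
    refine eq_zero_of_sum_mUp_succ hS hp fun n => ?_
    rw [← hs.D_succ_eq hΩ hS hf hp, h]
  · intro h n
    rw [hs.D_succ_eq hΩ hS hf hp]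
    simp [h]

/-- A specialisation of the solution with `X₁ = 0`. The formula for `W_n` prescribes `W_{n,3}` as a
multiple of `D_n F₂`, while the split form has `D_3 W_n = 0`; hence `D_n F₂ = 0`. -/
theorem Split.isKilling_zero_iff (hΩ : IsBox Ω) (hS : S.IsAdapted Ω) (hs : S.Split Ω)
    {o : Pt k} (hoΩ : o ∈ Ω) (h₂ : Smooth Ω F₂) (h₃ : Smooth Ω F₃)
    (hF₂ : FunOf Ω {.v}ᶜ F₂) (hF₃ : FunOf Ω {.v}ᶜ F₃) (h0 : ∀ p ∈ Ω, F₃ p ≠ 0) :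
    S.IsKilling Ω (S.field 0 F₂ F₃) ↔
        (∀ p ∈ Ω, ∀ r : Fin k, pd (.x r.succ) F₂ p = 0) ∧
        (∀ p ∈ Ω, ∀ e, pd (.x e) F₃ p = 0) ∧
        (∀ p ∈ Ω, S.D2 (fun q => Real.log (S.m 0 0 q)) p =
          S.D 0 F₂ p / F₃ p + S.D2 (fun q => Real.log (F₃ q)) p) ∧
        (∃ E : Fin k → SF k, (∀ n, Smooth Ω (E n) ∧ FunOf Ω {.v, .x 0}ᶜ (E n)) ∧
          ∀ p ∈ Ω, ∀ n : Fin k, S.W n.succ p =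
            - antider o (.x 0) (fun q => S.m 0 0 q * S.D n.succ F₂ q / F₃ q) p + E n p) ∧
        (∃ A₃ : SF k, Smooth Ω A₃ ∧ FunOf Ω {.v, .x 0}ᶜ A₃ ∧
          ∀ p ∈ Ω, S.H p =
            - antider o (.x 0) (fun q => S.m 0 0 q * S.D2 F₂ q / F₃ q) p + A₃ p) := by
  rw [isKilling_zero_general_iff hΩ hS hoΩ h₂ h₃ hF₂ hF₃ h0]
  have hr : ∀ p ∈ Ω, ∀ r : Fin k, pd (.x r.succ) F₃ p + (pd (.x 0) (S.m 0 r.succ) p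
      - pd (.x r.succ) (S.m 0 0) p) * S.mUp 0 0 p * F₃ p = pd (.x r.succ) F₃ p := fun p hp r => by
    rw [hs.pd_m_zero hΩ hp, hs.pd_m_zero_succ hΩ hp]; ring
  constructor
  · rintro ⟨k1, k2, k3, k4, k5, k6⟩
    refine ⟨fun p hp => ?_, fun p hp e => ?_, k4, k5, k6⟩
    · rw [← hs.D_succ_eq_zero_iff hΩ hS hF₂ hp]
      intro n
      rw [exists_family_neg_antider_iff hΩ (fun n : Fin k => smooth_W hS n.succ)
        (fun n => funOf_W hS n.succ) compl_v_x (fun n : Fin k =>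
          ((hS.smooth_m 0 0).mul (smooth_D hΩ hS h₂ n.succ)).div h₃ h0) hoΩ] at k5
      have := k5 p hp n
      rw [pd_zero_eq_D_zero hS hp, hs.2.2.2 n p hp] at this
      simpa [hS.diag 0 p hp, h0 p hp] using this
    · induction e using Fin.cases with
      | zero => exact k1 p hp
      | succ r => rw [← hr p hp, k3 p hp]
  · rintro ⟨-, k2, k3, k4, k5⟩
    exact ⟨fun p hp => k2 p hp 0, fun p hp n r => hs.pd_m_succ hΩ hp n r,
      fun p hp r => by rw [hr p hp, k2 p hp], k3, k4, k5⟩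

theorem Split.B_eq_zero (hΩ : IsBox Ω) (hS : S.IsAdapted Ω) (hs : S.Split Ω) (hp : p ∈ Ω)
    (h : ∀ n r : Fin k, S.Bsym n.succ r.succ p = 0) (i j : Fin (k + 1))
    (hij : ¬ (i = 0 ∧ j = 0)) : S.B i j p = 0 := by
  induction i using Fin.cases with
  | zero =>
    induction j using Fin.cases with
    | zero => simp at hij
    | succ r => exact B_zero_succ_of_eq_zero hΩ hS hs.2.1 hp r
  | succ n =>
    induction j using Fin.cases with
    | zero => exact B_succ_zero hΩ hS hp n
    | succ r =>
      rw [B_succ_succ hΩ hS hp]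
      simp [(Bsym_eq_zero_iff hΩ hS hp).1 h]

/-! ### Split metrics with `X₁` depending on the distinguished transverse coordinate -/

theorem hasAlong_D2_v (S : Data k) (p : Pt k) :
    HasAlong (S.frame .two) (fun q => q .v) p (- S.H p) := by
  refine ⟨(Smooth.coord (Ω := Set.univ) .v).differentiableAt isOpen_univ trivial, ?_⟩
  change S.D2 _ p = _
  rw [D2_eq]; simp [pd_coord]

theorem hasAlong_D_v (S : Data k) (i : Fin (k + 1)) (p : Pt k) :
    HasAlong (S.frame (.tr i)) (fun q => q .v) p (- S.W i p) := by
  refine ⟨(Smooth.coord (Ω := Set.univ) .v).differentiableAt isOpen_univ trivial, ?_⟩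
  change S.D i _ p = _
  rw [D_eq]; simp [pd_coord]

theorem pd_v_neg_mul_v_add {G F : SF k} (hG : HasAlong (fun _ => Pi.single .v 1) G p 0)
    (hF : HasAlong (fun _ => Pi.single .v 1) F p 0) :
    pd .v (fun p => - G p * p .v + F p) p = - G p := by
  refine ((hG.neg.mul (hasPd_coord .v .v p)).add hF).2.trans ?_
  simp

/-- The equations sorted by powers of `v`: apart from the explicit factor `v` every term is
independent of `v`. The `n m_n` and `m_3 m_n` equations have no linear term, since `D_2 F₁` and `D_3
F₁` do not depend on the `x^r`. -/
theorem Split.killingAt_iff (hΩ : IsBox Ω) (hS : S.IsAdapted Ω) (hs : S.Split Ω)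
    (h₁ : Smooth Ω F₁) (h₂ : Smooth Ω F₂) (h₃ : Smooth Ω F₃) (hF₁ : FunOf Ω {.u, .x 0} F₁)
    (hF₂ : FunOf Ω {.v}ᶜ F₂) (hF₃ : FunOf Ω {.v}ᶜ F₃) (hp : p ∈ Ω) :
    S.KillingAt F₁ (fun p => - S.D2 F₁ p * p .v + F₂ p) (fun p => - S.D 0 F₁ p * p .v + F₃ p) p ↔
      (S.D2 F₂ p + S.H p * S.D2 F₁ p + F₃ p * S.D 0 S.H p)
        - (S.D2 (S.D2 F₁) p + S.D 0 F₁ p * S.D 0 S.H p) * p .v = 0 ∧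
      (S.D 0 F₂ p + S.D2 F₃ p + S.D 0 F₁ p * S.H p - F₁ p * S.D 0 S.H p
          - pd .u (S.m 0 0) p / S.m 0 0 p * F₃ p)
        - (S.D 0 (S.D2 F₁) p + S.D2 (S.D 0 F₁) p
          - pd .u (S.m 0 0) p / S.m 0 0 p * S.D 0 F₁ p) * p .v = 0 ∧
      (∀ n : Fin k, S.D2 (fun q => F₁ q * S.W n.succ q) p + S.D n.succ F₂ p
          - F₁ p * S.D n.succ S.H p = 0) ∧
      (pd (.x 0) F₃ p + pd .u (S.m 0 0) p * F₁ p) - pd (.x 0) (S.D 0 F₁) p * p .v = 0 ∧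
      (∀ n : Fin k, S.D n.succ F₃ p + S.W n.succ p * S.D 0 F₁ p = 0) ∧
      ∀ n r : Fin k, pd .u (S.m n.succ r.succ) p * F₁ p = 0 := by
  have ho := hΩ.isOpen
  have m0 := hS.diag 0 p hp
  have f₁ : FunOf Ω {.v}ᶜ F₁ := hF₁.mono (by intro c; rintro (rfl | rfl) <;> simp)
  have s2 := smooth_D2 hΩ hS h₁
  have s0 := smooth_D hΩ hS h₁ 0
  have fr : ∀ r : Fin k, ∀ q ∈ Ω, pd (.x r.succ) F₁ q = 0 := fun r q hq =>
    hF₁.pd_eq_zero ho hq (by simp)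
  have r2 : ∀ r : Fin k, pd (.x r.succ) (S.D2 F₁) p = 0 := fun r => by
    rw [pd_congr ho (fun q hq => D2_of_funOf hΩ hq f₁) hp, pd_comm h₁ ho hp,
      pd_congr (g := fun _ => 0) ho (fr r) hp, pd_const]
  have r0 : ∀ r : Fin k, pd (.x r.succ) (S.D 0 F₁) p = 0 := fun r => by
    rw [(((h₁.pd ho (.x 0)).hasPd ho hp (.x r.succ)).div ((hS.smooth_m 0 0).hasPd ho hp (.x r.succ))
      m0).pd_congr ho hp fun q hq => D_zero_eq hS hq F₁, hs.pd_m_zero hΩ hp, pd_comm h₁ ho hp,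
      pd_congr (g := fun _ => 0) ho (fr r) hp, pd_const]
    simp
  have v2 := hasPd_v_D2_of_funOf hΩ hS h₁ f₁ hp
  have v0 := hasPd_v_D_of_funOf hΩ hS h₁ f₁ hp 0
  have d2 : ∀ n : Fin k, S.D n.succ (S.D2 F₁) p = 0 := fun n => by
    rw [D_eq, Fin.sum_univ_succ, hs.mUp_succ_zero hS hp, show pd .v (S.D2 F₁) p = 0 from v2.2]
    simp [r2]
  have a1 : S.D2 (fun p => - S.D2 F₁ p * p .v + F₂ p) p
      = - S.D2 (S.D2 F₁) p * p .v + S.D2 F₁ p * S.H p + S.D2 F₂ p := by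
    refine (((hasAlong_D2 s2 hΩ hp).neg.mul (hasAlong_D2_v S p)).add (hasAlong_D2 h₂ hΩ hp)).2.trans ?_
    ring
  have a2 : ∀ i, S.D i (fun p => - S.D2 F₁ p * p .v + F₂ p) p
      = - S.D i (S.D2 F₁) p * p .v + S.D2 F₁ p * S.W i p + S.D i F₂ p := fun i => by
    refine (((hasAlong_D s2 hΩ hp i).neg.mul (hasAlong_D_v S i p)).add
      (hasAlong_D h₂ hΩ hp i)).2.trans ?_
    ring
  have a3 : S.D2 (fun p => - S.D 0 F₁ p * p .v + F₃ p) p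
      = - S.D2 (S.D 0 F₁) p * p .v + S.D 0 F₁ p * S.H p + S.D2 F₃ p := by
    refine (((hasAlong_D2 s0 hΩ hp).neg.mul (hasAlong_D2_v S p)).add (hasAlong_D2 h₃ hΩ hp)).2.trans ?_
    ring
  have b2 := pd_v_neg_mul_v_add v2 (hasPd_v_of_funOf h₂ hF₂ ho hp)
  have b3 := pd_v_neg_mul_v_add v0 (hasPd_v_of_funOf h₃ hF₃ ho hp)
  have c3 : ∀ e, pd (.x e) (fun p => - S.D 0 F₁ p * p .v + F₃ p) p
      = - pd (.x e) (S.D 0 F₁) p * p .v + pd (.x e) F₃ p := fun e => by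
    refine (((s0.hasPd ho hp (.x e)).neg.mul (hasPd_coord (.x e) .v p)).add
      (h₃.hasPd ho hp (.x e))).2.trans ?_
    simp
  have eW : ∀ n : Fin k, S.D2 (fun q => F₁ q * S.W n.succ q) p
      = S.D2 F₁ p * S.W n.succ p + F₁ p * S.D2 (S.W n.succ) p := fun n =>
    ((hasAlong_D2 h₁ hΩ hp).mul (hasAlong_D2 (smooth_W hS n.succ) hΩ hp)).2
  have e3r : (∀ r : Fin k, pd (.x r.succ) F₃ p + S.What r.succ p * S.D 0 F₁ p = 0) ↔
      ∀ n : Fin k, S.D n.succ F₃ p + S.W n.succ p * S.D 0 F₁ p = 0 := by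
    have hW : ∀ n : Fin k, S.D n.succ F₃ p + S.W n.succ p * S.D 0 F₁ p = ∑ r : Fin k,
        S.mUp n.succ r.succ p * (pd (.x r.succ) F₃ p + S.What r.succ p * S.D 0 F₁ p) := fun n => by
      rw [hs.D_succ_eq hΩ hS hF₃ hp, W, Fin.sum_univ_succ, hS.What_three p hp, mul_zero, zero_add,
        Finset.sum_mul, ← Finset.sum_add_distrib]
      exact Finset.sum_congr rfl fun r _ => by ring
    constructor
    · intro h n
      rw [hW]; simp [h]
    · intro h
      exact eq_zero_of_sum_mUp_succ hS hp fun n => by rw [← hW, h]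
  rw [← e3r]
  have g0 := W_zero hS hp
  have gu : pd .u F₁ p = S.D2 F₁ p := (D2_of_funOf hΩ hp f₁).symm
  constructor
  · intro K
    refine ⟨?_, ?_, fun n => ?_, ?_, fun r => ?_, fun n r => ?_⟩
    · have := K.nn; rw [a1] at this; linear_combination this
    · have := K.n₃; rw [a2, a3, g0] at this; linear_combination this
    · have := K.nr n; rw [a2, hs.2.2.2 n p hp, d2] at this; rw [eW]; linear_combination this
    · have := K.e₃₃; rw [c3] at this; linear_combination this
    · have := K.e₃r r
      rw [c3, b3, r0, hs.pd_m_zero hΩ hp, hs.pd_m_zero_succ hΩ hp, hs.pd_m_zero_succ hΩ hp] at this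
      linear_combination this
    · have := K.ers n r
      rw [hs.pd_m_succ hΩ hp] at this
      linear_combination this
  · rintro ⟨k1, k2, k3, k4, k5, k6⟩
    refine ⟨f₁.pd_eq_zero ho hp (by simp), by rw [b2, gu]; ring,
      by rw [b3, ← D_zero_eq hS hp]; ring, fun n => ?_, ?_, ?_, fun n => ?_, ?_, fun r => ?_,
      fun n r => ?_⟩
    · rw [Fin.sum_univ_succ, hs.mUp_succ_zero hS hp]
      simp [fr _ p hp]
    · rw [a1]; linear_combination k1
    · rw [a2, a3, g0]; linear_combination k2
    · have := k3 n; rw [eW] at this; rw [a2, hs.2.2.2 n p hp, d2]; linear_combination this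
    · rw [c3]; linear_combination k4
    · rw [c3, b3, r0, hs.pd_m_zero hΩ hp, hs.pd_m_zero_succ hΩ hp, hs.pd_m_zero_succ hΩ hp]
      linear_combination k5 r
    · rw [hs.pd_m_succ hΩ hp]; linear_combination k6 n r

/-- The `v`-coefficients give `∂_3 D_3 F₁ = 0`, `m_{33,u}/m_33 = D_3 D_2 F₁ / D_3 F₁` and the
equation for `D_3 H`. With these the `v`-free parts are solved for `H`, `W_n` and `F_{3,3}` by
dividing by `D_3 F₁`, which has no zero. -/
theorem Split.isKilling_iff (hΩ : IsBox Ω) (hS : S.IsAdapted Ω) (hs : S.Split Ω)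
    {o : Pt k} (hoΩ : o ∈ Ω)
    (h₁ : Smooth Ω F₁) (h₂ : Smooth Ω F₂) (h₃ : Smooth Ω F₃) (hF₁ : FunOf Ω {.u, .x 0} F₁)
    (hF₂ : FunOf Ω {.v}ᶜ F₂) (hF₃ : FunOf Ω {.v}ᶜ F₃) (h0 : ∀ p ∈ Ω, pd (.x 0) F₁ p ≠ 0) :
    S.IsKilling Ω (S.field F₁ (fun p => - S.D2 F₁ p * p .v + F₂ p)
          (fun p => - S.D 0 F₁ p * p .v + F₃ p)) ↔
        (∀ p ∈ Ω, ∀ m n : Fin k, S.Bsym m.succ n.succ p = 0) ∧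
        (∀ p ∈ Ω, pd (.x 0) (S.m 0 0) p / S.m 0 0 p
            = pd (.x 0) (pd (.x 0) F₁) p / pd (.x 0) F₁ p ∧
          pd .u (S.m 0 0) p / S.m 0 0 p = pd .u (pd (.x 0) F₁) p / pd (.x 0) F₁ p) ∧
        (∀ p ∈ Ω, S.H p = S.D 0 (S.D2 F₁) p / S.D 0 F₁ p ^ 2 * F₃ p
          - S.D2 (S.D2 F₁) p / S.D 0 F₁ p ^ 2 * F₁ p
          - (S.D2 F₃ p + S.D 0 F₂ p) / S.D 0 F₁ p) ∧
        (∀ p ∈ Ω, ∀ n : Fin k, S.W n.succ p = - S.D n.succ F₃ p / S.D 0 F₁ p) ∧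
        (∃ A₆ : SF k, Smooth Ω A₆ ∧ FunOf Ω {.v, .x 0}ᶜ A₆ ∧
          ∀ p ∈ Ω, F₃ p = - antider o (.x 0)
            (fun q => S.m 0 0 q * F₁ q * S.D 0 (S.D2 F₁) q / S.D 0 F₁ q) p + A₆ p) ∧
        (∀ p ∈ Ω, S.D2 F₂ p + S.H p * S.D2 F₁ p + F₃ p * S.D 0 S.H p = 0) ∧
        (∀ p ∈ Ω, S.D2 (S.D2 F₁) p + S.D 0 F₁ p * S.D 0 S.H p = 0) ∧
        (∀ p ∈ Ω, ∀ n : Fin k, S.D2 (fun q => F₁ q * S.W n.succ q) p + S.D n.succ F₂ p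
          - F₁ p * S.D n.succ S.H p = 0) := by
  have ho := hΩ.isOpen
  have f₁ : FunOf Ω {.v}ᶜ F₁ := hF₁.mono (by intro c; rintro (rfl | rfl) <;> simp)
  have s2 := smooth_D2 hΩ hS h₁
  have s0 := smooth_D hΩ hS h₁ 0
  have sX₂ : Smooth Ω (fun p => - S.D2 F₁ p * p .v + F₂ p) := (s2.neg.mul (Smooth.coord .v)).add h₂
  have sX₃ : Smooth Ω (fun p => - S.D 0 F₁ p * p .v + F₃ p) := (s0.neg.mul (Smooth.coord .v)).add h₃
  have φ0 : ∀ p ∈ Ω, S.D 0 F₁ p ≠ 0 := fun p hp => by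
    rw [D_zero_eq hS hp]; exact div_ne_zero (h0 p hp) (hS.diag 0 p hp)
  have eψ : ∀ p ∈ Ω, pd .u (pd (.x 0) F₁) p = S.m 0 0 p * S.D 0 (S.D2 F₁) p := fun p hp => by
    rw [← pd_zero_eq_D_zero hS hp, pd_congr ho (fun q hq => D2_of_funOf hΩ hq f₁) hp,
      pd_comm h₁ ho hp]
  have eφ0 : ∀ p ∈ Ω, pd (.x 0) (S.D 0 F₁) p = (pd (.x 0) (pd (.x 0) F₁) p * S.m 0 0 p
      - pd (.x 0) F₁ p * pd (.x 0) (S.m 0 0) p) / S.m 0 0 p ^ 2 := fun p hp =>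
    (((h₁.pd ho (.x 0)).hasPd ho hp (.x 0)).div ((hS.smooth_m 0 0).hasPd ho hp (.x 0))
      (hS.diag 0 p hp)).pd_congr ho hp fun q hq => D_zero_eq hS hq F₁
  -- The commutator `[n, m_3]` applied to `F₁`, of which only the `B_33` part survives.
  have eφu : ∀ p ∈ Ω, S.D2 (S.D 0 F₁) p = S.D 0 (S.D2 F₁) p
      - pd .u (S.m 0 0) p / S.m 0 0 p * S.D 0 F₁ p := fun p hp => by
    have m0 := hS.diag 0 p hp
    have : pd .u (S.D 0 F₁) p = (pd .u (pd (.x 0) F₁) p * S.m 0 0 p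
      - pd (.x 0) F₁ p * pd .u (S.m 0 0) p) / S.m 0 0 p ^ 2 :=
      (((h₁.pd ho (.x 0)).hasPd ho hp .u).div ((hS.smooth_m 0 0).hasPd ho hp .u)
        m0).pd_congr ho hp fun q hq => D_zero_eq hS hq F₁
    rw [D2_eq, show pd .v (S.D 0 F₁) p = 0 from (hasPd_v_D_of_funOf hΩ hS h₁ f₁ hp 0).2, this,
      eψ p hp, pd_zero_eq_D_zero hS hp]
    field_simp
    ring
  have b2 : ∀ q ∈ Ω, pd .v (fun p => - S.D2 F₁ p * p .v + F₂ p) q = - S.D2 F₁ q := fun q hq =>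
    pd_v_neg_mul_v_add (hasPd_v_D2_of_funOf hΩ hS h₁ f₁ hq) (hasPd_v_of_funOf h₂ hF₂ ho hq)
  have b3 : ∀ q ∈ Ω, pd .v (fun p => - S.D 0 F₁ p * p .v + F₃ p) q = - S.D 0 F₁ q := fun q hq =>
    pd_v_neg_mul_v_add (hasPd_v_D_of_funOf hΩ hS h₁ f₁ hq 0) (hasPd_v_of_funOf h₃ hF₃ ho hq)
  have eA := exists_neg_antider_iff hΩ h₃ hF₃ compl_v_x ((((hS.smooth_m 0 0).mul h₁).mul
    (smooth_D hΩ hS s2 0)).div s0 φ0) hoΩ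
  rw [eA, isKilling_iff_killingAt hΩ hS h₁ sX₂ sX₃]
  simp only [← forall₂_and]
  constructor
  · intro K p hp
    have m0 := hS.diag 0 p hp
    have φp := φ0 p hp
    -- The equations of the commutator with `ℓ` are the `v`-coefficients of the original ones.
    have K' := killingAt_pd_v hΩ hS h₁ sX₂ sX₃ K hp
    have t1 := K'.nn
    have t2 := K'.n₃
    have t3 := K'.e₃₃
    rw [show S.D2 (pd .v fun p => - S.D2 F₁ p * p .v + F₂ p) p = - S.D2 (S.D2 F₁) p from
      (along_congr ho b2 hp).trans along_neg, b3 p hp] at t1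
    rw [D_congr hΩ hp b2, show S.D2 (pd .v fun p => - S.D 0 F₁ p * p .v + F₃ p) p
      = - S.D2 (S.D 0 F₁) p from (along_congr ho b3 hp).trans along_neg, b3 p hp,
      show S.D 0 (fun q => - S.D2 F₁ q) p = - S.D 0 (S.D2 F₁) p from along_neg, eφu p hp] at t2
    rw [pd_congr ho b3 hp, pd_neg, eφ0 p hp] at t3
    simp only [Pi.zero_apply, mul_zero, add_zero, sub_zero] at t2 t3
    obtain ⟨k1, k2, k3, k4, k5, k6⟩ :=
      (hs.killingAt_iff hΩ hS h₁ h₂ h₃ hF₁ hF₂ hF₃ hp).1 (K p hp)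
    have t4 : pd .u (S.m 0 0) p / S.m 0 0 p = S.D 0 (S.D2 F₁) p / S.D 0 F₁ p := by
      rw [eq_div_iff φp]; linarith
    have t5 : S.D 0 S.H p = - S.D2 (S.D2 F₁) p / S.D 0 F₁ p := by
      rw [eq_div_iff φp]; linarith
    have t6 : pd .u (S.m 0 0) p = S.m 0 0 p * S.D 0 (S.D2 F₁) p / S.D 0 F₁ p := by
      rw [mul_div_assoc, ← t4]; field_simp
    have t7 : pd (.x 0) (pd (.x 0) F₁) p * S.m 0 0 p = pd (.x 0) F₁ p * pd (.x 0) (S.m 0 0) p := by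
      rw [neg_eq_zero, div_eq_zero_iff] at t3
      have := t3.resolve_right (pow_ne_zero 2 m0)
      linarith
    have h0p := h0 p hp
    refine ⟨(Bsym_eq_zero_iff hΩ hS hp).2 fun n r => ?_, ⟨?_, ?_⟩, ?_, fun n => ?_, ?_, ?_, ?_, k3⟩
    -- Only `m_{nr,u} F₁ = 0` is known, but `F_{1,3} ≠ 0` prevents `F₁` from vanishing on an open
    -- set.
    · exact eq_zero_of_mul_eq_zero_of_pd_ne_zero ho
        ((hS.smooth_m n.succ r.succ).pd ho .u).continuousOn hp (fun q hq =>
          ((hs.killingAt_iff hΩ hS h₁ h₂ h₃ hF₁ hF₂ hF₃ hq).1 (K q hq)).2.2.2.2.2 n r) h0p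
    · rw [div_eq_div_iff m0 h0p]; linarith
    · rw [t4, eψ p hp, pd_zero_eq_D_zero hS hp, mul_div_mul_left _ _ m0]
    · rw [t4, t5, eφu p hp, t4] at k2
      field_simp at k2 ⊢
      linarith
    · rw [eq_div_iff φp]; linarith [k5 n]
    · rw [t6, show pd (.x 0) (S.D 0 F₁) p = 0 by rw [eφ0 p hp, t7, sub_self, zero_div]] at k4
      field_simp at k4 ⊢
      linarith
    · rw [t5] at k1 ⊢
      field_simp at k1 ⊢
      linarith
    · linarith
  · intro h p hp
    have m0 := hS.diag 0 p hp
    have φp := φ0 p hp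
    have h0p := h0 p hp
    rw [hs.killingAt_iff hΩ hS h₁ h₂ h₃ hF₁ hF₂ hF₃ hp]
    obtain ⟨hB, ⟨l1, l2⟩, eH, eW, eF, q1, q2, q3⟩ := h p hp
    have t4 : pd .u (S.m 0 0) p / S.m 0 0 p = S.D 0 (S.D2 F₁) p / S.D 0 F₁ p := by
      rw [l2, eψ p hp, pd_zero_eq_D_zero hS hp, mul_div_mul_left _ _ m0]
    have t5 : S.D 0 S.H p = - S.D2 (S.D2 F₁) p / S.D 0 F₁ p := by
      rw [eq_div_iff φp]; linarith
    have t6 : pd .u (S.m 0 0) p = S.m 0 0 p * S.D 0 (S.D2 F₁) p / S.D 0 F₁ p := by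
      rw [mul_div_assoc, ← t4]; field_simp
    have t7 : pd (.x 0) (pd (.x 0) F₁) p * S.m 0 0 p = pd (.x 0) F₁ p * pd (.x 0) (S.m 0 0) p := by
      rw [div_eq_div_iff m0 h0p] at l1; linarith
    refine ⟨?_, ?_, q3, ?_, fun n => ?_, fun n r => ?_⟩
    · rw [q1, q2]; ring
    · rw [eφu p hp, t4, t5, eH]
      field_simp
      ring
    · rw [eφ0 p hp, t7, eF, t6]
      field_simp
      ring
    · rw [eW]; field_simp; ring
    · rw [(Bsym_eq_zero_iff hΩ hS hp).1 hB, zero_mul]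

end Data

end Kundt

/-! ### Coordinates straightening a parallel `m_3` -/

namespace Kundt

variable {k : ℕ} {Ω : Set (Pt k)} {f g : SF k} {p : Pt k}

/-- The derivative of the map replacing the coordinate `c` by the function `M`. -/
theorem exists_hasFDerivAt_update {M : SF k} {c : Coord k} (hM : DifferentiableAt ℝ M p)
    (h0 : pd c M p ≠ 0) :
    ∃ L : Pt k ≃L[ℝ] Pt k, HasFDerivAt (fun q => Function.update q c (M q))
      (L : Pt k →L[ℝ] Pt k) p := by
  let L : Pt k →L[ℝ] Pt k := ContinuousLinearMap.pi fun d =>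
    if d = c then fderiv ℝ M p else ContinuousLinearMap.proj d
  have hL : ∀ v d, L v d = if d = c then fderiv ℝ M p v else v d := fun v d => by
    simp only [L, ContinuousLinearMap.coe_pi']; split_ifs <;> rfl
  have hinj : Function.Injective L := by
    refine (injective_iff_map_eq_zero L).2 fun v hv => ?_
    have hd : ∀ d, d ≠ c → v d = 0 := fun d hd => by
      have := congr_fun hv d
      rwa [hL, if_neg hd] at this
    have hvc : v = v c • Pi.single c 1 := by
      ext d
      by_cases h : d = c
      · subst h; simp
      · simp [hd d h, h]
    have h1 := congr_fun hv c
    rw [hL, if_pos rfl, hvc, map_smul, smul_eq_mul] at h1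
    rw [hvc, (mul_eq_zero.1 h1).resolve_right h0, zero_smul]
  refine ⟨(LinearEquiv.ofInjectiveEndo L.toLinearMap hinj).toContinuousLinearEquiv, ?_⟩
  have : (((LinearEquiv.ofInjectiveEndo L.toLinearMap hinj).toContinuousLinearEquiv :
      Pt k ≃L[ℝ] Pt k) : Pt k →L[ℝ] Pt k) = L := by ext v; rfl
  rw [this]
  refine hasFDerivAt_pi.2 fun d => ?_
  by_cases h : d = c
  · subst h
    simpa using hM.hasFDerivAt
  · simpa [h] using hasFDerivAt_apply (𝕜 := ℝ) d p

/-- A function `M` with `M_{,c} ≠ 0` can locally replace the coordinate `c`. -/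
theorem exists_coordinate (hΩ : IsBox Ω) {M : SF k} (hM : Smooth Ω M) {c : Coord k}
    (h0 : ∀ p ∈ Ω, pd c M p ≠ 0) (hp : p ∈ Ω) :
    ∃ (Ω' : Set (Pt k)) (Θ : Pt k → Pt k), IsBox Ω' ∧ Function.update p c (M p) ∈ Ω' ∧
      Θ (Function.update p c (M p)) = p ∧ Set.MapsTo Θ Ω' Ω ∧ (∀ d, Smooth Ω' fun q => Θ q d) ∧
      ∀ q ∈ Ω', (∀ d, d ≠ c → Θ q d = q d) ∧ M (Θ q) = q c := by
  have ho := hΩ.isOpen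
  let Ψ : Pt k → Pt k := fun q => Function.update q c (M q)
  have hΨ : ∀ q ∈ Ω, ContDiffAt ℝ ∞ Ψ q := fun q hq => contDiffAt_pi.2 fun d => by
    by_cases h : d = c
    · subst h
      simpa [Ψ] using hM.contDiffAt ho hq
    · simpa [Ψ, h] using (contDiff_apply ℝ ℝ d).contDiffAt (x := q) (n := ∞)
  obtain ⟨L, hL⟩ := exists_hasFDerivAt_update (hM.differentiableAt ho hp) (h0 p hp)
  let e := (hΨ p hp).toOpenPartialHomeomorph Ψ hL (by simp)
  have hpe : p ∈ e.source := (hΨ p hp).mem_toOpenPartialHomeomorph_source hL (by simp)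
  have hep : ∀ q, e q = Ψ q := fun q => rfl
  have hU : e.target ∩ e.symm ⁻¹' Ω ∈ nhds (Ψ p) := by
    refine (e.isOpen_inter_preimage_symm ho).mem_nhds ⟨e.map_source hpe, ?_⟩
    change e.symm (e p) ∈ Ω
    rwa [e.left_inv hpe]
  obtain ⟨Ω', hΩ', hpΩ', hsub⟩ := exists_isBox_subset hU
  refine ⟨Ω', e.symm, hΩ', hpΩ', e.left_inv hpe, fun q hq => (hsub hq).2, fun d => ?_,
    fun q hq => ?_⟩
  -- Smoothness of the inverse is needed on the whole box, not only at the base point; it holds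
  -- because `M_{,c}` is nonzero throughout `Ω`, so the derivative is invertible at every preimage.
  · intro q hq
    obtain ⟨L', hL'⟩ := exists_hasFDerivAt_update (hM.differentiableAt ho (hsub hq).2)
      (h0 _ (hsub hq).2)
    exact (contDiffAt_pi.1 (e.contDiffAt_symm (hsub hq).1 hL' (hΨ _ (hsub hq).2))
      d).contDiffWithinAt
  · have h : Ψ (e.symm q) = q := e.right_inv (hsub hq).1
    refine ⟨fun d hd => ?_, ?_⟩
    · simpa [Ψ, hd] using congr_fun h d
    · simpa [Ψ] using congr_fun h c

theorem pd_comp {Φ : Pt k → Pt k} {q : Pt k}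
    (hf : DifferentiableAt ℝ f (Φ q)) (hΦ : ∀ c, DifferentiableAt ℝ (fun q => Φ q c) q)
    (a : Coord k) :
    pd a (fun q => f (Φ q)) q = ∑ d, pd a (fun q => Φ q d) q * pd d f (Φ q) := by
  have h := hf.hasFDerivAt.comp q (hasFDerivAt_pi.2 fun c => (hΦ c).hasFDerivAt)
  unfold pd
  rw [show (fun q => f (Φ q)) = f ∘ Φ from rfl, h.fderiv]
  exact along_eq_sum (fun _ => _) f (Φ q)

namespace Data

variable {S : Data k} {X₁ X₂ X₃ F₁ F₂ F₃ M h : SF k} {Ω' : Set (Pt k)} {Θ : Pt k → Pt k} {q : Pt k}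

/-- `Θ` expresses the coordinates on `Ω` through those in which `M` replaces the distinguished
transverse coordinate, where `M` is a potential for the covector `m_3`. -/
structure Straightens (S : Data k) (Ω : Set (Pt k)) (M : SF k) (Ω' : Set (Pt k))
    (Θ : Pt k → Pt k) : Prop where
  smooth_M : Smooth Ω M
  funOf_M : FunOf Ω {.v}ᶜ M
  pd_M : ∀ e, ∀ p ∈ Ω, pd (.x e) M p = S.m 0 e p
  isBox : IsBox Ω'
  mapsTo : Set.MapsTo Θ Ω' Ω
  smooth : ∀ d, Smooth Ω' fun q => Θ q d
  fix : ∀ q ∈ Ω', ∀ d, d ≠ .x 0 → Θ q d = q d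
  M_eq : ∀ q ∈ Ω', M (Θ q) = q (.x 0)

/-- Parallelism makes `m_3` closed in the transverse coordinates, so it has a potential `M` with
`M_{,3} = m_33 ≠ 0`, and the inverse function theorem applies. Nothing is imposed on `M_{,u}`. -/
theorem exists_straightens (hΩ : IsBox Ω) (hS : S.IsAdapted Ω) (hT : S.ThreeParallel Ω)
    (hp : p ∈ Ω) : ∃ M Ω' Θ, Straightens S Ω M Ω' Θ ∧ Function.update p (.x 0) (M p) ∈ Ω' ∧
      Θ (Function.update p (.x 0) (M p)) = p := by
  rw [threeParallel_iff hΩ hS] at hT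
  let w : Coord k → SF k := fun c => match c with
    | .x e => S.m 0 e
    | _ => 0
  obtain ⟨M, hM, fM, pM⟩ := exists_potential hΩ (s := {.v}ᶜ) (w := w)
    (Finset.univ.image Coord.x) (by intro c; simp; rintro e rfl; simp)
    (by simpa [w] using fun e => hS.smooth_m 0 e) (by simpa [w] using fun e => hS.funOf_m 0 e)
    (by simpa [w] using fun e f p hp => (hT p hp).2.1 e f)
  replace pM : ∀ e, ∀ p ∈ Ω, pd (.x e) M p = S.m 0 e p := fun e => by simpa [w] using pM (.x e)
  obtain ⟨Ω', Θ, h1, h2, h3, h4, h5, h6⟩ := exists_coordinate hΩ hM (c := .x 0)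
    (fun q hq => by rw [pM 0 q hq]; exact hS.diag 0 q hq) hp
  exact ⟨M, Ω', Θ, ⟨hM, fM, pM, h1, h4, h5, fun q hq => (h6 q hq).1, fun q hq => (h6 q hq).2⟩, h2, h3⟩

theorem Straightens.pd_fix (H : Straightens S Ω M Ω' Θ) (hq : q ∈ Ω') (a d : Coord k)
    (hd : d ≠ .x 0) : pd a (fun q => Θ q d) q = if d = a then 1 else 0 := by
  rw [pd_congr H.isBox.isOpen (fun q hq => H.fix q hq d hd) hq, pd_coord]

theorem Straightens.pd_comp (hΩ : IsBox Ω) (H : Straightens S Ω M Ω' Θ) (hf : Smooth Ω f)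
    (ff : FunOf Ω {.v}ᶜ f) (hq : q ∈ Ω') (a : Coord k) :
    pd a (fun q => f (Θ q)) q = (if a = .u then pd .u f (Θ q) else 0)
      + pd a (fun q => Θ q (.x 0)) q * pd (.x 0) f (Θ q)
      + ∑ r : Fin k, (if a = .x r.succ then pd (.x r.succ) f (Θ q) else 0) := by
  rw [Kundt.pd_comp (hf.differentiableAt hΩ.isOpen (H.mapsTo hq))
    (fun c => (H.smooth c).differentiableAt H.isBox.isOpen hq), sum_coord, Fin.sum_univ_succ,
    ff.pd_eq_zero (c := .v) hΩ.isOpen (H.mapsTo hq) (by simp)]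
  simp only [H.pd_fix hq a _ (show Coord.u ≠ .x 0 by simp),
    H.pd_fix hq a _ (show Coord.x (Fin.succ _) ≠ .x 0 by simp), eq_comm (a := a), ite_mul, one_mul,
    zero_mul, mul_zero, add_zero]
  ring

/-- Implicit differentiation of `M (Θ q) = q (.x 0)`. -/
theorem Straightens.pd_zero_coord (hΩ : IsBox Ω) (hS : S.IsAdapted Ω) (H : Straightens S Ω M Ω' Θ)
    (hq : q ∈ Ω') (a : Coord k) :
    pd a (fun q => Θ q (.x 0)) q = ((if a = .x 0 then 1 else 0)
      - (if a = .u then pd .u M (Θ q) else 0)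
      - ∑ r : Fin k, (if a = .x r.succ then S.m 0 r.succ (Θ q) else 0)) / S.m 0 0 (Θ q) := by
  have h := H.pd_comp hΩ H.smooth_M H.funOf_M hq a
  rw [pd_congr H.isBox.isOpen H.M_eq hq, pd_coord] at h
  simp only [H.pd_M _ _ (H.mapsTo hq)] at h
  rw [eq_div_iff (hS.diag 0 _ (H.mapsTo hq))]
  simp only [eq_comm (a := Coord.x 0)] at h
  linarith

theorem Straightens.funOf (hΩ : IsBox Ω) (hS : S.IsAdapted Ω) (H : Straightens S Ω M Ω' Θ)
    (hf : Smooth Ω f) (ff : FunOf Ω {.v}ᶜ f) : FunOf Ω' {.v}ᶜ fun q => f (Θ q) :=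
  funOf_v_of_hasPd H.isBox (hf.comp H.smooth H.mapsTo) fun q hq => by
    rw [H.pd_comp hΩ hf ff hq, H.pd_zero_coord hΩ hS hq]
    simp

/-- On functions independent of `v`, the new `∂_3` is the old `D_3`. -/
theorem Straightens.pd_zero_comp (hΩ : IsBox Ω) (hS : S.IsAdapted Ω) (H : Straightens S Ω M Ω' Θ)
    (hf : Smooth Ω f) (ff : FunOf Ω {.v}ᶜ f) (hq : q ∈ Ω') :
    pd (.x 0) (fun q => f (Θ q)) q = pd (.x 0) f (Θ q) / S.m 0 0 (Θ q) := by
  rw [H.pd_comp hΩ hf ff hq, H.pd_zero_coord hΩ hS hq]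
  simp [(Fin.succ_ne_zero _).symm]
  ring

theorem Straightens.pd_succ_comp (hΩ : IsBox Ω) (hS : S.IsAdapted Ω) (H : Straightens S Ω M Ω' Θ)
    (hf : Smooth Ω f) (ff : FunOf Ω {.v}ᶜ f) (hq : q ∈ Ω') (r : Fin k) :
    pd (.x r.succ) (fun q => f (Θ q)) q = pd (.x r.succ) f (Θ q)
      - S.m 0 r.succ (Θ q) * pd (.x 0) f (Θ q) / S.m 0 0 (Θ q) := by
  rw [H.pd_comp hΩ hf ff hq, H.pd_zero_coord hΩ hS hq]
  simp
  ring

/-- The data in the coordinates in which `M` replaces the distinguished transverse coordinate and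
`v` is shifted by `h`. -/
noncomputable def straighten (S : Data k) (M : SF k) (Θ : Pt k → Pt k) (h : SF k) : Data k where
  H q := S.H (Θ q) + pd .u h q + pd .u M (Θ q) ^ 2 / 2
  What := Fin.cases 0 fun r q => S.What r.succ (Θ q) + pd (.x r.succ) h q
  m := Fin.cases (Fin.cases (fun _ => 1) fun _ _ => 0) fun n e q => S.m n.succ e (Θ q)

theorem straighten_m_zero_zero (S : Data k) (M : SF k) (Θ : Pt k → Pt k) (h : SF k) :
    (S.straighten M Θ h).m 0 0 = fun _ => 1 := rfl

theorem straighten_m_zero_succ (S : Data k) (M : SF k) (Θ : Pt k → Pt k) (h : SF k) (r : Fin k) :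
    (S.straighten M Θ h).m 0 r.succ = fun _ => 0 := rfl

theorem straighten_m_succ (S : Data k) (M : SF k) (Θ : Pt k → Pt k) (h : SF k) (n : Fin k)
    (e : Fin (k + 1)) : (S.straighten M Θ h).m n.succ e = fun q => S.m n.succ e (Θ q) := rfl

theorem straighten_What_zero (S : Data k) (M : SF k) (Θ : Pt k → Pt k) (h : SF k) :
    (S.straighten M Θ h).What 0 = 0 := rfl

theorem straighten_What_succ (S : Data k) (M : SF k) (Θ : Pt k → Pt k) (h : SF k) (r : Fin k) :
    (S.straighten M Θ h).What r.succ = fun q => S.What r.succ (Θ q) + pd (.x r.succ) h q := rfl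

theorem straighten_isAdapted (hΩ : IsBox Ω) (hS : S.IsAdapted Ω) (H : Straightens S Ω M Ω' Θ)
    (sh : Smooth Ω' h) (fh : FunOf Ω' {.v}ᶜ h) : (S.straighten M Θ h).IsAdapted Ω' where
  smooth_H := ((hS.smooth_H.comp H.smooth H.mapsTo).add (sh.pd H.isBox.isOpen .u)).add
    ((((H.smooth_M.pd hΩ.isOpen .u).comp H.smooth H.mapsTo).pow 2).div (Smooth.const 2) (by simp))
  smooth_What := Fin.cases Smooth.zero fun r =>
    ((hS.smooth_What r.succ).comp H.smooth H.mapsTo).add (sh.pd H.isBox.isOpen _)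
  smooth_m := Fin.cases (Fin.cases (Smooth.const 1) fun _ => Smooth.const 0) fun n e =>
    (hS.smooth_m n.succ e).comp H.smooth H.mapsTo
  funOf_H := ((H.funOf hΩ hS hS.smooth_H hS.funOf_H).comp₂ (· + ·) (fh.pd H.isBox sh .u)).comp₂
    (fun a b => a + b ^ 2 / 2)
    (H.funOf hΩ hS (H.smooth_M.pd hΩ.isOpen .u) (H.funOf_M.pd hΩ H.smooth_M .u))
  funOf_What := Fin.cases (fun _ _ _ _ _ => rfl) fun r =>
    (H.funOf hΩ hS (hS.smooth_What r.succ) (hS.funOf_What r.succ)).comp₂ (· + ·)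
      (fh.pd H.isBox sh _)
  funOf_m := Fin.cases (Fin.cases (fun _ _ _ _ _ => rfl) fun _ _ _ _ _ _ => rfl) fun n e =>
    H.funOf hΩ hS (f := S.m n.succ e) (hS.smooth_m n.succ e) (hS.funOf_m n.succ e)
  What_three _ _ := rfl
  upper := Fin.cases (fun e he => absurd he (Fin.not_lt_zero e)) fun n e he q hq =>
    hS.upper n.succ e he _ (H.mapsTo hq)
  diag := Fin.cases (fun _ _ => one_ne_zero) fun n q hq => hS.diag n.succ _ (H.mapsTo hq)

/-- Since `W_3 = 0`, one has `Ŵ_r = ∑ m_nr W_n`, with coefficients independent of `x^3`. -/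
theorem pd_zero_What_succ (hΩ : IsBox Ω) (hS : S.IsAdapted Ω)
    (h0 : ∀ p ∈ Ω, ∀ n s : Fin k, pd (.x 0) (S.m n.succ s.succ) p = 0) (hp : p ∈ Ω) (r : Fin k) :
    pd (.x 0) (S.What r.succ) p
      = ∑ n : Fin k, S.m n.succ r.succ p * pd (.x 0) (S.W n.succ) p := by
  have ho := hΩ.isOpen
  have e : ∀ q ∈ Ω, S.What r.succ q = ∑ n : Fin k, S.m n.succ r.succ q * S.W n.succ q :=
    fun q hq => by
      rw [← sum_m_sum_mUp hS hq (fun e => S.What e q) r.succ, Fin.sum_univ_succ]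
      change S.m 0 r.succ q * S.W 0 q + ∑ n : Fin k, S.m n.succ r.succ q * S.W n.succ q = _
      rw [W_zero hS hq, mul_zero, zero_add]
  rw [pd_congr ho e hp, pd_sum fun n _ => ((hS.smooth_m n.succ r.succ).mul
    (smooth_W hS n.succ)).differentiableAt ho hp]
  refine Finset.sum_congr rfl fun n _ => ?_
  rw [pd_mul ((hS.smooth_m n.succ r.succ).differentiableAt ho hp)
    ((smooth_W hS n.succ).differentiableAt ho hp), h0 p hp, zero_mul, zero_add]

/-- If `m_3` is parallel, the derivative of `Ŵ_r` in the distinguished direction. -/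
theorem ThreeParallel.pd_What (hΩ : IsBox Ω) (hS : S.IsAdapted Ω) (hT : S.ThreeParallel Ω)
    (hp : p ∈ Ω) (r : Fin k) :
    pd (.x 0) (S.What r.succ) p = S.m 0 r.succ p * pd .u (S.m 0 0) p
      - S.m 0 0 p * pd .u (S.m 0 r.succ) p := by
  rw [threeParallel_iff hΩ hS] at hT
  have m0 := hS.diag 0 p hp
  -- This rebuilds `m_{3r,u}` from the components `B_3i`; parallelism identifies those with `i ≥ 4`
  -- as `-D_3 W_i`.
  have h1 := sum_m_sum_mUp hS hp (fun e => pd .u (S.m 0 e) p) r.succ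
  have h2 : ∀ i, ∑ e, S.mUp i e p * pd .u (S.m 0 e) p = S.B 0 i p := fun i =>
    Finset.sum_congr rfl fun e _ => mul_comm _ _
  simp only [h2] at h1
  rw [Fin.sum_univ_succ, B_zero_zero hS hp] at h1
  rw [pd_zero_What_succ hΩ hS (fun p hp => (hT p hp).1) hp]
  have h3 : ∀ n : Fin k, S.m n.succ r.succ p * pd (.x 0) (S.W n.succ) p
      = - S.m 0 0 p * (S.m n.succ r.succ p * S.B 0 n.succ p) := fun n => by
    rw [pd_zero_eq_D_zero hS hp]
    linear_combination S.m n.succ r.succ p * S.m 0 0 p * (hT p hp).2.2 n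
  rw [Finset.sum_congr rfl fun n _ => h3 n, ← Finset.mul_sum]
  rw [← h1]
  field_simp
  ring

/-- The condition `h_{,3} = M_{,u}` makes the new `Ŵ_r` independent of the new `x^3`: `h_{,r3} =
(M_{,u})_{,r}` is exactly the negative of the derivative of the old `Ŵ_r` found in
`ThreeParallel.pd_What`, rescaled by `m_33`. -/
theorem straighten_split (hΩ : IsBox Ω) (hS : S.IsAdapted Ω) (hT : S.ThreeParallel Ω)
    (H : Straightens S Ω M Ω' Θ) (sh : Smooth Ω' h) (fh : FunOf Ω' {.v}ᶜ h)
    (h0 : ∀ q ∈ Ω', pd (.x 0) h q = pd .u M (Θ q)) : (S.straighten M Θ h).Split Ω' := by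
  have hT' := (threeParallel_iff hΩ hS).1 hT
  have ho := H.isBox.isOpen
  have hS' := straighten_isAdapted hΩ hS H sh fh
  have hm : ∀ q ∈ Ω', ∀ n r : Fin k, pd (.x 0) ((S.straighten M Θ h).m n.succ r.succ) q = 0 :=
    fun q hq n r => by
      rw [straighten_m_succ, H.pd_zero_comp hΩ hS (hS.smooth_m _ _) (hS.funOf_m _ _) hq,
        (hT' _ (H.mapsTo hq)).1, zero_div]
  refine ⟨⟨fun q => q (.x 0), Smooth.coord _, FunOf.coord (by simp), fun q _ => ?_⟩,
    fun r q _ => rfl, fun n r => ?_, fun n q hq => ?_⟩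
  · rw [pd_coord]; simp [straighten_m_zero_zero]
  · rw [funOf_v_insert_iff H.isBox (hS'.smooth_m _ _) (hS'.funOf_m _ _)]
    exact fun q hq => hm q hq n r
  · have hW : ∀ r : Fin k, pd (.x 0) ((S.straighten M Θ h).What r.succ) q = 0 := fun r => by
      have hp := H.mapsTo hq
      have m0 := hS.diag 0 _ hp
      rw [straighten_What_succ, pd_add
        (((hS.smooth_What r.succ).comp H.smooth H.mapsTo).differentiableAt ho hq)
        ((sh.pd ho _).differentiableAt ho hq), pd_comm sh ho hq, pd_congr ho h0 hq,
        H.pd_zero_comp hΩ hS (hS.smooth_What _) (hS.funOf_What _) hq,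
        H.pd_succ_comp hΩ hS (H.smooth_M.pd hΩ.isOpen .u) (H.funOf_M.pd hΩ H.smooth_M .u) hq,
        hT.pd_What hΩ hS hp, pd_comm H.smooth_M hΩ.isOpen hp (.x 0) .u,
        pd_comm H.smooth_M hΩ.isOpen hp (.x r.succ) .u,
        pd_congr hΩ.isOpen (H.pd_M _) hp, pd_congr hΩ.isOpen (H.pd_M _) hp]
      field_simp
      ring
    have h1 := sum_mUp_sum_m hS' hq (fun i => pd (.x 0) ((S.straighten M Θ h).W i) q) n.succ
    have h2 : ∀ e, ∑ i, (S.straighten M Θ h).m i e q * pd (.x 0) ((S.straighten M Θ h).W i) q = 0 := by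
      have z : pd (.x 0) ((S.straighten M Θ h).W 0) q = 0 := along_W_zero H.isBox hS' hq (fun _ => Pi.single _ 1)
      intro e
      rw [Fin.sum_univ_succ, z, mul_zero, zero_add]
      induction e using Fin.cases with
      | zero => simp [m_succ_zero hS' hq]
      | succ r => rw [← pd_zero_What_succ H.isBox hS' hm hq, hW]
    simp only [h2, mul_zero, Finset.sum_const_zero] at h1
    rw [D_zero_eq hS' hq, ← h1, zero_div]

end Data

end Kundt

/-! ### Transport of metric and field to the straightened coordinates -/

namespace Kundt

variable {k : ℕ} {Ω : Set (Pt k)} {f g : SF k} {p : Pt k}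

namespace Data

variable {S : Data k} {X₁ X₂ X₃ F₁ F₂ F₃ M h : SF k} {Ω' : Set (Pt k)} {Θ : Pt k → Pt k} {q : Pt k}

theorem Straightens.mono {Ω'' : Set (Pt k)} (H : Straightens S Ω M Ω' Θ) (hb : IsBox Ω'')
    (h : Ω'' ⊆ Ω') : Straightens S Ω M Ω'' Θ where
  smooth_M := H.smooth_M
  funOf_M := H.funOf_M
  pd_M := H.pd_M
  isBox := hb
  mapsTo _ hq := H.mapsTo (h hq)
  smooth d := (H.smooth d).mono h
  fix q hq := H.fix q (h hq)
  M_eq q hq := H.M_eq q (h hq)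

/-- The metric written through its coframe one-forms, so that two metrics can be compared form by
form. -/
theorem ip_eq (S : Data k) (p : Pt k) (V Z : Coord k → ℝ) :
    S.ip p V Z = V .u * (Z .v + S.H p * Z .u + ∑ e, S.What e p * Z (.x e))
      + Z .u * (V .v + S.H p * V .u + ∑ e, S.What e p * V (.x e))
      + ∑ i, (∑ e, S.m i e p * V (.x e)) * ∑ e, S.m i e p * Z (.x e) := by
  have hT : ∑ e, ∑ f, V (.x e) * S.gT e f p * Z (.x f)
      = ∑ i, (∑ e, S.m i e p * V (.x e)) * ∑ e, S.m i e p * Z (.x e) := by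
    simp only [Finset.sum_mul_sum]
    conv_rhs => rw [Finset.sum_comm]
    refine Finset.sum_congr rfl fun e _ => ?_
    conv_rhs => rw [Finset.sum_comm]
    refine Finset.sum_congr rfl fun f _ => ?_
    rw [gT, Finset.mul_sum, Finset.sum_mul]
    exact Finset.sum_congr rfl fun i _ => by ring
  have h1 : ∀ (a : ℝ) (Z : Coord k → ℝ), ∑ e, a * S.What e p * Z (.x e)
      = a * ∑ e, S.What e p * Z (.x e) := fun a Z => by
    rw [Finset.mul_sum]; exact Finset.sum_congr rfl fun e _ => by ring
  have h2 : ∑ e, V (.x e) * S.What e p * Z .u = Z .u * ∑ e, S.What e p * V (.x e) := by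
    rw [Finset.mul_sum]; exact Finset.sum_congr rfl fun e _ => by ring
  simp only [ip, sum_coord, metric, mul_one, mul_zero, zero_mul, add_zero, Finset.sum_add_distrib,
    Finset.sum_const_zero, hT, h1, h2]
  ring

theorem metric_eq_ip (S : Data k) (p : Pt k) (a b : Coord k) :
    S.metric p a b = S.ip p (Pi.single a 1) (Pi.single b 1) := by
  simp [ip, Pi.single_apply]

theorem ip_comm_eq (S : Data k) (p : Pt k) (V Z : Coord k → ℝ) :
    S.ip p V Z = ∑ c, ∑ d, S.metric p c d * V c * Z d :=
  Finset.sum_congr rfl fun c _ => Finset.sum_congr rfl fun d _ => by ring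

theorem field_x_zero (hS : S.IsAdapted Ω) (hp : p ∈ Ω) (X₁ X₂ X₃ : SF k) :
    S.field X₁ X₂ X₃ p (.x 0) = X₃ p / S.m 0 0 p := by
  simp [field, frame, mUp_zero_zero hS hp, div_eq_mul_inv]

theorem field_x_succ (hS : S.IsAdapted Ω) (hp : p ∈ Ω) (X₁ X₂ X₃ : SF k) (r : Fin k) :
    S.field X₁ X₂ X₃ p (.x r.succ) = 0 := by
  simp [field, frame, mUp_zero_succ hS hp]

theorem field_u (S : Data k) (X₁ X₂ X₃ : SF k) (p : Pt k) : S.field X₁ X₂ X₃ p .u = X₁ p := by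
  simp [field, frame]

theorem field_v (hS : S.IsAdapted Ω) (hp : p ∈ Ω) (X₁ X₂ X₃ : SF k) :
    S.field X₁ X₂ X₃ p .v = X₂ p - S.H p * X₁ p := by
  simp [field, frame, W_zero hS hp]; ring

/-- If `m_3` is parallel, there are coordinates near every point in which the metric is split. -/
theorem exists_split (hΩ : IsBox Ω) (hS : S.IsAdapted Ω) (hT : S.ThreeParallel Ω)
    (h₁ : Smooth Ω X₁) (h₂ : Smooth Ω X₂) (h₃ : Smooth Ω X₃) (p₀ : Pt k) (hp₀ : p₀ ∈ Ω) :
    ∃ (S' : Data k) (Ω' : Set (Pt k)) (Φ : Pt k → Pt k) (X₁' X₂' X₃' : SF k),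
        IsBox Ω' ∧ S'.IsAdapted Ω' ∧ p₀ ∈ Φ '' Ω' ∧
        (∀ q ∈ Ω', Φ q .u = q .u ∧ ∀ r : Fin k, Φ q (.x r.succ) = q (.x r.succ)) ∧
        Smooth Ω' X₁' ∧ Smooth Ω' X₂' ∧ Smooth Ω' X₃' ∧
        IsCoordChange S Ω (S.field X₁ X₂ X₃) S' Ω' (S'.field X₁' X₂' X₃') Φ ∧
        S'.Split Ω' := by
  obtain ⟨M, Ω₁, Θ, H₁, hq₀, hΘq₀⟩ := exists_straightens hΩ hS hT hp₀
  set q₀ := Function.update p₀ (.x 0) (M p₀) with hq₀_def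
  have sMu := H₁.smooth_M.pd hΩ.isOpen .u
  have fMu := H₁.funOf_M.pd hΩ H₁.smooth_M .u
  have sg := sMu.comp H₁.smooth H₁.mapsTo
  have fg := H₁.funOf hΩ hS sMu fMu
  -- The antiderivative is based at `q₀`, so `h` vanishes there and `Φ` sends `q₀` to `p₀`.
  obtain ⟨h, sh₁, fh₁, h0₁, hhq₀⟩ : ∃ h : SF k, Smooth Ω₁ h ∧ FunOf Ω₁ {.v}ᶜ h ∧
      (∀ q ∈ Ω₁, pd (.x 0) h q = pd .u M (Θ q)) ∧ h q₀ = 0 :=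
    ⟨_, smooth_antider H₁.isBox sg hq₀ (.x 0), fg.antider H₁.isBox hq₀ (by simp),
      fun q hq => pd_antider H₁.isBox sg hq₀ _ hq, by simp [antider]⟩
  let Φ : Pt k → Pt k := fun q => Function.update (Θ q) .v (q .v + h q)
  have hΦv : ∀ q, Φ q .v = q .v + h q := fun q => by simp [Φ]
  have hΦ : ∀ q c, c ≠ .v → Φ q c = Θ q c := fun q c hc => by simp [Φ, hc]
  have sΦ₁ : ∀ c, Smooth Ω₁ fun q => Φ q c := fun c => by
    by_cases hc : c = .v
    · subst hc
      exact ((Smooth.coord .v).add sh₁).congr fun q _ => hΦv q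
    · exact (H₁.smooth c).congr fun q _ => hΦ q c hc
  have hΦq₀ : Φ q₀ = p₀ := by
    ext c
    by_cases hc : c = .v
    · subst hc; rw [hΦv, hhq₀, hq₀_def]; simp
    · rw [hΦ _ _ hc, hΘq₀]
  have hnhds : Ω₁ ∩ Φ ⁻¹' Ω ∈ nhds q₀ := by
    refine Filter.inter_mem (H₁.isBox.isOpen.mem_nhds hq₀) (ContinuousAt.preimage_mem_nhds
      (continuousAt_pi.2 fun c => ?_) (by rw [hΦq₀]; exact hΩ.isOpen.mem_nhds hp₀))
    exact ((sΦ₁ c).differentiableAt H₁.isBox.isOpen hq₀).continuousAt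
  obtain ⟨Ω', hΩ', hq₀', hsub⟩ := exists_isBox_subset hnhds
  have hsub₁ : Ω' ⊆ Ω₁ := fun q hq => (hsub hq).1
  have hmaps : Set.MapsTo Φ Ω' Ω := fun q hq => (hsub hq).2
  have H := H₁.mono hΩ' hsub₁
  have sh := sh₁.mono hsub₁
  have fh := fh₁.mono_left hsub₁
  have h0 := fun q hq => h0₁ q (hsub₁ hq)
  have sΦ := fun c => (sΦ₁ c).mono hsub₁
  have ho := hΩ'.isOpen
  have hS' := straighten_isAdapted hΩ hS H sh fh
  have hv : ∀ {f : SF k}, FunOf Ω {.v}ᶜ f → ∀ q ∈ Ω', f (Φ q) = f (Θ q) := fun hf q hq =>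
    hf _ (hmaps hq) _ (H.mapsTo hq) fun c hc => hΦ q c hc
  -- the derivatives of the coordinate change
  have dv : ∀ q ∈ Ω', ∀ a, pd a (fun q => Φ q .v) q = (if .v = a then 1 else 0) + pd a h q :=
    fun q hq a => by
      refine ((hasPd_coord a .v q).add (sh.hasPd ho hq a)).pd_congr ho hq fun q _ => hΦv q
  have d0 : ∀ q ∈ Ω', ∀ a, pd a (fun q => Φ q (.x 0)) q = ((if a = .x 0 then 1 else 0)
      - (if a = .u then pd .u M (Θ q) else 0)
      - ∑ r : Fin k, (if a = .x r.succ then S.m 0 r.succ (Θ q) else 0)) / S.m 0 0 (Θ q) :=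
    fun q hq a => by
      rw [pd_congr ho (fun q _ => hΦ q (.x 0) (by simp)) hq, H.pd_zero_coord hΩ hS hq]
  have dc : ∀ q ∈ Ω', ∀ a c, c ≠ .v → c ≠ .x 0 →
      pd a (fun q => Φ q c) q = if c = a then 1 else 0 := fun q hq a c hc hc' => by
    rw [pd_congr ho (fun q _ => hΦ q c hc) hq, H.pd_fix hq a c hc']
  have hvh : ∀ q ∈ Ω', pd .v h q = 0 := fun q hq => fh.pd_eq_zero ho hq (by simp)
  -- These are read off from the coordinate components: the new `x^3` component is `X` applied to
  -- `M`, and `X₂'` is the new `v` component, the old one minus `X` applied to `h`, corrected by the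
  -- new `H`.
  let X₁' : SF k := fun q => X₁ (Φ q)
  let X₃' : SF k := fun q => X₃ (Φ q) + X₁ (Φ q) * pd .u M (Θ q)
  let X₂' : SF k := fun q => X₂ (Φ q) - S.H (Φ q) * X₁ (Φ q)
    + (S.straighten M Θ h).H q * X₁' q - X₁' q * pd .u h q - X₃' q * pd .u M (Θ q)
  have s₁ : Smooth Ω' X₁' := h₁.comp sΦ hmaps
  have s₃ : Smooth Ω' X₃' := (h₃.comp sΦ hmaps).add (s₁.mul (sg.mono hsub₁))
  refine ⟨S.straighten M Θ h, Ω', Φ, X₁', X₂', X₃', hΩ', hS', ⟨q₀, hq₀', hΦq₀⟩,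
    fun q hq => ⟨?_, fun r => ?_⟩, s₁,
    ((((h₂.comp sΦ hmaps).sub ((hS.smooth_H.comp sΦ hmaps).mul s₁)).add (hS'.smooth_H.mul s₁)).sub
      (s₁.mul (sh.pd ho .u))).sub (s₃.mul (sg.mono hsub₁)), s₃, ?_,
    straighten_split hΩ hS hT H sh fh h0⟩
  · rw [hΦ q _ (by simp), H.fix q hq _ (by simp)]
  · rw [hΦ q _ (by simp), H.fix q hq _ (by simp)]
  refine ⟨sΦ, hmaps, fun q hq q' hq' hqq => ?_, fun q hq c => ?_, fun q hq a b => ?_,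
    fun q hq c => ?_⟩
  -- The image determines `u` and the `x^r` directly, the new `x^3` as the value of `M`, and then
  -- `v`, because `h` is independent of `v`.
  · have hΘ : ∀ c, c ≠ .v → Θ q c = Θ q' c := fun c hc => by rw [← hΦ q c hc, hqq, hΦ q' c hc]
    have hc : ∀ c ∈ ({.v}ᶜ : Set (Coord k)), q c = q' c := fun c hc => by
      by_cases hc0 : c = .x 0
      · rw [hc0, ← H.M_eq q hq, ← H.M_eq q' hq']
        exact H.funOf_M _ (H.mapsTo hq) _ (H.mapsTo hq') hΘ
      · rw [← H.fix q hq c hc0, ← H.fix q' hq' c hc0, hΘ c hc]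
    ext c
    by_cases hcv : c = .v
    · subst hcv
      have := congr_fun hqq .v
      rw [hΦv, hΦv, fh q hq q' hq' hc] at this
      linarith
    · exact hc c hcv
  · by_cases hc : c = .v
    · subst hc; rw [dv q hq, hvh q hq]; simp
    · by_cases hc0 : c = .x 0
      · subst hc0; rw [d0 q hq]; simp
      · rw [dc q hq _ c hc hc0]
  · have hp := H.mapsTo hq
    have m0 := hS.diag 0 _ hp
    -- The covector `m_3` pulls back to `dx^3 - M_{,u} du`. In its square, `M_{,u}²` is absorbed by
    -- the new `H`, and the cross term cancels against `h_{,3} = M_{,u}` in `2 du dh`.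
    have e0 : ∀ a, S.m 0 0 (Θ q) * pd a (fun q => Φ q (.x 0)) q
        + ∑ r : Fin k, S.m 0 r.succ (Θ q) * pd a (fun q => Φ q (.x r.succ)) q
        = (Pi.single a 1 : Pt k) (.x 0) - pd .u M (Θ q) * (Pi.single a 1 : Pt k) .u := fun a => by
      simp only [d0 q hq, dc q hq a (.x (Fin.succ _)) (by simp) (by simp), Pi.single_apply,
        eq_comm (a := a), mul_ite, mul_one, mul_zero]
      field_simp
      ring
    have eh : ∀ a, pd a h q = (Pi.single a 1 : Pt k) .u * pd .u h q
        + (Pi.single a 1 : Pt k) (.x 0) * pd .u M (Θ q)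
        + ∑ r : Fin k, pd (.x r.succ) h q * (Pi.single a 1 : Pt k) (.x r.succ) := fun a => by
      have : pd a h q = ∑ c, (Pi.single a 1 : Pt k) c * pd c h q := by simp [Pi.single_apply]
      rw [this, sum_coord, hvh q hq, Fin.sum_univ_succ, h0 q hq]
      simp only [mul_comm ((Pi.single a 1 : Pt k) (.x (Fin.succ _)))]
      ring
    have es : ∀ a (r : Fin k), pd a (fun q => Φ q (.x r.succ)) q
        = (Pi.single a 1 : Pt k) (.x r.succ) := fun a r => by
      rw [dc q hq a _ (by simp) (by simp), Pi.single_apply]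
    have eu : ∀ a, pd a (fun q => Φ q .u) q = (Pi.single a 1 : Pt k) .u := fun a => by
      rw [dc q hq a _ (by simp) (by simp), Pi.single_apply]
    have ev : ∀ a, pd a (fun q => Φ q .v) q = (Pi.single a 1 : Pt k) .v + pd a h q := fun a => by
      rw [dv q hq a, Pi.single_apply]
    rw [metric_eq_ip, ← ip_comm_eq, ip_eq, ip_eq]
    simp only [Fin.sum_univ_succ (n := k), straighten_m_zero_zero, straighten_m_zero_succ,
      straighten_m_succ, straighten_What_zero, straighten_What_succ, hv (hS.funOf_m _ _) q hq,
      hv (hS.funOf_What _) q hq, hv hS.funOf_H q hq, hS.What_three _ hp, m_succ_zero hS hp, e0,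
      Pi.zero_apply, zero_mul, zero_add, Finset.sum_const_zero, add_zero, one_mul]
    simp only [es, eu, ev, add_mul, Finset.sum_add_distrib]
    rw [eh a, eh b]
    simp only [straighten]
    ring
  · have hp := hmaps hq
    have hY : ∀ r : Fin k, (S.straighten M Θ h).field X₁' X₂' X₃' q (.x r.succ) = 0 :=
      field_x_succ hS' hq _ _ _
    have hY0 : (S.straighten M Θ h).field X₁' X₂' X₃' q (.x 0) = X₃' q := by
      rw [field_x_zero hS' hq, straighten_m_zero_zero, div_one]
    by_cases hcv : c = .v
    · subst hcv
      simp only [dv q hq, mul_add, Finset.sum_add_distrib, mul_ite, mul_one, mul_zero,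
        Finset.sum_ite_eq, Finset.mem_univ, if_true]
      simp only [sum_coord, Fin.sum_univ_succ, hY, hY0, h0 q hq, hvh q hq, field_u,
        field_v hS' hq, field_v hS hp, zero_mul, mul_zero, Finset.sum_const_zero, add_zero]
      simp only [X₂']
      ring
    by_cases hc0 : c = .x 0
    · subst hc0
      simp only [sum_coord, Fin.sum_univ_succ, hY, hY0, field_u, field_x_zero hS hp, d0 q hq,
        hv (hS.funOf_m _ _) q hq]
      simp [(Fin.succ_ne_zero _).symm, X₁', X₃']
      ring
    · simp only [dc q hq _ c hcv hc0, mul_ite, mul_one, mul_zero, Finset.sum_ite_eq,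
        Finset.mem_univ, if_true]
      cases c with
      | u => rw [field_u, field_u]
      | v => exact absurd rfl hcv
      | x e =>
        induction e using Fin.cases with
        | zero => exact absurd rfl hc0
        | succ r => rw [hY, field_x_succ hS hp]

end Data

end Kundt

/-! ### Assembly of the cases -/

theorem mainTheorem1 (k : ℕ) (Ω : Set (Pt k)) (hΩ : IsBox Ω) (S : Data k) (hS : S.IsAdapted Ω) :
    -- The Killing equations for `X = X₁ n + X₂ ℓ + X₃ m_3`, in the frame.
    (∀ X₁ X₂ X₃ : SF k, Smooth Ω X₁ → Smooth Ω X₂ → Smooth Ω X₃ →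
      ∀ Xt : Fin (k + 1) → SF k, Xt = (fun i => if i = 0 then X₃ else 0) →
      (S.IsKilling Ω (S.field X₁ X₂ X₃) ↔ ∀ p ∈ Ω,
        pd .v X₁ p = 0 ∧
        pd .u X₁ p + pd .v X₂ p = 0 ∧
        (∑ e, S.mUp 0 e p * pd (.x e) X₁ p) + pd .v X₃ p = 0 ∧
        (∀ n : Fin k, ∑ e, S.mUp n.succ e p * pd (.x e) X₁ p = 0) ∧
        S.D2 X₂ p + ∑ i, S.J i p * Xt i p = 0 ∧
        (∀ i, S.D i X₂ p + S.D2 (Xt i) p - S.J i p * X₁ p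
          - ∑ j, (S.A j i p + S.B i j p) * Xt j p = 0) ∧
        (∀ i j, S.D j (Xt i) p + S.D i (Xt j) p + 2 * S.Bsym i j p * X₁ p
          - ∑ l, (S.Γ (.tr l) (.tr i) (.tr j) p + S.Γ (.tr l) (.tr j) (.tr i) p) * Xt l p
            = 0))) ∧
    -- The form of the components and the two cases.
    (∀ X₁ X₂ X₃ : SF k, Smooth Ω X₁ → Smooth Ω X₂ → Smooth Ω X₃ →
      S.IsKilling Ω (S.field X₁ X₂ X₃) →
      (∃ F₁ F₂ F₃ : SF k, Smooth Ω F₁ ∧ Smooth Ω F₂ ∧ Smooth Ω F₃ ∧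
        FunOf Ω {.v}ᶜ F₁ ∧ FunOf Ω {.v}ᶜ F₂ ∧ FunOf Ω {.v}ᶜ F₃ ∧
        ∀ p ∈ Ω, X₁ p = F₁ p ∧ X₂ p = - S.D2 X₁ p * p .v + F₂ p ∧
          X₃ p = - S.D 0 X₁ p * p .v + F₃ p) ∧
      ((∀ p ∈ Ω, S.D 0 X₁ p = 0) ∨ S.ThreeParallel Ω) ∧
      ((∀ p ∈ Ω, S.D 0 X₁ p = 0) → ∃ c₁ c₂ : ℝ, ∀ p ∈ Ω, X₁ p = c₁ * p .u + c₂)) ∧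
    -- Case 1, normalisation: `X₁ = u` if `c₁ ≠ 0`, and `X₁ = 1` if `c₁ = 0 ≠ c₂`.
    (∀ X₁ X₂ X₃ : SF k, Smooth Ω X₁ → Smooth Ω X₂ → Smooth Ω X₃ →
      S.IsKilling Ω (S.field X₁ X₂ X₃) →
      ∀ c₁ c₂ : ℝ, (∀ p ∈ Ω, X₁ p = c₁ * p .u + c₂) →
      (c₁ ≠ 0 → ∃ (S' : Data k) (Ω' : Set (Pt k)) (Φ : Pt k → Pt k) (X₂' X₃' : SF k),
        IsBox Ω' ∧ S'.IsAdapted Ω' ∧ Smooth Ω' X₂' ∧ Smooth Ω' X₃' ∧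
        (∀ q, Φ q = Function.update q .u (q .u - c₂ / c₁)) ∧ Φ '' Ω' = Ω ∧
        IsCoordChange S Ω (fun p c => c₁⁻¹ * S.field X₁ X₂ X₃ p c)
          S' Ω' (S'.field (fun q => q .u) X₂' X₃') Φ) ∧
      (c₁ = 0 → c₂ ≠ 0 → ∃ X₂' X₃' : SF k, Smooth Ω X₂' ∧ Smooth Ω X₃' ∧
        ∀ p ∈ Ω, ∀ c, c₂⁻¹ * S.field X₁ X₂ X₃ p c = S.field (fun _ => 1) X₂' X₃' p c)) ∧
    -- Subcase 1.1 (i): `X₁ = u`, `F₃ = 0`.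
    ((∀ p ∈ Ω, p .u ≠ 0) → ∀ F₂ : SF k, Smooth Ω F₂ → FunOf Ω {.v}ᶜ F₂ →
      (S.IsKilling Ω (S.field (fun p => p .u) (fun p => - p .v + F₂ p) 0) ↔
        (∀ e f, FunOf Ω {.u, .v}ᶜ (S.gT e f)) ∧
        ∃ (f₂ g₂ : SF k) (b : Fin k → SF k),
          Smooth Ω f₂ ∧ FunOf Ω {.u, .v}ᶜ f₂ ∧ Smooth Ω g₂ ∧ FunOf Ω {.v, .x 0}ᶜ g₂ ∧
          (∀ n, Smooth Ω (b n) ∧ FunOf Ω {.u, .v}ᶜ (b n)) ∧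
          ∀ p ∈ Ω, F₂ p = f₂ p / p .u + g₂ p / p .u ∧
            S.H p = f₂ p / p .u ^ 2 - pd .u g₂ p / p .u + g₂ p / p .u ^ 2 ∧
            ∀ n : Fin k, S.W n.succ p = (b n p - S.D n.succ g₂ p) / p .u) ∧
      (S.IsKilling Ω (S.field (fun p => p .u) (fun p => - p .v + F₂ p) 0) → ∀ p₀ ∈ Ω,
        ∃ (S' : Data k) (Ω' : Set (Pt k)) (Φ : Pt k → Pt k) (h F₂' f₂ g₂ : SF k)
          (b : Fin k → SF k),
          IsBox Ω' ∧ S'.IsAdapted Ω' ∧ p₀ ∈ Φ '' Ω' ∧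
          Smooth Ω' h ∧ FunOf Ω' {.v, .x 0}ᶜ h ∧
          (∀ q ∈ Ω', Φ q = Function.update q .v (q .v + h q)) ∧
          Smooth Ω' F₂' ∧ FunOf Ω' {.v}ᶜ F₂' ∧
          IsCoordChange S Ω (S.field (fun p => p .u) (fun p => - p .v + F₂ p) 0)
            S' Ω' (S'.field (fun p => p .u) (fun p => - p .v + F₂' p) 0) Φ ∧
          (∀ e f, FunOf Ω' {.u, .v}ᶜ (S'.gT e f)) ∧
          Smooth Ω' f₂ ∧ FunOf Ω' {.u, .v}ᶜ f₂ ∧ Smooth Ω' g₂ ∧ FunOf Ω' {.u} g₂ ∧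
          (∀ n, Smooth Ω' (b n) ∧ FunOf Ω' {.u, .v}ᶜ (b n)) ∧
          ∀ q ∈ Ω', F₂' q = f₂ q / q .u + g₂ q / q .u ∧
            S'.H q = f₂ q / q .u ^ 2 - pd .u g₂ q / q .u + g₂ q / q .u ^ 2 ∧
            ∀ n : Fin k, S'.W n.succ q = b n q / q .u)) ∧
    -- Subcase 1.1 (ii): `X₁ = 1`, `F₃ = 0`.
    (∀ o ∈ Ω, ∀ F₂ : SF k, Smooth Ω F₂ → FunOf Ω {.v}ᶜ F₂ →
      (S.IsKilling Ω (S.field (fun _ => 1) F₂ 0) ↔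
        (∀ e f, FunOf Ω {.u, .v}ᶜ (S.gT e f)) ∧
        (∀ p ∈ Ω, pd .u F₂ p = 0) ∧
        ∃ (A₀ : SF k) (C : Fin k → SF k), Smooth Ω A₀ ∧ FunOf Ω {.v, .x 0}ᶜ A₀ ∧
          (∀ n, Smooth Ω (C n) ∧ FunOf Ω {.u, .v}ᶜ (C n)) ∧
          ∀ p ∈ Ω, S.H p = F₂ p + A₀ p ∧
            ∀ n : Fin k, S.W n.succ p = antider o .u (S.D n.succ A₀) p + C n p)) ∧
    -- Subcase 1.2 (i): `X₁ = u`.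
    ((∀ p ∈ Ω, p .u ≠ 0) → ∀ o ∈ Ω, ∀ F₂ F₃ : SF k, Smooth Ω F₂ → Smooth Ω F₃ →
      FunOf Ω {.v}ᶜ F₂ → FunOf Ω {.v}ᶜ F₃ →
      (S.IsKilling Ω (S.field (fun p => p .u) (fun p => - p .v + F₂ p) F₃) ↔
        (∃ A₁ : SF k, Smooth Ω A₁ ∧ FunOf Ω {.u, .v}ᶜ A₁ ∧
          ∀ p ∈ Ω, S.m 0 0 p = - antider o .u (fun q => pd (.x 0) F₃ q / q .u) p + A₁ p) ∧
        (∀ p ∈ Ω, ∀ n r : Fin k, pd .u (S.m n.succ r.succ) p =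
          - pd (.x 0) (S.m n.succ r.succ) p * F₃ p / (S.m 0 0 p * p .u)) ∧
        (∀ p ∈ Ω, ∀ r : Fin k, pd .u (S.m 0 r.succ) p =
          - pd (.x r.succ) F₃ p / p .u - (pd (.x 0) (S.m 0 r.succ) p
            - pd (.x r.succ) (S.m 0 0) p) * S.mUp 0 0 p * F₃ p / p .u) ∧
        (∀ p ∈ Ω, S.H p = - S.D2 F₂ p - S.D2 (F₃ ^ 2) p / (2 * p .u)
          - F₃ p * S.D 0 F₂ p / p .u - F₃ p * S.D 0 (F₃ ^ 2) p / (2 * p .u ^ 2)) ∧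
        (∀ p ∈ Ω, p .u * S.D 0 S.H p =
          S.D 0 F₂ p + S.D2 F₃ p + S.D 0 (F₃ ^ 2) p / (2 * p .u)) ∧
        (∀ p ∈ Ω, ∀ n : Fin k, S.D2 (fun q => q .u * S.W n.succ q) p
          + F₃ p * S.D 0 (S.W n.succ) p
          + S.D n.succ (fun q => F₂ q - q .u * S.H q) p = 0))) ∧
    -- Subcase 1.2 (ii): `X₁ = 1`.
    (∀ o ∈ Ω, ∀ F₂ F₃ : SF k, Smooth Ω F₂ → Smooth Ω F₃ →
      FunOf Ω {.v}ᶜ F₂ → FunOf Ω {.v}ᶜ F₃ →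
      (S.IsKilling Ω (S.field (fun _ => 1) F₂ F₃) ↔
        (∃ A₁ : SF k, Smooth Ω A₁ ∧ FunOf Ω {.u, .v}ᶜ A₁ ∧
          ∀ p ∈ Ω, S.m 0 0 p = - antider o .u (pd (.x 0) F₃) p + A₁ p) ∧
        (∀ p ∈ Ω, ∀ n r : Fin k, pd .u (S.m n.succ r.succ) p =
          - pd (.x 0) (S.m n.succ r.succ) p * F₃ p / S.m 0 0 p) ∧
        (∀ p ∈ Ω, ∀ r : Fin k, pd .u (S.m 0 r.succ) p =
          - pd (.x r.succ) F₃ p - (pd (.x 0) (S.m 0 r.succ) p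
            - pd (.x r.succ) (S.m 0 0) p) * S.mUp 0 0 p * F₃ p) ∧
        (∀ p ∈ Ω, S.D2 F₂ p + F₃ p * S.D 0 F₂ p + 1 / 2 * S.D2 (F₃ ^ 2) p
          + 1 / 2 * F₃ p * S.D 0 (F₃ ^ 2) p = 0) ∧
        (∃ A₂ : SF k, Smooth Ω A₂ ∧ FunOf Ω {.v, .x 0}ᶜ A₂ ∧
          ∀ p ∈ Ω, S.H p = antider o (.x 0) (fun q => S.m 0 0 q * S.D2 F₃ q) p
            + F₂ p + 1 / 2 * F₃ p ^ 2 + A₂ p) ∧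
        (∀ p ∈ Ω, ∀ n : Fin k, F₃ p * S.D 0 (S.W n.succ) p + S.D2 (S.W n.succ) p
          = S.D n.succ (fun q => S.H q - F₂ q) p))) ∧
    -- Subcase 1.2 (iii): `X₁ = 0`, `F₃ ≠ 0`.
    (∀ o ∈ Ω, ∀ F₂ F₃ : SF k, Smooth Ω F₂ → Smooth Ω F₃ →
      FunOf Ω {.v}ᶜ F₂ → FunOf Ω {.v}ᶜ F₃ → (∀ p ∈ Ω, F₃ p ≠ 0) →
      (S.IsKilling Ω (S.field 0 F₂ F₃) ↔
        (∀ p ∈ Ω, pd (.x 0) F₃ p = 0) ∧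
        (∀ p ∈ Ω, ∀ n r : Fin k, pd (.x 0) (S.m n.succ r.succ) p = 0) ∧
        (∀ p ∈ Ω, ∀ r : Fin k, pd (.x r.succ) F₃ p + (pd (.x 0) (S.m 0 r.succ) p
            - pd (.x r.succ) (S.m 0 0) p) * S.mUp 0 0 p * F₃ p = 0) ∧
        (∀ p ∈ Ω, S.D2 (fun q => Real.log (S.m 0 0 q)) p =
          S.D 0 F₂ p / F₃ p + S.D2 (fun q => Real.log (F₃ q)) p) ∧
        (∃ E : Fin k → SF k, (∀ n, Smooth Ω (E n) ∧ FunOf Ω {.v, .x 0}ᶜ (E n)) ∧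
          ∀ p ∈ Ω, ∀ n : Fin k, S.W n.succ p =
            - antider o (.x 0) (fun q => S.m 0 0 q * S.D n.succ F₂ q / F₃ q) p + E n p) ∧
        (∃ A₃ : SF k, Smooth Ω A₃ ∧ FunOf Ω {.v, .x 0}ᶜ A₃ ∧
          ∀ p ∈ Ω, S.H p =
            - antider o (.x 0) (fun q => S.m 0 0 q * S.D2 F₂ q / F₃ q) p + A₃ p))) ∧
    -- Case 2: `Γ_{3ia} = 0`; the form of the coframe, and the two subcases.
    (S.ThreeParallel Ω → ∀ X₁ X₂ X₃ : SF k, Smooth Ω X₁ → Smooth Ω X₂ → Smooth Ω X₃ →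
      ∀ p₀ ∈ Ω, ∃ (S' : Data k) (Ω' : Set (Pt k)) (Φ : Pt k → Pt k) (X₁' X₂' X₃' : SF k),
        IsBox Ω' ∧ S'.IsAdapted Ω' ∧ p₀ ∈ Φ '' Ω' ∧
        (∀ q ∈ Ω', Φ q .u = q .u ∧ ∀ r : Fin k, Φ q (.x r.succ) = q (.x r.succ)) ∧
        Smooth Ω' X₁' ∧ Smooth Ω' X₂' ∧ Smooth Ω' X₃' ∧
        IsCoordChange S Ω (S.field X₁ X₂ X₃) S' Ω' (S'.field X₁' X₂' X₃') Φ ∧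
        S'.Split Ω') ∧
    ((∀ r : Fin k, ∀ p ∈ Ω, S.m 0 r.succ p = 0) → (S.ThreeParallel Ω ↔ S.Split Ω)) ∧
    (S.Split Ω → ∀ X₁ X₂ X₃ : SF k, Smooth Ω X₁ → Smooth Ω X₂ → Smooth Ω X₃ →
      S.IsKilling Ω (S.field X₁ X₂ X₃) →
      FunOf Ω {.u, .x 0} X₁ ∧
      (∀ p ∈ Ω, ∀ m n : Fin k, S.Bsym m.succ n.succ p * X₁ p = 0) ∧
      ((∀ p ∈ Ω, X₁ p = 0) ∨ (∀ p ∈ Ω, ∀ m n : Fin k, S.Bsym m.succ n.succ p = 0))) ∧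
    -- Case 2.1: `X₁ = 0`.
    (S.Split Ω → ∀ o ∈ Ω, ∀ F₂ F₃ : SF k, Smooth Ω F₂ → Smooth Ω F₃ →
      FunOf Ω {.v}ᶜ F₂ → FunOf Ω {.v}ᶜ F₃ → (∀ p ∈ Ω, F₃ p ≠ 0) →
      (S.IsKilling Ω (S.field 0 F₂ F₃) ↔
        (∀ p ∈ Ω, ∀ r : Fin k, pd (.x r.succ) F₂ p = 0) ∧
        (∀ p ∈ Ω, ∀ e, pd (.x e) F₃ p = 0) ∧
        (∀ p ∈ Ω, S.D2 (fun q => Real.log (S.m 0 0 q)) p =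
          S.D 0 F₂ p / F₃ p + S.D2 (fun q => Real.log (F₃ q)) p) ∧
        (∃ E : Fin k → SF k, (∀ n, Smooth Ω (E n) ∧ FunOf Ω {.v, .x 0}ᶜ (E n)) ∧
          ∀ p ∈ Ω, ∀ n : Fin k, S.W n.succ p =
            - antider o (.x 0) (fun q => S.m 0 0 q * S.D n.succ F₂ q / F₃ q) p + E n p) ∧
        (∃ A₃ : SF k, Smooth Ω A₃ ∧ FunOf Ω {.v, .x 0}ᶜ A₃ ∧
          ∀ p ∈ Ω, S.H p =
            - antider o (.x 0) (fun q => S.m 0 0 q * S.D2 F₂ q / F₃ q) p + A₃ p))) ∧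
    -- Case 2.2: `B_(mn) = 0`; consequences, and the solution when `F_{1,3} ≠ 0`.
    (S.Split Ω → (∀ p ∈ Ω, ∀ m n : Fin k, S.Bsym m.succ n.succ p = 0) →
      ∀ p ∈ Ω, (∀ n r : Fin k, pd .u (S.m n.succ r.succ) p = 0) ∧
        (∀ r : Fin k, S.mUp r.succ 0 p = 0) ∧
        (∀ i j, ¬ (i = 0 ∧ j = 0) → S.B i j p = 0)) ∧
    (S.Split Ω → ∀ o ∈ Ω, ∀ F₁ F₂ F₃ : SF k, Smooth Ω F₁ → Smooth Ω F₂ → Smooth Ω F₃ →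
      FunOf Ω {.u, .x 0} F₁ → FunOf Ω {.v}ᶜ F₂ → FunOf Ω {.v}ᶜ F₃ →
      (∀ p ∈ Ω, pd (.x 0) F₁ p ≠ 0) →
      (S.IsKilling Ω (S.field F₁ (fun p => - S.D2 F₁ p * p .v + F₂ p)
          (fun p => - S.D 0 F₁ p * p .v + F₃ p)) ↔
        (∀ p ∈ Ω, ∀ m n : Fin k, S.Bsym m.succ n.succ p = 0) ∧
        (∀ p ∈ Ω, pd (.x 0) (S.m 0 0) p / S.m 0 0 p
            = pd (.x 0) (pd (.x 0) F₁) p / pd (.x 0) F₁ p ∧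
          pd .u (S.m 0 0) p / S.m 0 0 p = pd .u (pd (.x 0) F₁) p / pd (.x 0) F₁ p) ∧
        (∀ p ∈ Ω, S.H p = S.D 0 (S.D2 F₁) p / S.D 0 F₁ p ^ 2 * F₃ p
          - S.D2 (S.D2 F₁) p / S.D 0 F₁ p ^ 2 * F₁ p
          - (S.D2 F₃ p + S.D 0 F₂ p) / S.D 0 F₁ p) ∧
        (∀ p ∈ Ω, ∀ n : Fin k, S.W n.succ p = - S.D n.succ F₃ p / S.D 0 F₁ p) ∧
        (∃ A₆ : SF k, Smooth Ω A₆ ∧ FunOf Ω {.v, .x 0}ᶜ A₆ ∧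
          ∀ p ∈ Ω, F₃ p = - antider o (.x 0)
            (fun q => S.m 0 0 q * F₁ q * S.D 0 (S.D2 F₁) q / S.D 0 F₁ q) p + A₆ p) ∧
        (∀ p ∈ Ω, S.D2 F₂ p + S.H p * S.D2 F₁ p + F₃ p * S.D 0 S.H p = 0) ∧
        (∀ p ∈ Ω, S.D2 (S.D2 F₁) p + S.D 0 F₁ p * S.D 0 S.H p = 0) ∧
        (∀ p ∈ Ω, ∀ n : Fin k, S.D2 (fun q => F₁ q * S.W n.succ q) p + S.D n.succ F₂ p
          - F₁ p * S.D n.succ S.H p = 0))) := by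
  refine ⟨fun X₁ X₂ X₃ h₁ h₂ h₃ Xt hXt => Data.isKilling_field_iff hΩ hS h₁ h₂ h₃ Xt hXt,
    fun X₁ X₂ X₃ h₁ h₂ h₃ hK => ?_, fun X₁ X₂ X₃ h₁ h₂ h₃ _ c₁ c₂ hX₁ =>
      ⟨fun hc => Data.exists_translation hΩ hS h₂ h₃ hX₁ hc, fun hc₁ hc₂ =>
        ⟨fun p => c₂⁻¹ * X₂ p, fun p => c₂⁻¹ * X₃ p, (Smooth.const _).mul h₂,
          (Smooth.const _).mul h₃, fun p hp c => ?_⟩⟩,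
    fun hu F₂ h₂ hF₂ => ⟨Data.isKilling_u_iff hΩ hS hu h₂ hF₂,
      Data.exists_shift hΩ hS hu h₂ hF₂⟩,
    fun o ho F₂ h₂ hF₂ => Data.isKilling_one_iff hΩ hS ho h₂ hF₂,
    fun hu o ho F₂ F₃ h₂ h₃ hF₂ hF₃ => Data.isKilling_u_general_iff hΩ hS hu ho h₂ h₃ hF₂ hF₃,
    fun o ho F₂ F₃ h₂ h₃ hF₂ hF₃ => Data.isKilling_one_general_iff hΩ hS ho h₂ h₃ hF₂ hF₃,
    fun o ho F₂ F₃ h₂ h₃ hF₂ hF₃ h0 => Data.isKilling_zero_general_iff hΩ hS ho h₂ h₃ hF₂ hF₃ h0,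
    fun hT X₁ X₂ X₃ h₁ h₂ h₃ => Data.exists_split hΩ hS hT h₁ h₂ h₃,
    Data.threeParallel_iff_split hΩ hS,
    fun hs X₁ X₂ X₃ h₁ h₂ h₃ hK => hs.killing hΩ hS h₁ h₂ h₃
      ((Data.isKilling_iff_killingAt hΩ hS h₁ h₂ h₃).1 hK),
    fun hs o ho F₂ F₃ h₂ h₃ hF₂ hF₃ h0 => hs.isKilling_zero_iff hΩ hS ho h₂ h₃ hF₂ hF₃ h0,
    fun hs hB p hp => ⟨(Data.Bsym_eq_zero_iff hΩ hS hp).1 (hB p hp),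
      fun r => hs.mUp_succ_zero hS hp r, hs.B_eq_zero hΩ hS hp (hB p hp)⟩,
    fun hs o ho F₁ F₂ F₃ h₁ h₂ h₃ hF₁ hF₂ hF₃ h0 =>
      hs.isKilling_iff hΩ hS ho h₁ h₂ h₃ hF₁ hF₂ hF₃ h0⟩
  · have K := (Data.isKilling_iff_killingAt hΩ hS h₁ h₂ h₃).1 hK
    refine ⟨Data.killing_form hΩ hS h₁ h₂ h₃ K, ?_, Data.killing_affine hΩ hS h₁ h₂ h₃ K⟩
    -- Because `c` is a constant, the alternative between the two cases holds on all of `Ω` rather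
    -- than point by point.
    obtain ⟨c, hc⟩ := Data.exists_const_of_killingAt hΩ hS h₁ h₂ h₃ K
    by_cases h0 : c = 0
    · exact Or.inl fun p hp => by rw [Data.D_zero_eq hS hp, (hc p hp).2, h0]; simp
    · exact Or.inr (Data.threeParallel_of_killingAt hΩ hS h₁ h₂ h₃ K h0 hc)
  · simp only [Data.field, hX₁ p hp, hc₁]
    field_simp
    ring
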